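/- Let $F$ be a totally real number field with adele ring $\mathbb{A}_F$, let $F_\infty=\prod_{v\mid\infty}F_v$, and let $F_{\infty,+}^\times$ be the identity component of $F_\infty^\times$ (the totally positive elements). Let $B=MN$ be the upper triangular Borel subgroup of $\mathrm{SL}_2$, with $M$ the diagonal and $N$ the upper unipotent subgroup. Let $K=\prod_{v\mid\infty}\mathrm{SO}(2)\times\prod_{v<\infty}\mathrm{SL}_2(\mathcal{O}_{F_v})$, let $\mathfrak{g}=\prod_{v\mid\infty}\mathfrak{sl}_2(\mathbb{C})$ be the complexified Lie algebra of $\mathrm{SL}_2(F_\infty)$, acting on smooth functions on $\mathrm{SL}_2(\mathbb{A}_F)$ by right differentiation, let $\mathcal{Z}$ be the centre of the universal enveloping algebra of $\mathfrak{g}$, and let $\mathfrak{p}_-\subset\mathfrak{g}$ be the antiholomorphic tangent space at the base point $(i,\dots,i)$ of the product of upper half planes, i.e. the product over $v\mid\infty$ of the lines spanned by $\tfrac12\begin{pmatrix}1&-i\\-i&-1\end{pmatrix}$. An automorphic form is a smooth function $\varphi:\mathrm{SL}_2(F)\backslash\mathrm{SL}_2(\mathbb{A}_F)\to\mathbb{C}$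 that is right $K$-finite, $\mathcal{Z}$-finite and slowly increasing; it is nearly holomorphic if $\mathfrak{p}_-^m\cdot\varphi=0$ for some integer $m\ge1$. Its constant term along $B$ is $$\varphi_0(g)=\int_{N(F)\backslash N(\mathbb{A}_F)}\varphi(ng)\,dn,\qquad g\in\mathrm{SL}_2(\mathbb{A}_F),$$ where $dn$ is a Haar measure. For a Hecke character $\mu$ and $s\in\mathbb{C}$, let $\mathrm{Ind}_{B(\mathbb{A}_F)}^{\mathrm{SL}_2(\mathbb{A}_F)}(\mu|\cdot|^s)$ be the space of smooth right $K$-finite functions $f$ on $\mathrm{SL}_2(\mathbb{A}_F)$ such that $$f\left(\begin{pmatrix}a&0\\0&a^{-1}\end{pmatrix}ng\right)=\mu(a)\,|a|^{s+1}f(g)\qquad(a\in\mathbb{A}_F^\times,\ n\in N(\mathbb{A}_F),\ g\in\mathrm{SL}_2(\mathbb{A}_F)).$$ **Proposition.** For every nearly holomorphic automorphic form $\varphi$ on $\mathrm{SL}_2(\mathbb{A}_F)$ there exist an integer $\ell\ge0$, Hecke characters $\mu_1,\dots,\mu_\ell$ of $F^\times F_{\infty,+}^\times\backslash\mathbb{A}_F^\times$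 (continuous homomorphisms $\mathbb{A}_F^\times\to\mathbb{C}^\times$ trivial on $F^\times F_{\infty,+}^\times$), integers $s_1,\dots,s_\ell$, and functions $\phi_i\in\mathrm{Ind}_{B(\mathbb{A}_F)}^{\mathrm{SL}_2(\mathbb{A}_F)}(\mu_i|\cdot|^{s_i})$ such that $$\varphi_0=\sum_{i=1}^{\ell}\phi_i .$$ -/

import Mathlib

open NumberField NumberField.InfinitePlace IsDedekindDomain MeasureTheory Topology Matrix
open scoped ContDiff

noncomputable section

namespace NearlyHolomorphic

/-! ## One-parameter subgroups of `SL₂(ℝ)` -/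

/-- The exponential of a traceless real `2 × 2` matrix has determinant one. -/
theorem det_exp_sl (X : LieAlgebra.SpecialLinear.sl (Fin 2) ℝ) :
    (NormedSpace.exp X.1).det = 1 := by
  have htr : X.1 0 0 + X.1 1 1 = 0 := by
    have h : Matrix.trace X.1 = 0 := X.2
    rwa [Matrix.trace_fin_two] at h
  set A : Matrix (Fin 2) (Fin 2) ℝ := X.1 with hA
  let J : Matrix (Fin 2) (Fin 2) ℝ := !![0, 1; -1, 0]
  have hJinv : J⁻¹ = !![0, -1; 1, 0] := by
    apply Matrix.inv_eq_right_inv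
    ext i j
    fin_cases i <;> fin_cases j <;> simp [J, Matrix.mul_apply, Fin.sum_univ_two]
  have hJ : IsUnit J := by
    rw [Matrix.isUnit_iff_isUnit_det]
    simp [J, Matrix.det_fin_two]
  have h1 : J * Aᵀ * J⁻¹ = -A := by
    rw [hJinv]
    ext i j
    fin_cases i <;> fin_cases j <;>
      simp [J, Matrix.mul_apply, Matrix.vecMul, dotProduct, Fin.sum_univ_two] <;> linarith
  have h2 : J * (NormedSpace.exp A)ᵀ * J⁻¹ = (NormedSpace.exp A)⁻¹ := by
    rw [← Matrix.exp_transpose, ← Matrix.exp_conj J _ hJ, h1, Matrix.exp_neg]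
  have h3 : J * (NormedSpace.exp A)ᵀ * J⁻¹ = (NormedSpace.exp A).adjugate := by
    rw [hJinv, Matrix.adjugate_fin_two]
    ext i j
    fin_cases i <;> fin_cases j <;>
      simp [J, Matrix.mul_apply, Matrix.vecMul, dotProduct, Fin.sum_univ_two]
  have hu : IsUnit (NormedSpace.exp A).det :=
    (Matrix.isUnit_iff_isUnit_det _).1 (Matrix.isUnit_exp A)
  have h4 : (NormedSpace.exp A) * (NormedSpace.exp A).adjugate = 1 := by
    rw [← h3, h2, Matrix.mul_nonsing_inv _ hu]
  rw [Matrix.mul_adjugate] at h4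
  have h5 := congrFun (congrFun h4 0) 0
  simpa using h5

/-- The exponential map `𝔰𝔩₂(ℝ) → SL₂(ℝ)`. -/
def expSL (X : LieAlgebra.SpecialLinear.sl (Fin 2) ℝ) : Matrix.SpecialLinearGroup (Fin 2) ℝ :=
  ⟨NormedSpace.exp X.1, det_exp_sl X⟩

/-- The linear coordinates `(a, b, c) ↦ !![a, b; c, -a]` on `𝔰𝔩₂(ℝ)`. -/
def slOfCoord (x : Fin 3 → ℝ) : LieAlgebra.SpecialLinear.sl (Fin 2) ℝ :=
  ⟨!![x 0, x 1; x 2, -x 0], by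
    change Matrix.trace (!![x 0, x 1; x 2, -x 0] : Matrix (Fin 2) (Fin 2) ℝ) = 0
    simp [Matrix.trace_fin_two]⟩

/-- Entrywise real part `𝔰𝔩₂(ℂ) → 𝔰𝔩₂(ℝ)`. -/
def slRe (Z : LieAlgebra.SpecialLinear.sl (Fin 2) ℂ) : LieAlgebra.SpecialLinear.sl (Fin 2) ℝ :=
  ⟨Z.1.map Complex.re, by
    have h : Matrix.trace Z.1 = 0 := Z.2
    change Matrix.trace (Z.1.map Complex.re) = 0
    rw [Matrix.trace_fin_two] at h ⊢
    simpa using congrArg Complex.re h⟩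

/-- Entrywise imaginary part `𝔰𝔩₂(ℂ) → 𝔰𝔩₂(ℝ)`. -/
def slIm (Z : LieAlgebra.SpecialLinear.sl (Fin 2) ℂ) : LieAlgebra.SpecialLinear.sl (Fin 2) ℝ :=
  ⟨Z.1.map Complex.im, by
    have h : Matrix.trace Z.1 = 0 := Z.2
    change Matrix.trace (Z.1.map Complex.im) = 0
    rw [Matrix.trace_fin_two] at h ⊢
    simpa using congrArg Complex.im h⟩

/-- The lowering element `(1/2) !![1, -i; -i, -1]` of `𝔰𝔩₂(ℂ)`.  It spans the antiholomorphic
tangent space of the upper half plane at `i`: on `g ↦ f (g • i)` it acts at `g = 1` as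
`-2i ∂f/∂z̄ (i)`. -/
def lowering : LieAlgebra.SpecialLinear.sl (Fin 2) ℂ :=
  ⟨!![1 / 2, -Complex.I / 2; -Complex.I / 2, -1 / 2], by
    change Matrix.trace (!![1 / 2, -Complex.I / 2; -Complex.I / 2, -1 / 2] :
      Matrix (Fin 2) (Fin 2) ℂ) = 0
    rw [Matrix.trace_fin_two]
    simp
    ring⟩

/-- The upper unipotent matrix `!![1, x; 0, 1]`. -/
def unip {R : Type*} [CommRing R] (x : R) : Matrix.SpecialLinearGroup (Fin 2) R :=
  ⟨!![1, x; 0, 1], by simp [Matrix.det_fin_two]⟩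

theorem unip_add {R : Type*} [CommRing R] (x y : R) : unip (x + y) = unip x * unip y := by
  apply Matrix.SpecialLinearGroup.ext
  intro i j
  rw [Matrix.SpecialLinearGroup.coe_mul]
  fin_cases i <;> fin_cases j <;>
    simp [unip, Matrix.mul_apply, Fin.sum_univ_two, add_comm]

theorem map_unip {R S : Type*} [CommRing R] [CommRing S] (f : R →+* S) (x : R) :
    Matrix.SpecialLinearGroup.map f (unip x) = unip (f x) := by
  apply Matrix.SpecialLinearGroup.ext
  intro i j
  rw [Matrix.SpecialLinearGroup.map_apply_coe]
  fin_cases i <;> fin_cases j <;> simp [unip]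

/-- The diagonal matrix `diag(a, a⁻¹)`. -/
def diagSL {R : Type*} [CommRing R] (a : Rˣ) : Matrix.SpecialLinearGroup (Fin 2) R :=
  ⟨!![(a : R), 0; 0, ((a⁻¹ : Rˣ) : R)], by simp [Matrix.det_fin_two]⟩

/-! ## The adele group `SL₂(𝔸_F)` of a totally real field -/

variable (F : Type*) [Field F] [NumberField F]

/-- The adele ring `𝔸_F = F_∞ × 𝔸_{F,fin}`. -/
abbrev Adele := AdeleRing (𝓞 F) F

/-- The additive quotient group `𝔸_F / F`, which is `N(F) \ N(𝔸_F)` for the upper unipotent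
subgroup `N`. -/
abbrev AdeleQuot := Adele F ⧸ AdeleRing.principalSubgroup (𝓞 F) F

/-- The group `SL₂(𝔸_F) = (Res_{F/ℚ} SL₂)(𝔸_ℚ)`. -/
abbrev GA := Matrix.SpecialLinearGroup (Fin 2) (Adele F)

/-- The complexified Lie algebra `∏_{v ∣ ∞} 𝔰𝔩₂(ℂ)` of `∏_{v ∣ ∞} SL₂(F_v)`. -/
abbrev LieG := InfinitePlace F → LieAlgebra.SpecialLinear.sl (Fin 2) ℂ

/-- Products of Lie rings, with componentwise bracket. -/
instance piLieRing {ι : Type*} (L : ι → Type*) [∀ i, LieRing (L i)] : LieRing (∀ i, L i) where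
  bracket X Y := fun i => ⁅X i, Y i⁆
  add_lie X Y Z := funext fun i => add_lie (X i) (Y i) (Z i)
  lie_add X Y Z := funext fun i => lie_add (X i) (Y i) (Z i)
  lie_self X := funext fun i => lie_self (X i)
  leibniz_lie X Y Z := funext fun i => leibniz_lie (X i) (Y i) (Z i)

/-- Products of Lie algebras. -/
instance piLieAlgebra {ι R : Type*} [CommRing R] (L : ι → Type*) [∀ i, LieRing (L i)]
    [∀ i, LieAlgebra R (L i)] : LieAlgebra R (∀ i, L i) where
  lie_smul t X Y := funext fun i => lie_smul t (X i) (Y i)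

variable {F}

/-- The element of `U(𝔤)` represented by a formal linear combination of words in `𝔤`. -/
def envOf (T : List (LieG F) →₀ ℂ) : UniversalEnvelopingAlgebra ℂ (LieG F) :=
  T.sum fun w c => c • (w.map (UniversalEnvelopingAlgebra.ι ℂ)).prod

/-- The diagonal embedding `SL₂(F) → SL₂(𝔸_F)`. -/
def rational (γ : Matrix.SpecialLinearGroup (Fin 2) F) : GA F :=
  Matrix.SpecialLinearGroup.map (algebraMap F (Adele F)) γ

/-- The idelic absolute value `|a| = ∏_v |a_v|_v`, with `|·|_v` the normalized absolute values. -/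
def ideleAbs (a : (Adele F)ˣ) : ℝ :=
  (∏ v : InfinitePlace F, ‖(a : Adele F).1 v‖ ^ v.mult) *
    ∏ᶠ v : HeightOneSpectrum (𝓞 F), ‖(a : Adele F).2 v‖

/-- The height `‖g‖ = ∏_v max_{i,j} |g_{ij}|_v` on `SL₂(𝔸_F)` (the entries of `g⁻¹` are, up to
sign, those of `g`). -/
def height (g : GA F) : ℝ :=
  (∏ v : InfinitePlace F, (⨆ p : Fin 2 × Fin 2, ‖(g p.1 p.2).1 v‖) ^ v.mult) *
    ∏ᶠ v : HeightOneSpectrum (𝓞 F), ⨆ p : Fin 2 × Fin 2, ‖(g p.1 p.2).2 v‖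

/-- Slowly increasing functions. -/
def SlowlyIncreasing (φ : GA F → ℂ) : Prop :=
  ∃ (C : ℝ) (N : ℕ), ∀ g, ‖φ g‖ ≤ C * height g ^ N

variable [IsTotallyReal F]

/-- The identification `F_v = ℝ` at an archimedean place of a totally real field. -/
def realIso (v : InfinitePlace F) : v.Completion ≃+* ℝ :=
  Completion.ringEquivRealOfIsReal (IsTotallyReal.isReal v)

/-- The projection `𝔸_F → F_v = ℝ` at an archimedean place. -/
def toReal (v : InfinitePlace F) : Adele F →+* ℝ where
  toFun x := realIso v (x.1 v)
  map_one' := map_one (realIso v)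
  map_mul' x y := map_mul (realIso v) (x.1 v) (y.1 v)
  map_zero' := map_zero (realIso v)
  map_add' x y := map_add (realIso v) (x.1 v) (y.1 v)

/-- The archimedean component `SL₂(𝔸_F) → ∏_{v ∣ ∞} SL₂(ℝ)`. -/
def archPart (g : GA F) (v : InfinitePlace F) : Matrix.SpecialLinearGroup (Fin 2) ℝ :=
  Matrix.SpecialLinearGroup.map (toReal v) g

/-- The embedding `∏_{v ∣ ∞} SL₂(ℝ) → SL₂(𝔸_F)`, trivial at all finite places. -/
def archIncl (h : InfinitePlace F → Matrix.SpecialLinearGroup (Fin 2) ℝ) : GA F :=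
  ⟨Matrix.of fun i j =>
    ((fun v => (realIso v).symm (h v i j), (1 : Matrix (Fin 2) (Fin 2) (FiniteAdeleRing (𝓞 F) F)) i j) :
      InfiniteAdeleRing F × FiniteAdeleRing (𝓞 F) F), by
    rw [Matrix.det_fin_two]
    refine Prod.ext (funext fun v => ?_) ?_
    · change (realIso v).symm (h v 0 0) * (realIso v).symm (h v 1 1) -
        (realIso v).symm (h v 0 1) * (realIso v).symm (h v 1 0) = 1
      have hd := (h v).det_coe
      rw [Matrix.det_fin_two] at hd
      rw [← map_mul, ← map_mul, ← map_sub, hd, map_one]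
    · change (1 : Matrix (Fin 2) (Fin 2) (FiniteAdeleRing (𝓞 F) F)) 0 0 *
        (1 : Matrix (Fin 2) (Fin 2) (FiniteAdeleRing (𝓞 F) F)) 1 1 -
        (1 : Matrix (Fin 2) (Fin 2) (FiniteAdeleRing (𝓞 F) F)) 0 1 *
        (1 : Matrix (Fin 2) (Fin 2) (FiniteAdeleRing (𝓞 F) F)) 1 0 = 1
      simp⟩

/-- The standard maximal compact subgroup `∏_{v ∣ ∞} SO(2) × ∏_{v < ∞} SL₂(𝓞_v)`. -/
def maximalCompact : Set (GA F) :=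
  {g | (∀ v, (archPart g v : Matrix (Fin 2) (Fin 2) ℝ) ∈ Matrix.orthogonalGroup (Fin 2) ℝ) ∧
    ∀ (v : HeightOneSpectrum (𝓞 F)) (i j : Fin 2), (g i j).2 v ∈ v.adicCompletionIntegers F}

/-! ## Automorphic forms -/

/-- Right `K`-finiteness: the right translates by `K` span a finite-dimensional space. -/
def KFinite (φ : GA F → ℂ) : Prop :=
  FiniteDimensional ℂ
    (Submodule.span ℂ {ψ : GA F → ℂ | ∃ k ∈ maximalCompact (F := F), ψ = fun g => φ (g * k)})

/-- Smooth functions on `SL₂(𝔸_F)`: near every point the function depends on the archimedean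
component only, and it is `C^∞` in the archimedean variables (in exponential coordinates around
every point). -/
structure Smooth (φ : GA F → ℂ) : Prop where
  locally_arch : ∀ g : GA F, ∃ V ∈ 𝓝 g, ∀ h ∈ V, ∀ h' ∈ V, archPart h = archPart h' → φ h = φ h'
  arch_smooth : ∀ g : GA F, ContDiffAt ℝ ∞
    (fun x : InfinitePlace F → Fin 3 → ℝ =>
      φ (g * archIncl fun v => expSL (slOfCoord (x v)))) 0

/-- `(X φ)(g) = d/dt φ(g exp(tX))` at `t = 0`, for `X` in the real Lie algebra. -/
def lieDerivReal (X : InfinitePlace F → LieAlgebra.SpecialLinear.sl (Fin 2) ℝ)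
    (φ : GA F → ℂ) : GA F → ℂ :=
  fun g => deriv (fun t : ℝ => φ (g * archIncl fun v => expSL (t • X v))) 0

/-- The complex-linear extension of the action by right differentiation to `𝔤`. -/
def lieDeriv (Z : LieG F) (φ : GA F → ℂ) : GA F → ℂ :=
  fun g => lieDerivReal (fun v => slRe (Z v)) φ g +
    Complex.I * lieDerivReal (fun v => slIm (Z v)) φ g

/-- The action of a word `X₁ X₂ ⋯ X_m`, that is `φ ↦ X₁ (X₂ (⋯ (X_m φ)))`. -/
def wordAct (w : List (LieG F)) (φ : GA F → ℂ) : GA F → ℂ :=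
  w.foldr lieDeriv φ

/-- The action on functions of a formal linear combination of words in `𝔤`.  On smooth functions
it depends only on the image of the combination in the universal enveloping algebra. -/
def envAct (T : List (LieG F) →₀ ℂ) (φ : GA F → ℂ) : GA F → ℂ :=
  T.sum fun w c => c • wordAct w φ

/-- `𝒵`-finiteness, where `𝒵` is the centre of `U(𝔤)`: the space `𝒵 φ` is finite-dimensional. -/
def ZFinite (φ : GA F → ℂ) : Prop :=
  FiniteDimensional ℂ
    (Submodule.span ℂ {ψ : GA F → ℂ | ∃ T : List (LieG F) →₀ ℂ,
      envOf T ∈ Subalgebra.center ℂ (UniversalEnvelopingAlgebra ℂ (LieG F)) ∧ ψ = envAct T φ})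

/-- Automorphic forms on `SL₂(𝔸_F)`. -/
structure IsAutomorphicForm (φ : GA F → ℂ) : Prop where
  left_invariant : ∀ (γ : Matrix.SpecialLinearGroup (Fin 2) F) (g : GA F), φ (rational γ * g) = φ g
  smooth : Smooth φ
  kFinite : KFinite φ
  zFinite : ZFinite φ
  slowlyIncreasing : SlowlyIncreasing φ

/-- The subalgebra `𝔭₋ = ∏_{v ∣ ∞} ℂ · L_v` of `𝔤`, with `L_v` the lowering element at `v`. -/
def pMinus : Submodule ℂ (LieG F) :=
  Submodule.pi Set.univ fun _ => Submodule.span ℂ {lowering}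

/-- `𝔭₋`-finiteness: `𝔭₋^m φ = 0` for some `m ≥ 1`. -/
def IsNearlyHolomorphic (φ : GA F → ℂ) : Prop :=
  ∃ m : ℕ, 1 ≤ m ∧ ∀ w : List (LieG F), w.length = m → (∀ X ∈ w, X ∈ pMinus (F := F)) →
    wordAct w φ = 0

/-! ## The constant term along the Borel subgroup -/

/-- The function `n ↦ φ(n g)` on `N(F) \ N(𝔸_F) = F \ 𝔸_F`. -/
def unipFiber (φ : GA F → ℂ) (hφ : IsAutomorphicForm φ) (g : GA F) :
    AdeleQuot F → ℂ :=
  Quotient.lift (fun x : Adele F => φ (unip x * g)) (by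
    intro x y hxy
    obtain ⟨ξ, hξ⟩ := QuotientAddGroup.leftRel_apply.1 hxy
    have hy : y = algebraMap F (Adele F) ξ + x := by
      rw [hξ]; ring
    have hu : (unip y : GA F) = rational (unip ξ) * unip x := by
      rw [hy, unip_add, rational, map_unip]
    simp only [hu, mul_assoc, hφ.left_invariant])

/-- The constant term `φ₀(g) = ∫_{N(F) \ N(𝔸_F)} φ(n g) dn`, for a Haar measure `dn`. -/
def constantTerm [MeasurableSpace (AdeleQuot F)]
    (dn : Measure (AdeleQuot F))
    (φ : GA F → ℂ) (hφ : IsAutomorphicForm φ) (g : GA F) : ℂ :=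
  ∫ x, unipFiber φ hφ g x ∂dn

/-! ## Hecke characters and induced representations -/

variable (F) in
/-- Hecke characters of `F^× F_{∞,+}^× \ 𝔸_F^×`: continuous characters `𝔸_F^× → ℂ^×` that are
trivial on `F^×` and on the totally positive elements of `F_∞^×`. -/
structure HeckeCharacter where
  toHom : (Adele F)ˣ →* ℂˣ
  continuous_toHom : Continuous toHom
  map_principal : ∀ x : Fˣ, toHom (Units.map (algebraMap F (Adele F) : F →* Adele F) x) = 1
  map_arch_pos : ∀ a : (Adele F)ˣ, (∀ v : InfinitePlace F, 0 < toReal v (a : Adele F)) →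
    (a : Adele F).2 = 1 → toHom a = 1

/-- The (normalized) induced representation `Ind_{B(𝔸_F)}^{SL₂(𝔸_F)}(μ |·|^s)`: smooth right
`K`-finite functions with `f(m n g) = μ(a) |a|^{s+1} f(g)` for `m = diag(a, a⁻¹)` and `n` upper
unipotent. -/
def Ind (μ : HeckeCharacter F) (s : ℂ) : Set (GA F → ℂ) :=
  {f | Smooth f ∧ KFinite f ∧ ∀ (a : (Adele F)ˣ) (x : Adele F) (g : GA F),
    f (diagSL a * unip x * g) = (μ.toHom a : ℂ) * (ideleAbs a : ℂ) ^ (s + 1) * f g}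

end NearlyHolomorphic

end

/-! # Constant terms of nearly holomorphic automorphic forms on `SL₂`

Let `φ` be a nearly holomorphic form and `h` its constant term. Since `φ` is `K`-finite, it is a
finite sum of vectors of weight `k_v` under the rotations at each archimedean place `v`, all still
killed by powers of the lowering operators `L_v` (`mem_iSup_weight`); so let `φ` have weight `k`.

Write `H, E` for the diagonal and upper triangular generators of `𝔰𝔩₂`. On vectors of weight `k_v`
one has `H = 2 L_v + k_v + 2 i E` (`lowerAt_of_weight`), and `E` kills constant terms along the torus.
The constant terms `f_j` of `L_v^j φ`, restricted to the torus at `v`, therefore satisfy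
`f_j' = 2 f_{j+1} + (k_v - 2j) f_j`, with `f_m = 0`. This triangular system has distinct exponents, so
`h` is a combination of the exponentials `exp ((k_v - 2i) t)` with `i < m`
(`exists_exponential_sum`, `unipAverage_mem_expSpan`). Consequently `h` is a finite sum of
simultaneous eigenfunctions of the archimedean torus with integral exponents `e_v`
(`mem_iSup_torusEigenspace`).

Consider a nonzero such eigenfunction. By smoothness and `K`-finiteness it is right invariant under
an open subgroup of the finite adelic points (`KFinite.eventually_right_invariant`). By the Iwasawa
decomposition and compactness of `K`, an open subgroup of the ideles acts on it from the left through
`c ↦ ∏_v |c_v|^{e_v}` (`eventually_apply_diagSL_mul`). For a unit `u` of `F`, a power of `u` can be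
moved into this subgroup, and principal ideles act trivially, so that `∏_v |u|_v^{e_v} = 1`
(`archWeight_unit`). By Dirichlet's unit theorem all the `e_v` equal one integer `s`
(`exists_parallel_exponent`).

After twisting by `|·|^{-s}`, the ideles act on the eigenfunction through a quotient by an open
subgroup containing `F^×` and the totally positive archimedean ideles. This quotient is finite
(`finiteIndex_of_isOpen`), and Fourier inversion on it decomposes the eigenfunction into elements of
`Ind (μ |·|^{s-1})`, for Hecke characters `μ` (`mem_indSpan`). Eigenfunctions are smooth because the
Iwasawa decomposition makes them explicit in the archimedean variables (`smooth_of_eigenfunction`).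
-/

noncomputable section

namespace NearlyHolomorphic

/-! ### Integral adeles and strong approximation -/

section IntegralAdeles

variable {F : Type*} [Field F] [NumberField F]

theorem norm_lt_norm_iff (v : HeightOneSpectrum (𝓞 F)) (x y : v.adicCompletion F) :
    ‖x‖ < ‖y‖ ↔ Valued.v x < Valued.v y := by
  rw [FinitePlace.norm_def, FinitePlace.norm_def, NNReal.coe_lt_coe]
  exact (WithZeroMulInt.toNNReal_strictMono (HeightOneSpectrum.one_lt_absNorm_nnreal v)).lt_iff_lt

theorem norm_le_norm_iff (v : HeightOneSpectrum (𝓞 F)) (x y : v.adicCompletion F) :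
    ‖x‖ ≤ ‖y‖ ↔ Valued.v x ≤ Valued.v y := by
  rw [← not_lt, norm_lt_norm_iff, not_lt]

theorem mem_integers_iff_norm (v : HeightOneSpectrum (𝓞 F)) (x : v.adicCompletion F) :
    x ∈ v.adicCompletionIntegers F ↔ ‖x‖ ≤ 1 := by
  rw [HeightOneSpectrum.mem_adicCompletionIntegers, ← norm_one (α := v.adicCompletion F),
    norm_le_norm_iff, map_one]

/-- The ring of integers of `F` is dense in the valuation ring of the completion at `v`. -/
theorem exists_norm_sub_lt (v : HeightOneSpectrum (𝓞 F)) {x : v.adicCompletion F}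
    (hx : ‖x‖ ≤ 1) {ε : ℝ} (hε : 0 < ε) :
    ∃ a : 𝓞 F, ‖x - algebraMap F (v.adicCompletion F) (algebraMap (𝓞 F) F a)‖ < ε := by
  have hd := HeightOneSpectrum.denseRange_algebraMap (R := 𝓞 F) (K := F) v
  obtain ⟨ϖ, hϖ⟩ := HeightOneSpectrum.valuation_exists_uniformizer F v
  set p : v.adicCompletion F := algebraMap F _ ϖ with hp
  have hvp : Valued.v p = v.valuation F ϖ := HeightOneSpectrum.valuedAdicCompletion_eq_valuation' v ϖ
  have hp1 : ‖p‖ < 1 := by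
    rw [← norm_one (α := v.adicCompletion F), norm_lt_norm_iff, hvp, map_one, hϖ]
    exact WithZero.exp_lt_exp.2 (by norm_num : (-1 : ℤ) < 0)
  have hp0 : p ≠ 0 := by
    intro h
    rw [h, map_zero, hϖ] at hvp
    exact absurd hvp.symm (by simp)
  obtain ⟨n, hn⟩ := exists_pow_lt_of_lt_one hε hp1
  obtain ⟨k, hk⟩ := hd.exists_dist_lt x (ε := ‖p ^ n‖) (norm_pos_iff.2 (pow_ne_zero _ hp0))
  rw [dist_eq_norm] at hk
  have hpn : ‖p ^ n‖ ≤ 1 := by rw [norm_pow]; exact pow_le_one₀ (norm_nonneg _) hp1.le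
  have hvk : Valued.v (algebraMap F (v.adicCompletion F) k) = v.valuation F k :=
    HeightOneSpectrum.valuedAdicCompletion_eq_valuation' v k
  have hk1 : algebraMap F (v.adicCompletion F) k ∈ v.adicCompletionIntegers F := by
    have h1 : x ∈ v.adicCompletionIntegers F := (mem_integers_iff_norm v x).2 hx
    have h2 : x - algebraMap F (v.adicCompletion F) k ∈ v.adicCompletionIntegers F :=
      (mem_integers_iff_norm v _).2 (hk.le.trans hpn)
    simpa using sub_mem h1 h2
  rw [HeightOneSpectrum.mem_adicCompletionIntegers, hvk] at hk1
  have hϖ0 : v.valuation F (ϖ ^ n) ≠ 0 := by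
    rw [map_pow, hϖ]; exact pow_ne_zero _ (by simp)
  obtain ⟨a, ha⟩ := HeightOneSpectrum.exists_valuation_sub_lt_of_integer v hk1 (Units.mk0 _ hϖ0)
  refine ⟨a, ?_⟩
  have h3 : x - algebraMap F (v.adicCompletion F) (algebraMap (𝓞 F) F a) =
      (x - algebraMap F (v.adicCompletion F) k) +
        (-(algebraMap F (v.adicCompletion F) (algebraMap (𝓞 F) F a - k))) := by
    rw [map_sub]; ring
  have h4 : Valued.v (x - algebraMap F (v.adicCompletion F) (algebraMap (𝓞 F) F a)) <
      Valued.v (p ^ n) := by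
    rw [h3]
    refine Valuation.map_add_lt _ ((norm_lt_norm_iff _ _ _).1 hk) ?_
    rw [Valuation.map_neg]
    have := HeightOneSpectrum.valuedAdicCompletion_eq_valuation' v (algebraMap (𝓞 F) F a - k)
    have h5 : Valued.v (algebraMap F (v.adicCompletion F) (algebraMap (𝓞 F) F a - k)) =
      v.valuation F (algebraMap (𝓞 F) F a - k) := this
    rw [h5, map_pow, hvp, ← map_pow]
    exact ha
  exact ((norm_lt_norm_iff _ _ _).2 h4).trans (by rwa [norm_pow])

instance finite_residue (v : HeightOneSpectrum (𝓞 F)) :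
    Finite (IsLocalRing.ResidueField (v.adicCompletionIntegers F)) := by
  have : Finite (𝓞 F ⧸ v.asIdeal) := v.asIdeal.finiteQuotientOfFreeOfNeBot v.ne_bot
  let f : 𝓞 F →+* IsLocalRing.ResidueField (v.adicCompletionIntegers F) :=
    (IsLocalRing.residue _).comp (algebraMap (𝓞 F) (v.adicCompletionIntegers F))
  have hmem : ∀ z : v.adicCompletionIntegers F, ‖(z : v.adicCompletion F)‖ < 1 →
      IsLocalRing.residue _ z = 0 := by
    intro z hz
    rw [IsLocalRing.residue_eq_zero_iff, IsLocalRing.mem_maximalIdeal, mem_nonunits_iff,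
      HeightOneSpectrum.adicCompletionIntegers.isUnit_iff_valued_eq_one]
    rw [← norm_one (α := v.adicCompletion F), norm_lt_norm_iff, map_one] at hz
    exact hz.ne
  have hf : ∀ a ∈ v.asIdeal, f a = 0 := by
    intro a ha
    apply hmem
    exact (FinitePlace.norm_lt_one_iff_mem F v a).2 ha
  refine Finite.of_surjective (Ideal.Quotient.lift v.asIdeal f hf) ?_
  apply Ideal.Quotient.lift_surjective_of_surjective
  intro y
  obtain ⟨x, rfl⟩ := IsLocalRing.residue_surjective y
  obtain ⟨a, ha⟩ := exists_norm_sub_lt v ((mem_integers_iff_norm v _).1 x.2) one_pos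
  refine ⟨a, ?_⟩
  have := hmem (x - algebraMap (𝓞 F) (v.adicCompletionIntegers F) a) ha
  rw [map_sub, sub_eq_zero] at this
  exact this.symm

instance compactSpace_integers (v : HeightOneSpectrum (𝓞 F)) :
    CompactSpace (v.adicCompletionIntegers F) := by
  have := (Valued.integer.compactSpace_iff_completeSpace_and_isDiscreteValuationRing_and_finite_residueField
    (K := v.adicCompletion F) (Γ₀ := WithZero (Multiplicative ℤ))).2
  refine this ⟨?_, inferInstanceAs (IsDiscreteValuationRing (v.adicCompletionIntegers F)), finite_residue v⟩
  have hc : IsClosed (v.adicCompletionIntegers F : Set (v.adicCompletion F)) :=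
    Valued.isClosed_valuationSubring _
  exact hc.completeSpace_coe

variable (F) in
/-- The open compact subring `Ô = ∏_v 𝓞_v` of the finite adeles. -/
def integralAdeles : Set (FiniteAdeleRing (𝓞 F) F) :=
  {a | ∀ v, a v ∈ v.adicCompletionIntegers F}

theorem integralAdeles_eq_range : integralAdeles F =
    Set.range (RestrictedProduct.structureMap
      (fun v : HeightOneSpectrum (𝓞 F) => v.adicCompletion F)
      (fun v => (v.adicCompletionIntegers F : Set (v.adicCompletion F))) Filter.cofinite) := by
  rw [RestrictedProduct.range_structureMap]
  rfl

theorem isCompact_integralAdeles : IsCompact (integralAdeles F) := by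
  rw [integralAdeles_eq_range]
  have (v : HeightOneSpectrum (𝓞 F)) :
    CompactSpace ((v.adicCompletionIntegers F : Set (v.adicCompletion F))) := compactSpace_integers v
  exact isCompact_range RestrictedProduct.isEmbedding_structureMap.continuous

theorem isOpen_integralAdeles : IsOpen (integralAdeles F) :=
  RestrictedProduct.isOpen_forall_mem fun _ => Valued.isOpen_valuationSubring _

/-- Finite adeles have a common integral denominator. -/
theorem exists_integral_mul (a : FiniteAdeleRing (𝓞 F) F) :
    ∃ d : 𝓞 F, d ≠ 0 ∧ ∀ v : HeightOneSpectrum (𝓞 F),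
      ‖a v * algebraMap F (v.adicCompletion F) (algebraMap (𝓞 F) F d)‖ ≤ 1 := by
  classical
  choose b hb hab using fun v => HeightOneSpectrum.adicCompletion.mul_nonZeroDivisor_mem_adicCompletionIntegers v (a v)
  have hfin : {v | ¬ a v ∈ v.adicCompletionIntegers F}.Finite := a.2
  refine ⟨∏ v ∈ hfin.toFinset, b v, Finset.prod_ne_zero_iff.2 fun v _ => nonZeroDivisors.ne_zero (hb v), ?_⟩
  intro v
  have hint : ∀ r : 𝓞 F, ‖algebraMap F (v.adicCompletion F) (algebraMap (𝓞 F) F r)‖ ≤ 1 :=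
    fun r => FinitePlace.norm_le_one F v r
  by_cases hv : v ∈ hfin.toFinset
  · rw [← Finset.mul_prod_erase _ _ hv, map_mul, map_mul, ← mul_assoc, norm_mul]
    exact mul_le_one₀ ((mem_integers_iff_norm _ _).1 (hab v)) (norm_nonneg _) (hint _)
  · rw [norm_mul]
    refine mul_le_one₀ ((mem_integers_iff_norm _ _).1 ?_) (norm_nonneg _) (hint _)
    simpa using hv

/-- Strong approximation for the additive group: `𝔸_{F,fin} = F + Ô`. -/
theorem exists_sub_mem_integralAdeles (a : FiniteAdeleRing (𝓞 F) F) :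
    ∃ x : F, a - algebraMap F (FiniteAdeleRing (𝓞 F) F) x ∈ integralAdeles F := by
  classical
  obtain ⟨d, hd0, hd⟩ := exists_integral_mul a
  set j := fun v : HeightOneSpectrum (𝓞 F) => fun r : 𝓞 F =>
    algebraMap F (v.adicCompletion F) (algebraMap (𝓞 F) F r) with hj
  have hjd : ∀ v, 0 < ‖j v d‖ := fun v => norm_pos_iff.2 (by simpa [hj] using hd0)
  choose r hr using fun v => exists_norm_sub_lt v (hd v) (hjd v)
  have hfin : {v : HeightOneSpectrum (𝓞 F) | v.asIdeal ∣ Ideal.span {d}}.Finite :=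
    Ideal.finite_factors (by simpa using hd0)
  have hexp : ∀ v : HeightOneSpectrum (𝓞 F), ∃ n : ℕ, ∀ z ∈ v.asIdeal ^ n, ‖j v z‖ ≤ ‖j v d‖ := by
    intro v
    refine ⟨multiplicity v.asIdeal (Ideal.span {d}), fun z hz => ?_⟩
    rw [← HeightOneSpectrum.intValuation_le_pow_iff_mem,
      ← HeightOneSpectrum.intValuation_eq_exp_neg_multiplicity v hd0] at hz
    rw [norm_le_norm_iff]
    have e : ∀ y : 𝓞 F, Valued.v (j v y) = v.intValuation y := fun y => by
      rw [← HeightOneSpectrum.valuation_of_algebraMap (K := F)]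
      exact HeightOneSpectrum.valuedAdicCompletion_eq_valuation' v _
    rwa [e, e]
  choose n hn using hexp
  obtain ⟨y, hy⟩ := IsDedekindDomain.exists_forall_sub_mem_ideal (s := hfin.toFinset)
    (fun v : HeightOneSpectrum (𝓞 F) => v.asIdeal) n (fun v _ => v.prime)
    (fun v _ w _ hvw h => hvw (HeightOneSpectrum.ext h)) (fun v => r v)
  refine ⟨algebraMap (𝓞 F) F y / algebraMap (𝓞 F) F d, fun v => ?_⟩
  rw [mem_integers_iff_norm]
  have e1 : (a - algebraMap F (FiniteAdeleRing (𝓞 F) F) (algebraMap (𝓞 F) F y / algebraMap (𝓞 F) F d)) v =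
      (a v * j v d - j v y) / j v d := by
    change a v - algebraMap F (v.adicCompletion F) (algebraMap (𝓞 F) F y / algebraMap (𝓞 F) F d) = _
    rw [map_div₀, sub_div, mul_div_cancel_right₀ _ (norm_pos_iff.1 (hjd v))]
  rw [e1, norm_div, div_le_one (hjd v)]
  have hul : ∀ x y : v.adicCompletion F, ‖x + y‖ ≤ max ‖x‖ ‖y‖ := by
    intro x y
    rcases le_total ‖x‖ ‖y‖ with h | h
    · rw [max_eq_right h, norm_le_norm_iff]
      exact Valuation.map_add_le _ ((norm_le_norm_iff _ _ _).1 h) le_rfl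
    · rw [max_eq_left h, norm_le_norm_iff]
      exact Valuation.map_add_le _ le_rfl ((norm_le_norm_iff _ _ _).1 h)
  by_cases hv : v ∈ hfin.toFinset
  · have e2 : a v * j v d - j v y = (a v * j v d - j v (r v)) + (- j v (y - r v)) := by
      simp only [hj, map_sub]; ring
    rw [e2]
    refine (hul _ _).trans (max_le (hr v).le ?_)
    rw [norm_neg]
    exact hn v _ (hy v hv)
  · have h1 : ‖j v d‖ = 1 := by
      refine (FinitePlace.norm_eq_one_iff_notMem F v d).2 fun h => hv ?_
      simpa [Ideal.dvd_span_singleton] using h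
    rw [h1, sub_eq_add_neg]
    refine (hul _ _).trans (max_le (hd v) ?_)
    rw [norm_neg]
    exact FinitePlace.norm_le_one F v y

end IntegralAdeles

/-! ### Compactness of the adeles modulo the field -/

section AdeleQuotient

variable {F : Type*} [Field F] [NumberField F]

omit [NumberField F] in
theorem norm_algebraMap_infinite (v : InfinitePlace F) (x : F) :
    ‖algebraMap F (InfiniteAdeleRing F) x v‖ = v x :=
  InfinitePlace.Completion.norm_coe v (WithAbs.toAbs v.1 x)

omit [NumberField F] in
theorem infinitePlace_ratCast (v : InfinitePlace F) (q : ℚ) : v (q : F) = |(q : ℝ)| := by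
  rw [← InfinitePlace.norm_embedding_eq, map_ratCast, Complex.norm_ratCast]

variable (F) in
/-- The ring of integers is cocompact in `F_∞`. -/
theorem exists_integer_sub_bounded : ∃ M : ℝ, ∀ x : InfiniteAdeleRing F, ∃ n : 𝓞 F,
    ∀ v, ‖(x - algebraMap F (InfiniteAdeleRing F) (algebraMap (𝓞 F) F n)) v‖ ≤ M := by
  classical
  set b := integralBasis F
  refine ⟨1 + ∑ v : InfinitePlace F, ∑ i, v (b i), fun x => ?_⟩
  have hopen : {y : InfiniteAdeleRing F | ∀ v, ‖x v - y v‖ < 1} ∈ 𝓝 x := by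
    have : ∀ v : InfinitePlace F, ∀ᶠ y : InfiniteAdeleRing F in 𝓝 x, ‖x v - y v‖ < 1 := by
      intro v
      have hc : Continuous fun y : InfiniteAdeleRing F => ‖x v - y v‖ :=
        (continuous_const.sub (continuous_apply v)).norm
      refine hc.continuousAt.eventually_lt continuousAt_const ?_
      simp
    exact Filter.eventually_all.2 this
  obtain ⟨y, hy⟩ := (InfiniteAdeleRing.denseRange_algebraMap F).exists_mem_open isOpen_interior
    ⟨x, mem_interior_iff_mem_nhds.2 hopen⟩
  replace hy := interior_subset hy
  obtain ⟨c, hc⟩ : ∃ c : _ → ℚ, ∑ i, c i • b i = y := ⟨_, b.sum_repr y⟩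
  refine ⟨∑ i, ⌊c i⌋ • RingOfIntegers.basis F i, fun v => ?_⟩
  have e : algebraMap (𝓞 F) F (∑ i, ⌊c i⌋ • RingOfIntegers.basis F i) =
      y - ∑ i, ((Int.fract (c i) : ℚ) : F) * b i := by
    conv_rhs => rw [← hc]
    rw [map_sum, ← Finset.sum_sub_distrib]
    refine Finset.sum_congr rfl fun i _ => ?_
    rw [map_zsmul, ← integralBasis_apply, zsmul_eq_mul, Algebra.smul_def, ← sub_mul]
    have hfl : ((⌊c i⌋ : ℤ) : F) = (c i : F) - ((Int.fract (c i) : ℚ) : F) := by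
      rw [← Rat.cast_sub, Int.self_sub_fract, Rat.cast_intCast]
    rw [hfl]
    rfl
  rw [e, map_sub, sub_sub_eq_add_sub, add_sub_right_comm]
  refine (norm_add_le _ _).trans (add_le_add (hy v).le ?_)
  refine le_trans ?_ (Finset.single_le_sum (f := fun v : InfinitePlace F => ∑ i, v (b i))
    (fun w _ => Finset.sum_nonneg fun i _ => apply_nonneg w _) (Finset.mem_univ v))
  have hsum : ∀ f : Module.Free.ChooseBasisIndex ℤ (𝓞 F) → InfiniteAdeleRing F, (∑ i, f i) v = ∑ i, f i v :=
    fun f => Finset.sum_apply v Finset.univ f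
  rw [map_sum, hsum]
  refine (norm_sum_le _ _).trans (Finset.sum_le_sum fun i _ => ?_)
  refine (norm_algebraMap_infinite v _).trans_le ?_
  rw [map_mul, infinitePlace_ratCast]
  refine mul_le_of_le_one_left (apply_nonneg _ _) ?_
  rw [abs_of_nonneg (by exact_mod_cast Int.fract_nonneg _)]
  exact_mod_cast (Int.fract_lt_one _).le

variable (F) in
/-- A bounded subset of the adeles, meeting every class modulo `F` when `M` is large. -/
def adeleBox (M : ℝ) : Set (Adele F) := {a | (∀ v, ‖a.1 v‖ ≤ M) ∧ a.2 ∈ integralAdeles F}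

theorem isCompact_adeleBox [IsTotallyReal F] (M : ℝ) : IsCompact (adeleBox F M) := by
  have h : adeleBox F M = {x : InfiniteAdeleRing F | ∀ v, ‖x v‖ ≤ M} ×ˢ integralAdeles F := rfl
  rw [h]
  refine IsCompact.prod ?_ isCompact_integralAdeles
  have h2 : {x : InfiniteAdeleRing F | ∀ v, ‖x v‖ ≤ M} =
      Set.pi Set.univ fun v : InfinitePlace F => {y : v.Completion | ‖y‖ ≤ M} := by
    ext x; exact Set.mem_univ_pi.symm
  rw [h2]
  refine isCompact_univ_pi fun v => ?_
  let e := InfinitePlace.Completion.isometryEquivRealOfIsReal (IsTotallyReal.isReal v)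
  have h3 : {y : v.Completion | ‖y‖ ≤ M} = e.symm '' Metric.closedBall (e 0) M := by
    rw [IsometryEquiv.image_closedBall]
    ext y
    simp
  rw [h3]
  exact (isCompact_closedBall _ _).image e.symm.continuous

variable (F) in
/-- A suitable box of adeles meets every class modulo `F`. -/
theorem exists_adeleBox_cover : ∃ M : ℝ, ∀ a : Adele F, ∃ x : F,
    a - algebraMap F (Adele F) x ∈ adeleBox F M := by
  obtain ⟨M, hM⟩ := exists_integer_sub_bounded F
  refine ⟨M, fun a => ?_⟩
  obtain ⟨x, hx⟩ := exists_sub_mem_integralAdeles a.2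
  obtain ⟨n, hn⟩ := hM (a - algebraMap F (Adele F) x).1
  refine ⟨x + algebraMap (𝓞 F) F n, ?_, ?_⟩
  · intro v
    rw [map_add, ← sub_sub]
    exact hn v
  · rw [map_add, ← sub_sub]
    intro v
    refine sub_mem (hx v) ?_
    exact (mem_integers_iff_norm _ _).2 (FinitePlace.norm_le_one F v n)

instance compactSpace_adeleQuot [IsTotallyReal F] : CompactSpace (AdeleQuot F) := by
  obtain ⟨M, hM⟩ := exists_adeleBox_cover F
  refine ⟨?_⟩
  have : (Set.univ : Set (AdeleQuot F)) = QuotientAddGroup.mk '' adeleBox F M := by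
    refine (Set.eq_univ_of_forall fun q => ?_).symm
    obtain ⟨a, rfl⟩ := QuotientAddGroup.mk_surjective q
    obtain ⟨x, hx⟩ := hM a
    refine ⟨_, hx, ?_⟩
    rw [QuotientAddGroup.eq]
    exact ⟨x, by simp⟩
  rw [this]
  exact (isCompact_adeleBox M).image continuous_quotient_mk'

/-- Multiplication by a nonzero element of `F` on `𝔸_F / F`. -/
def mulQuot (x : F) : AdeleQuot F →+ AdeleQuot F :=
  QuotientAddGroup.map _ _ (AddMonoidHom.mulLeft (algebraMap F (Adele F) x)) (by
    rintro _ ⟨y, rfl⟩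
    exact ⟨x * y, by simp⟩)

theorem continuous_mulQuot (x : F) : Continuous (mulQuot x) := by
  refine continuous_quot_lift _ ?_
  exact continuous_quotient_mk'.comp (continuous_const.mul continuous_id)

theorem mulQuot_surjective {x : F} (hx : x ≠ 0) : Function.Surjective (mulQuot x) := by
  intro q
  obtain ⟨a, rfl⟩ := QuotientAddGroup.mk_surjective q
  refine ⟨((algebraMap F (Adele F) x⁻¹ * a : Adele F) : AdeleQuot F), ?_⟩
  change ((algebraMap F (Adele F) x * (algebraMap F (Adele F) x⁻¹ * a) : Adele F) : AdeleQuot F) = a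
  rw [← mul_assoc, ← map_mul, mul_inv_cancel₀ hx, map_one, one_mul]

/-- Haar measure on the compact group `𝔸_F / F` is preserved by every surjective continuous
endomorphism. -/
theorem measurePreserving_mulQuot [IsTotallyReal F] [MeasurableSpace (AdeleQuot F)]
    [BorelSpace (AdeleQuot F)] (dn : Measure (AdeleQuot F)) [dn.IsAddHaarMeasure]
    {x : F} (hx : x ≠ 0) : MeasurePreserving (mulQuot x) dn dn :=
  AddMonoidHom.measurePreserving (continuous_mulQuot x) (mulQuot_surjective hx) rfl

end AdeleQuotient

/-! ### Ideles: product formula, class groups and finite index -/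

section Ideles

variable {F : Type*} [Field F] [NumberField F]

/-- The principal idele of an element of `F^×`. -/
def principalIdele : Fˣ →* (Adele F)ˣ := Units.map (algebraMap F (Adele F) : F →* Adele F)

theorem idele_fst_ne_zero (a : (Adele F)ˣ) (v : InfinitePlace F) : (a : Adele F).1 v ≠ 0 := by
  have h : (a : Adele F).1 v * ((a⁻¹ : (Adele F)ˣ) : Adele F).1 v = 1 :=
    congrFun (congrArg Prod.fst a.mul_inv) v
  exact left_ne_zero_of_mul_eq_one h

theorem idele_snd_mul_inv (a : (Adele F)ˣ) (v : HeightOneSpectrum (𝓞 F)) :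
    (a : Adele F).2 v * ((a⁻¹ : (Adele F)ˣ) : Adele F).2 v = 1 :=
  congrArg (fun x : FiniteAdeleRing (𝓞 F) F => x v) (congrArg Prod.snd a.mul_inv)

theorem idele_snd_ne_zero (a : (Adele F)ˣ) (v : HeightOneSpectrum (𝓞 F)) :
    (a : Adele F).2 v ≠ 0 :=
  left_ne_zero_of_mul_eq_one (idele_snd_mul_inv a v)

theorem finite_norm_ne_one (a : (Adele F)ˣ) :
    {v : HeightOneSpectrum (𝓞 F) | ‖(a : Adele F).2 v‖ ≠ 1}.Finite := by
  have h1 : {v | ¬ (a : Adele F).2 v ∈ v.adicCompletionIntegers F}.Finite := (a : Adele F).2.2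
  have h2 : {v | ¬ ((a⁻¹ : (Adele F)ˣ) : Adele F).2 v ∈ v.adicCompletionIntegers F}.Finite :=
    ((a⁻¹ : (Adele F)ˣ) : Adele F).2.2
  refine (h1.union h2).subset fun v hv => ?_
  by_contra hcon
  simp only [Set.mem_union, Set.mem_ofPred_eq, not_or, not_not] at hcon
  rw [mem_integers_iff_norm, mem_integers_iff_norm] at hcon
  have h3 := congrArg norm (idele_snd_mul_inv a v)
  rw [norm_mul, norm_one] at h3
  refine hv (le_antisymm hcon.1 ?_)
  rw [← h3]
  exact mul_le_of_le_one_right (norm_nonneg _) hcon.2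

theorem ideleAbs_mul (a b : (Adele F)ˣ) : ideleAbs (a * b) = ideleAbs a * ideleAbs b := by
  unfold ideleAbs
  have h1 : ∀ v : InfinitePlace F, ‖((a * b : (Adele F)ˣ) : Adele F).1 v‖ ^ v.mult =
      ‖(a : Adele F).1 v‖ ^ v.mult * ‖(b : Adele F).1 v‖ ^ v.mult := fun v => by
    rw [← mul_pow, ← norm_mul]; rfl
  have h2 : ∀ v : HeightOneSpectrum (𝓞 F), ‖((a * b : (Adele F)ˣ) : Adele F).2 v‖ =
      ‖(a : Adele F).2 v‖ * ‖(b : Adele F).2 v‖ := fun v => by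
    rw [← norm_mul]; rfl
  simp only [h1, h2]
  rw [Finset.prod_mul_distrib, finprod_mul_distrib (finite_norm_ne_one a) (finite_norm_ne_one b)]
  ring

theorem ideleAbs_pos (a : (Adele F)ˣ) : 0 < ideleAbs a := by
  unfold ideleAbs
  refine mul_pos (Finset.prod_pos fun v _ => pow_pos (norm_pos_iff.2 (idele_fst_ne_zero a v)) _) ?_
  exact finprod_induction (fun x : ℝ => 0 < x) one_pos (fun _ _ => mul_pos)
    fun v => norm_pos_iff.2 (idele_snd_ne_zero a v)

/-- The product formula. -/
theorem ideleAbs_principal (x : Fˣ) : ideleAbs (principalIdele x) = 1 := by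
  rw [← prod_abs_eq_one (K := F) x.ne_zero]
  unfold ideleAbs
  congr 1
  · exact Finset.prod_congr rfl fun v _ => by rw [← norm_algebraMap_infinite]; rfl
  · rw [← finprod_comp_equiv (FinitePlace.equivHeightOneSpectrum (K := F)).symm]
    rfl

theorem t2Space_adele : T2Space (Adele F) := by
  have h1 : T2Space (InfiniteAdeleRing F) :=
    inferInstanceAs (T2Space ((v : InfinitePlace F) → v.Completion))
  have h2 : T2Space (FiniteAdeleRing (𝓞 F) F) :=
    inferInstanceAs (T2Space (RestrictedProduct (fun v : HeightOneSpectrum (𝓞 F) => v.adicCompletion F)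
      (fun v => (v.adicCompletionIntegers F : Set (v.adicCompletion F))) Filter.cofinite))
  exact inferInstanceAs (T2Space (InfiniteAdeleRing F × FiniteAdeleRing (𝓞 F) F))

variable (F) in
/-- The ideles lying in a box together with their inverses form a compact set, because
`c ↦ (c, c⁻¹)` is a closed embedding. For `M = 1` these are the ideles of norm one at every place. -/
theorem isCompact_unitBox [IsTotallyReal F] (M : ℝ) :
    IsCompact {c : (Adele F)ˣ | (c : Adele F) ∈ adeleBox F M ∧
      ((c⁻¹ : (Adele F)ˣ) : Adele F) ∈ adeleBox F M} := by
  have hT2 : T2Space (Adele F) := t2Space_adele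
  have hcl : IsClosedEmbedding (Units.embedProduct (Adele F)) := Units.isClosedEmbedding_embedProduct
  have hK : IsCompact (adeleBox F M ×ˢ (MulOpposite.op '' adeleBox F M)) :=
    (isCompact_adeleBox M).prod ((isCompact_adeleBox M).image MulOpposite.continuous_op)
  convert hcl.isCompact_preimage hK using 1
  ext c
  simp [Units.embedProduct]

open FractionalIdeal in
theorem count_spanSingleton (v : HeightOneSpectrum (𝓞 F)) {x : F} (hx : x ≠ 0) :
    count F v (spanSingleton (nonZeroDivisors (𝓞 F)) x) = - WithZero.log (v.valuation F x) := by
  obtain ⟨n, d, hd, rfl⟩ := IsFractionRing.div_surjective (𝓞 F) x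
  have hd0 := nonZeroDivisors.ne_zero hd
  have hn0 : n ≠ 0 := by rintro rfl; simp at hx
  rw [count_well_defined F v (spanSingleton_ne_zero_iff.2 hx) (a := d) (J := Ideal.span {n})]
  · rw [map_div₀, HeightOneSpectrum.valuation_of_algebraMap, HeightOneSpectrum.valuation_of_algebraMap,
      WithZero.log_div (HeightOneSpectrum.intValuation_ne_zero v n hn0)
        (HeightOneSpectrum.intValuation_ne_zero v d hd0),
      HeightOneSpectrum.intValuation_if_neg v hn0, HeightOneSpectrum.intValuation_if_neg v hd0,
      WithZero.log_exp, WithZero.log_exp]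
    ring
  · rw [coeIdeal_span_singleton, spanSingleton_mul_spanSingleton, div_eq_inv_mul]

/-- The fractional ideal of an idele. -/
def ideleIdeal (a : (Adele F)ˣ) : FractionalIdeal (nonZeroDivisors (𝓞 F)) F :=
  ∏ᶠ v : HeightOneSpectrum (𝓞 F),
    (v.asIdeal : FractionalIdeal (nonZeroDivisors (𝓞 F)) F) ^ (- WithZero.log (Valued.v ((a : Adele F).2 v)))

theorem count_ideleIdeal (a : (Adele F)ˣ) (v : HeightOneSpectrum (𝓞 F)) :
    FractionalIdeal.count F v (ideleIdeal a) = - WithZero.log (Valued.v ((a : Adele F).2 v)) := by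
  refine FractionalIdeal.count_finprod F v _ ?_
  refine (finite_norm_ne_one a).subset fun w hw hw1 => hw ?_
  have : Valued.v ((a : Adele F).2 w) = 1 := by
    rw [← norm_one (α := w.adicCompletion F)] at hw1
    refine le_antisymm ?_ ?_
    · have := (norm_le_norm_iff w _ _).1 hw1.le; rwa [map_one] at this
    · have := (norm_le_norm_iff w _ _).1 hw1.ge; rwa [map_one] at this
  change - WithZero.log (Valued.v ((a : Adele F).2 w)) = 0
  rw [this, WithZero.log_one, neg_zero]

theorem ideleIdeal_ne_zero (a : (Adele F)ˣ) : ideleIdeal a ≠ 0 := by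
  refine finprod_induction (fun I => I ≠ 0) one_ne_zero (fun _ _ => mul_ne_zero) fun v => ?_
  exact zpow_ne_zero _ (FractionalIdeal.coeIdeal_ne_zero.2 v.ne_bot)

/-- Two ideles with the same ideal class differ by a principal idele and an idele whose finite
components are units. -/
theorem exists_principal_of_class_eq {a b : (Adele F)ˣ}
    (h : ClassGroup.mk F (Units.mk0 _ (ideleIdeal_ne_zero a)) =
      ClassGroup.mk F (Units.mk0 _ (ideleIdeal_ne_zero b))) :
    ∃ x : Fˣ, ∀ v, ‖((a * b⁻¹ * principalIdele x : (Adele F)ˣ) : Adele F).2 v‖ = 1 := by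
  rw [← div_eq_one, ← map_div, ClassGroup.mk_eq_one_iff] at h
  obtain ⟨y, hy⟩ := h
  have hy' : (Units.mk0 _ (ideleIdeal_ne_zero a) / Units.mk0 _ (ideleIdeal_ne_zero b) :
      (FractionalIdeal (nonZeroDivisors (𝓞 F)) F)ˣ) =
      FractionalIdeal.spanSingleton (nonZeroDivisors (𝓞 F)) y := by
    apply FractionalIdeal.coeToSubmodule_injective
    exact hy.trans (FractionalIdeal.coe_spanSingleton _ y).symm
  rw [Units.val_div_eq_div_val, Units.val_mk0, Units.val_mk0, div_eq_iff (ideleIdeal_ne_zero b)] at hy'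
  have hy0 : y ≠ 0 := by
    rintro rfl
    rw [FractionalIdeal.spanSingleton_zero, zero_mul] at hy'
    exact ideleIdeal_ne_zero a hy'
  refine ⟨(Units.mk0 y hy0)⁻¹, fun v => ?_⟩
  have hc := congrArg (FractionalIdeal.count F v) hy'
  rw [FractionalIdeal.count_mul F v (FractionalIdeal.spanSingleton_ne_zero_iff.2 hy0)
    (ideleIdeal_ne_zero b), count_ideleIdeal, count_ideleIdeal, count_spanSingleton v hy0] at hc
  have hva : Valued.v ((a : Adele F).2 v) ≠ 0 := (Valuation.ne_zero_iff _).2 (idele_snd_ne_zero a v)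
  have hvb : Valued.v ((b : Adele F).2 v) ≠ 0 := (Valuation.ne_zero_iff _).2 (idele_snd_ne_zero b v)
  have hvy : v.valuation F y ≠ 0 := (Valuation.ne_zero_iff _).2 hy0
  have hab : Valued.v ((a : Adele F).2 v) = v.valuation F y * Valued.v ((b : Adele F).2 v) := by
    rw [← WithZero.exp_log hva, ← WithZero.exp_log (mul_ne_zero hvy hvb),
      WithZero.log_mul hvy hvb]
    congr 1; linarith
  set c := ((a * b⁻¹ * principalIdele (Units.mk0 y hy0)⁻¹ : (Adele F)ˣ) : Adele F).2 v with hcdef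
  have hyc : Valued.v (algebraMap F (v.adicCompletion F) y) = v.valuation F y :=
    HeightOneSpectrum.valuedAdicCompletion_eq_valuation' v y
  have e : c * (algebraMap F (v.adicCompletion F) y * (b : Adele F).2 v) = (a : Adele F).2 v := by
    have e1 : a * b⁻¹ * principalIdele (Units.mk0 y hy0)⁻¹ * (principalIdele (Units.mk0 y hy0) * b) = a := by
      rw [map_inv]; group
    exact congrArg (fun u : (Adele F)ˣ => (u : Adele F).2 v) e1
  have e2 : ‖c‖ * ‖algebraMap F (v.adicCompletion F) y * (b : Adele F).2 v‖ = ‖(a : Adele F).2 v‖ := by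
    rw [← norm_mul, e]
  have e3 : ‖algebraMap F (v.adicCompletion F) y * (b : Adele F).2 v‖ = ‖(a : Adele F).2 v‖ := by
    refine le_antisymm ?_ ?_ <;> rw [norm_le_norm_iff, map_mul, hyc, hab]
  rw [e3] at e2
  exact mul_right_cancel₀ (norm_ne_zero_iff.2 (idele_snd_ne_zero a v)) (e2.trans (one_mul _).symm)

/-- The idele with prescribed nonzero archimedean components, trivial at the finite places. -/
def archIdele [IsTotallyReal F] (y : InfinitePlace F → ℝˣ) : (Adele F)ˣ where
  val := ((fun v => (realIso v).symm (y v), 1) : InfiniteAdeleRing F × FiniteAdeleRing (𝓞 F) F)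
  inv := ((fun v => (realIso v).symm ((y v)⁻¹ : ℝˣ), 1) : InfiniteAdeleRing F × FiniteAdeleRing (𝓞 F) F)
  val_inv := Prod.ext (funext fun v => by
    change (realIso v).symm (y v) * (realIso v).symm ((y v)⁻¹ : ℝˣ) = 1
    rw [← map_mul, Units.mul_inv, map_one]) (mul_one _)
  inv_val := Prod.ext (funext fun v => by
    change (realIso v).symm ((y v)⁻¹ : ℝˣ) * (realIso v).symm (y v) = 1
    rw [← map_mul, Units.inv_mul, map_one]) (mul_one _)

theorem norm_eq_abs_toReal [IsTotallyReal F] (v : InfinitePlace F) (a : Adele F) :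
    ‖a.1 v‖ = |toReal v a| := by
  have h := (InfinitePlace.Completion.isometryEquivRealOfIsReal (IsTotallyReal.isReal v)).isometry.dist_eq
    (a.1 v) 0
  have h0 : (InfinitePlace.Completion.isometryEquivRealOfIsReal (IsTotallyReal.isReal v)) 0 = 0 :=
    map_zero (realIso v)
  rw [h0, dist_zero_right, dist_zero_right] at h
  exact h.symm

/-- An open subgroup of the ideles that contains the principal and the totally positive
archimedean ideles has finite index: the finiteness of the narrow ray class groups. -/
theorem finiteIndex_of_isOpen [IsTotallyReal F] (Γ : Subgroup (Adele F)ˣ) (hopen : IsOpen (Γ : Set (Adele F)ˣ))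
    (hprin : ∀ x : Fˣ, principalIdele x ∈ Γ)
    (harch : ∀ a : (Adele F)ˣ, (∀ v, 0 < toReal v (a : Adele F)) → (a : Adele F).2 = 1 → a ∈ Γ) :
    Finite ((Adele F)ˣ ⧸ Γ) := by
  classical
  have hdisc : DiscreteTopology ((Adele F)ˣ ⧸ Γ) := QuotientGroup.discreteTopology hopen
  set C := {c : (Adele F)ˣ | (c : Adele F) ∈ adeleBox F 1 ∧
      ((c⁻¹ : (Adele F)ˣ) : Adele F) ∈ adeleBox F 1}
  have hC : (QuotientGroup.mk '' C : Set ((Adele F)ˣ ⧸ Γ)).Finite :=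
    ((isCompact_unitBox F 1).image continuous_quotient_mk').finite_of_discrete
  let cl : (Adele F)ˣ → ClassGroup (𝓞 F) := fun a => ClassGroup.mk F (Units.mk0 _ (ideleIdeal_ne_zero a))
  let rep : ClassGroup (𝓞 F) → (Adele F)ˣ := fun κ =>
    if h : ∃ a, cl a = κ then h.choose else 1
  have hrep : ∀ a, cl (rep (cl a)) = cl a := fun a => by
    have h : ∃ a', cl a' = cl a := ⟨a, rfl⟩
    simp only [rep, dif_pos h]
    exact h.choose_spec
  have hcover : (Set.univ : Set ((Adele F)ˣ ⧸ Γ)) ⊆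
      ⋃ κ : ClassGroup (𝓞 F), (fun q => (rep κ : (Adele F)ˣ ⧸ Γ) * q) '' (QuotientGroup.mk '' C) := by
    rintro q -
    obtain ⟨a, rfl⟩ := QuotientGroup.mk_surjective q
    obtain ⟨x, hx⟩ := exists_principal_of_class_eq (hrep a).symm
    set c := a * (rep (cl a))⁻¹ * principalIdele x with hc
    have hne : ∀ v, |toReal v (c : Adele F)|⁻¹ ≠ 0 := fun v => by
      rw [← norm_eq_abs_toReal]
      exact inv_ne_zero (norm_ne_zero_iff.2 (idele_fst_ne_zero c v))
    set p : (Adele F)ˣ := archIdele fun v => Units.mk0 _ (hne v) with hp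
    have hpr : ∀ v, toReal v (p : Adele F) = |toReal v (c : Adele F)|⁻¹ := fun v =>
      (realIso v).apply_symm_apply _
    have hpΓ : p ∈ Γ := harch p (fun v => by
      rw [hpr]; exact lt_of_le_of_ne (inv_nonneg.2 (abs_nonneg _)) (hne v).symm) rfl
    have hcp1 : ∀ v, ‖((c * p : (Adele F)ˣ) : Adele F).1 v‖ = 1 := fun v => by
      rw [norm_eq_abs_toReal, Units.val_mul, map_mul, hpr, abs_mul, abs_inv, abs_abs]
      exact mul_inv_cancel₀ (fun h => hne v (by rw [h, _root_.inv_zero]))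
    have hcp2 : ∀ v, ‖((c * p : (Adele F)ˣ) : Adele F).2 v‖ = 1 := fun v => by
      have : ((c * p : (Adele F)ˣ) : Adele F).2 v = (c : Adele F).2 v := mul_one _
      rw [this]; exact hx v
    have hinv1 : ∀ v, ‖(((c * p)⁻¹ : (Adele F)ˣ) : Adele F).1 v‖ = 1 := fun v => by
      have h : ((c * p : (Adele F)ˣ) : Adele F).1 v * (((c * p)⁻¹ : (Adele F)ˣ) : Adele F).1 v = 1 :=
        congrFun (congrArg Prod.fst (c * p).mul_inv) v
      have h' := congrArg norm h
      rwa [norm_mul, hcp1, one_mul, norm_one] at h'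
    have hinv2 : ∀ v, ‖(((c * p)⁻¹ : (Adele F)ˣ) : Adele F).2 v‖ = 1 := fun v => by
      have h' := congrArg norm (idele_snd_mul_inv (c * p) v)
      rwa [norm_mul, hcp2, one_mul, norm_one] at h'
    refine Set.mem_iUnion.2 ⟨cl a, _, ⟨c * p, ⟨⟨fun v => (hcp1 v).le, fun v =>
      (mem_integers_iff_norm v _).2 (hcp2 v).le⟩, ⟨fun v => (hinv1 v).le, fun v =>
      (mem_integers_iff_norm v _).2 (hinv2 v).le⟩⟩, rfl⟩, ?_⟩
    change ((rep (cl a) * (c * p) : (Adele F)ˣ) : (Adele F)ˣ ⧸ Γ) = a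
    symm
    rw [QuotientGroup.eq, hc]
    have : a⁻¹ * (rep (cl a) * (a * (rep (cl a))⁻¹ * principalIdele x * p)) = principalIdele x * p := by
      rw [mul_comm a, mul_assoc _ a, mul_assoc _ (a * _), mul_inv_cancel_left, mul_assoc, inv_mul_cancel_left]
    rw [this]
    exact mul_mem (hprin x) hpΓ
  exact Set.finite_univ_iff.1 ((Set.finite_iUnion fun κ => hC.image _).subset hcover)

end Ideles

/-! ### The logarithmic chart of the real special linear group -/

section LogChart

/-- The coordinates `(X₀₀, X₀₁, X₁₀)` of a real matrix. -/
def entries : Matrix (Fin 2) (Fin 2) ℝ →ₗ[ℝ] (Fin 3 → ℝ) where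
  toFun A := ![A 0 0, A 0 1, A 1 0]
  map_add' A B := by ext i; fin_cases i <;> rfl
  map_smul' t A := by ext i; fin_cases i <;> rfl

/-- The coordinate parametrization of `𝔰𝔩₂(ℝ)` as a linear map to matrices. -/
def slMatrix : (Fin 3 → ℝ) →ₗ[ℝ] Matrix (Fin 2) (Fin 2) ℝ where
  toFun x := (slOfCoord x).1
  map_add' x y := by
    ext i j; fin_cases i <;> fin_cases j <;> simp [slOfCoord]
    ring
  map_smul' t x := by
    ext i j; fin_cases i <;> fin_cases j <;> simp [slOfCoord]

theorem slOfCoord_smul (t : ℝ) (x : Fin 3 → ℝ) : slOfCoord (t • x) = t • slOfCoord x :=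
  Subtype.ext (slMatrix.map_smul t x)

theorem slOfCoord_entries (X : LieAlgebra.SpecialLinear.sl (Fin 2) ℝ) :
    slOfCoord (entries X.1) = X := by
  have htr : X.1 0 0 + X.1 1 1 = 0 := by
    have h : Matrix.trace X.1 = 0 := X.2
    rwa [Matrix.trace_fin_two] at h
  apply Subtype.ext
  ext i j; fin_cases i <;> fin_cases j <;> simp [slOfCoord, entries]
  linarith

theorem entries_slMatrix (x : Fin 3 → ℝ) : entries (slMatrix x) = x := by
  ext i; fin_cases i <;> rfl

theorem contDiff_exp_entry (i j : Fin 2) :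
    ContDiff ℝ ∞ (fun x : Fin 3 → ℝ => (expSL (slOfCoord x)).1 i j) := by
  let _ : NormedRing (Matrix (Fin 2) (Fin 2) ℝ) := Matrix.linftyOpNormedRing
  let _ : NormedAlgebra ℝ (Matrix (Fin 2) (Fin 2) ℝ) := Matrix.linftyOpNormedAlgebra
  have h1 : ContDiff ℝ ∞ (NormedSpace.exp : Matrix (Fin 2) (Fin 2) ℝ → _) :=
    contDiff_iff_contDiffAt.2 fun x => (NormedSpace.exp_analytic (𝕂 := ℝ) x).contDiffAt
  exact (LinearMap.toContinuousLinearMap (Matrix.entryLinearMap ℝ ℝ i j)).contDiff.comp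
    (h1.comp (LinearMap.toContinuousLinearMap slMatrix).contDiff)

/-- The exponential map in coordinates. -/
def expCoord (x : Fin 3 → ℝ) : Fin 3 → ℝ := entries (expSL (slOfCoord x)).1

theorem contDiff_expCoord : ContDiff ℝ ∞ expCoord := by
  rw [contDiff_pi]
  intro i
  fin_cases i
  exacts [contDiff_exp_entry 0 0, contDiff_exp_entry 0 1, contDiff_exp_entry 1 0]

theorem expSL_zero : expSL 0 = 1 := Subtype.ext (NormedSpace.exp_zero)

theorem slOfCoord_zero : slOfCoord 0 = 0 := Subtype.ext slMatrix.map_zero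

theorem expCoord_zero : expCoord 0 = ![1, 0, 0] := by
  rw [expCoord, slOfCoord_zero, expSL_zero]
  ext i; fin_cases i <;> rfl

theorem hasFDerivAt_expCoord :
    HasFDerivAt expCoord ((ContinuousLinearEquiv.refl ℝ (Fin 3 → ℝ) :
      (Fin 3 → ℝ) ≃L[ℝ] (Fin 3 → ℝ)) : (Fin 3 → ℝ) →L[ℝ] (Fin 3 → ℝ)) 0 := by
  let _ : NormedRing (Matrix (Fin 2) (Fin 2) ℝ) := Matrix.linftyOpNormedRing
  let _ : NormedAlgebra ℝ (Matrix (Fin 2) (Fin 2) ℝ) := Matrix.linftyOpNormedAlgebra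
  have h1 : HasFDerivAt (NormedSpace.exp : Matrix (Fin 2) (Fin 2) ℝ → _)
      (1 : Matrix (Fin 2) (Fin 2) ℝ →L[ℝ] Matrix (Fin 2) (Fin 2) ℝ)
      (LinearMap.toContinuousLinearMap slMatrix 0) := by
    rw [map_zero]; exact hasFDerivAt_exp_zero
  have h2 := (LinearMap.toContinuousLinearMap entries).hasFDerivAt.comp 0
    (h1.comp 0 (LinearMap.toContinuousLinearMap slMatrix).hasFDerivAt)
  convert! h2 using 1
  ext x i
  exact congrFun (entries_slMatrix _).symm i

/-- A local inverse of the exponential map of `SL₂(ℝ)`, in coordinates. -/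
def logCoord : (Fin 3 → ℝ) → Fin 3 → ℝ :=
  contDiff_expCoord.contDiffAt.localInverse hasFDerivAt_expCoord (by simp)

theorem contDiffAt_logCoord : ContDiffAt ℝ ∞ logCoord ![1, 0, 0] := by
  rw [← expCoord_zero]
  exact contDiff_expCoord.contDiffAt.to_localInverse hasFDerivAt_expCoord (by simp)

theorem logCoord_one : logCoord ![1, 0, 0] = 0 := by
  rw [← expCoord_zero]
  exact contDiff_expCoord.contDiffAt.localInverse_apply_image hasFDerivAt_expCoord (by simp)

theorem eventually_expCoord_logCoord : ∀ᶠ p in 𝓝 (![1, 0, 0] : Fin 3 → ℝ), expCoord (logCoord p) = p := by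
  rw [← expCoord_zero]
  exact ((contDiff_expCoord.contDiffAt (x := 0)).hasStrictFDerivAt' hasFDerivAt_expCoord
    (by simp)).eventually_right_inverse

theorem entries_injOn {g h : Matrix.SpecialLinearGroup (Fin 2) ℝ} (h0 : g.1 0 0 ≠ 0)
    (he : entries g.1 = entries h.1) : g = h := by
  have e0 : g.1 0 0 = h.1 0 0 := congrFun he 0
  have e1 : g.1 0 1 = h.1 0 1 := congrFun he 1
  have e2 : g.1 1 0 = h.1 1 0 := congrFun he 2
  have dg := g.2
  have dh := h.2
  rw [Matrix.det_fin_two] at dg dh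
  have e3 : g.1 1 1 = h.1 1 1 := by
    apply mul_left_cancel₀ h0
    rw [← e0, ← e1, ← e2] at dh
    linarith
  apply Subtype.ext
  ext i j; fin_cases i <;> fin_cases j <;> assumption

theorem eventually_expSL_logCoord : ∀ᶠ p in 𝓝 (![1, 0, 0] : Fin 3 → ℝ),
    ∀ h : Matrix.SpecialLinearGroup (Fin 2) ℝ, entries h.1 = p → expSL (slOfCoord (logCoord p)) = h := by
  have hc : ContinuousAt (fun p : Fin 3 → ℝ => p 0) ![1, 0, 0] := (continuous_apply 0).continuousAt
  filter_upwards [eventually_expCoord_logCoord, hc.eventually_ne (by simp : (![1, 0, 0] : Fin 3 → ℝ) 0 ≠ 0)]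
    with p hp hp0 h hh
  have hp0' : h.1 0 0 ≠ 0 := by rw [← hh] at hp0; exact hp0
  exact (entries_injOn hp0' (hh.trans hp.symm)).symm

end LogChart

/-! ### Archimedean and finite components of adelic matrices -/

section ArchGroup

variable {F : Type*} [Field F] [NumberField F] [IsTotallyReal F]

theorem GA_ext {g h : GA F} (h1 : ∀ v, archPart g v = archPart h v)
    (h2 : ∀ i j, (g i j).2 = (h i j).2) : g = h := by
  apply Matrix.SpecialLinearGroup.ext
  intro i j
  refine Prod.ext (funext fun v => (realIso v).injective ?_) (h2 i j)
  exact congrArg (fun m : Matrix.SpecialLinearGroup (Fin 2) ℝ => m i j) (h1 v)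

omit [IsTotallyReal F] in
theorem GA_mul_apply (g h : GA F) (i j : Fin 2) :
    (g * h) i j = g i 0 * h 0 j + g i 1 * h 1 j := by
  rw [Matrix.SpecialLinearGroup.coe_mul, Matrix.mul_apply, Fin.sum_univ_two]

theorem archPart_mul (g h : GA F) (v : InfinitePlace F) :
    archPart (g * h) v = archPart g v * archPart h v :=
  map_mul (Matrix.SpecialLinearGroup.map (toReal v)) g h

theorem archPart_one (v : InfinitePlace F) : archPart (1 : GA F) v = 1 :=
  map_one (Matrix.SpecialLinearGroup.map (toReal v))

theorem archPart_inv (g : GA F) (v : InfinitePlace F) : archPart g⁻¹ v = (archPart g v)⁻¹ :=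
  map_inv (Matrix.SpecialLinearGroup.map (toReal v)) g

theorem archPart_archIncl (h : InfinitePlace F → Matrix.SpecialLinearGroup (Fin 2) ℝ)
    (v : InfinitePlace F) : archPart (archIncl h) v = h v := by
  apply Matrix.SpecialLinearGroup.ext
  intro i j
  exact (realIso v).apply_symm_apply _

theorem archIncl_mul (h k : InfinitePlace F → Matrix.SpecialLinearGroup (Fin 2) ℝ) :
    archIncl (h * k) = archIncl h * archIncl k := by
  refine GA_ext (fun v => ?_) fun i j => ?_
  · rw [archPart_mul, archPart_archIncl, archPart_archIncl, archPart_archIncl]; rfl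
  · rw [GA_mul_apply]
    change (1 : Matrix (Fin 2) (Fin 2) (FiniteAdeleRing (𝓞 F) F)) i j =
      (1 : Matrix (Fin 2) (Fin 2) (FiniteAdeleRing (𝓞 F) F)) i 0 *
        (1 : Matrix (Fin 2) (Fin 2) (FiniteAdeleRing (𝓞 F) F)) 0 j +
      (1 : Matrix (Fin 2) (Fin 2) (FiniteAdeleRing (𝓞 F) F)) i 1 *
        (1 : Matrix (Fin 2) (Fin 2) (FiniteAdeleRing (𝓞 F) F)) 1 j
    rw [← Fin.sum_univ_two (f := fun k => (1 : Matrix (Fin 2) (Fin 2) (FiniteAdeleRing (𝓞 F) F)) i k *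
      (1 : Matrix (Fin 2) (Fin 2) (FiniteAdeleRing (𝓞 F) F)) k j), ← Matrix.mul_apply, one_mul]

theorem archIncl_one : archIncl (1 : InfinitePlace F → Matrix.SpecialLinearGroup (Fin 2) ℝ) = 1 := by
  have h := archIncl_mul (1 : InfinitePlace F → Matrix.SpecialLinearGroup (Fin 2) ℝ) 1
  rw [one_mul] at h
  exact (mul_eq_left.1 h.symm)

theorem archIncl_inv (h : InfinitePlace F → Matrix.SpecialLinearGroup (Fin 2) ℝ) :
    archIncl h⁻¹ = (archIncl h)⁻¹ := by
  rw [eq_inv_iff_mul_eq_one, ← archIncl_mul, inv_mul_cancel, archIncl_one]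

/-- Elements with trivial archimedean component commute with the archimedean group. -/
theorem archIncl_comm {g : GA F} (hg : ∀ v, archPart g v = 1)
    (h : InfinitePlace F → Matrix.SpecialLinearGroup (Fin 2) ℝ) :
    archIncl h * g = g * archIncl h := by
  refine GA_ext (fun v => ?_) fun i j => ?_
  · rw [archPart_mul, archPart_mul, hg, one_mul, mul_one]
  · rw [GA_mul_apply, GA_mul_apply]
    change (1 : Matrix (Fin 2) (Fin 2) (FiniteAdeleRing (𝓞 F) F)) i 0 * (g 0 j).2 +
        (1 : Matrix (Fin 2) (Fin 2) (FiniteAdeleRing (𝓞 F) F)) i 1 * (g 1 j).2 =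
      (g i 0).2 * (1 : Matrix (Fin 2) (Fin 2) (FiniteAdeleRing (𝓞 F) F)) 0 j +
        (g i 1).2 * (1 : Matrix (Fin 2) (Fin 2) (FiniteAdeleRing (𝓞 F) F)) 1 j
    set M : Matrix (Fin 2) (Fin 2) (FiniteAdeleRing (𝓞 F) F) := Matrix.of fun i j => (g i j).2
    have h1 := congrFun (congrFun (one_mul M) i) j
    have h2 := congrFun (congrFun (mul_one M) i) j
    rw [Matrix.mul_apply, Fin.sum_univ_two] at h1 h2
    exact h1.trans h2.symm

/-- The finite part of an element of `SL₂(𝔸_F)`. -/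
def finPart (g : GA F) : GA F := g * archIncl (archPart g)⁻¹

theorem archPart_finPart (g : GA F) (v : InfinitePlace F) : archPart (finPart g) v = 1 := by
  rw [finPart, archPart_mul, archPart_archIncl]
  exact mul_inv_cancel _

theorem finPart_mul_archIncl (g : GA F) : finPart g * archIncl (archPart g) = g := by
  rw [finPart, archIncl_inv, inv_mul_cancel_right]

theorem archIncl_mul_finPart (g : GA F) : archIncl (archPart g) * finPart g = g := by
  rw [archIncl_comm (archPart_finPart g), finPart_mul_archIncl]

theorem continuous_toReal (v : InfinitePlace F) : Continuous (toReal v : Adele F → ℝ) :=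
  (InfinitePlace.Completion.isometryEquivRealOfIsReal (IsTotallyReal.isReal v)).continuous.comp
    ((continuous_apply v).comp continuous_fst)

omit [NumberField F] in
theorem continuous_realIso_symm (v : InfinitePlace F) : Continuous (realIso v).symm :=
  (InfinitePlace.Completion.isometryEquivRealOfIsReal (IsTotallyReal.isReal v)).symm.continuous

theorem continuous_archPart (v : InfinitePlace F) : Continuous fun g : GA F => archPart g v :=
  (continuous_toReal v).specialLinearGroup_map

theorem continuous_archIncl : Continuous (archIncl : (InfinitePlace F → _) → GA F) := by
  refine continuous_induced_rng.2 (continuous_matrix fun i j => ?_)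
  refine Continuous.prodMk (continuous_pi fun v => ?_) continuous_const
  refine (continuous_realIso_symm v).comp ?_
  exact (Continuous.matrix_elem continuous_subtype_val i j).comp (continuous_apply v)

theorem continuous_finPart : Continuous (finPart : GA F → GA F) := by
  refine continuous_id.mul (continuous_archIncl.comp ?_)
  exact continuous_pi fun v => (continuous_archPart v).inv

end ArchGroup

/-! ### Smooth functions and right differentiation -/

section SmoothFunctions

variable {F : Type*} [Field F] [NumberField F] [IsTotallyReal F]

/-- The family of logarithmic coordinates of an element of `∏_{v ∣ ∞} SL₂(ℝ)` near the identity. -/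
def archLog (h : InfinitePlace F → Matrix.SpecialLinearGroup (Fin 2) ℝ) :
    InfinitePlace F → Fin 3 → ℝ :=
  fun v => logCoord (entries (h v).1)

omit [NumberField F] [IsTotallyReal F] in
theorem archLog_one : archLog (1 : InfinitePlace F → Matrix.SpecialLinearGroup (Fin 2) ℝ) = 0 := by
  funext v
  have : entries (1 : Matrix (Fin 2) (Fin 2) ℝ) = ![1, 0, 0] := by
    ext i; fin_cases i <;> rfl
  change logCoord (entries (1 : Matrix (Fin 2) (Fin 2) ℝ)) = 0
  rw [this, logCoord_one]

theorem entries_one : entries (1 : Matrix (Fin 2) (Fin 2) ℝ) = ![1, 0, 0] := by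
  ext i; fin_cases i <;> rfl

theorem continuous_entries : Continuous fun h : Matrix.SpecialLinearGroup (Fin 2) ℝ => entries h.1 := by
  refine continuous_pi fun i => ?_
  have h (i j : Fin 2) : Continuous fun h : Matrix.SpecialLinearGroup (Fin 2) ℝ => h.1 i j :=
    Continuous.matrix_elem continuous_subtype_val i j
  fin_cases i
  exacts [h 0 0, h 0 1, h 1 0]

omit [IsTotallyReal F] in
theorem eventually_exp_archLog :
    ∀ᶠ h in 𝓝 (1 : InfinitePlace F → Matrix.SpecialLinearGroup (Fin 2) ℝ),
      (fun v => expSL (slOfCoord (archLog h v))) = h := by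
  have h1 : ∀ v : InfinitePlace F,
      ∀ᶠ h in 𝓝 (1 : InfinitePlace F → Matrix.SpecialLinearGroup (Fin 2) ℝ),
        expSL (slOfCoord (archLog h v)) = h v := by
    intro v
    have hc : ContinuousAt (fun h : InfinitePlace F → Matrix.SpecialLinearGroup (Fin 2) ℝ =>
        entries (h v).1) 1 := (continuous_entries.comp (continuous_apply v)).continuousAt
    have h2 := eventually_expSL_logCoord
    rw [← entries_one] at h2
    filter_upwards [hc.eventually h2] with h hh
    exact hh (h v) rfl
  filter_upwards [Filter.eventually_all.2 h1] with h hh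
  exact funext hh

omit [NumberField F] [IsTotallyReal F] in
theorem continuousAt_archLog :
    ContinuousAt (archLog : (InfinitePlace F → Matrix.SpecialLinearGroup (Fin 2) ℝ) → _) 1 := by
  refine continuousAt_pi.2 fun v => ?_
  have h := contDiffAt_logCoord.continuousAt
  rw [← entries_one] at h
  exact ContinuousAt.comp (f := fun h : InfinitePlace F → Matrix.SpecialLinearGroup (Fin 2) ℝ =>
    entries (h v).1) h (continuous_entries.comp (continuous_apply v)).continuousAt

variable {ψ : GA F → ℂ}

/-- A smooth function in exponential coordinates around `g`. -/
def expChart (ψ : GA F → ℂ) (g : GA F) (x : InfinitePlace F → Fin 3 → ℝ) : ℂ :=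
  ψ (g * archIncl fun v => expSL (slOfCoord (x v)))

theorem eventually_expChart_archLog (ψ : GA F → ℂ) (g : GA F) :
    ∀ᶠ h in 𝓝 (1 : InfinitePlace F → Matrix.SpecialLinearGroup (Fin 2) ℝ),
      ψ (g * archIncl h) = expChart ψ g (archLog h) := by
  filter_upwards [eventually_exp_archLog] with h hh
  rw [expChart, hh]

theorem Smooth.continuousAt_archIncl (hψ : Smooth ψ) (g : GA F) :
    ContinuousAt (fun h => ψ (g * archIncl h)) 1 := by
  have h1 : ContinuousAt (expChart ψ g) (archLog 1) := by
    rw [archLog_one]; exact (hψ.arch_smooth g).continuousAt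
  exact (h1.comp continuousAt_archLog).congr
    ((eventually_expChart_archLog ψ g).mono fun h hh => hh.symm)

/-- Smoothness is required only along the archimedean directions through each point, together with
local dependence on the archimedean part alone; this suffices for continuity. -/
theorem Smooth.continuous (hψ : Smooth ψ) : Continuous ψ := by
  refine continuous_iff_continuousAt.2 fun g => ?_
  obtain ⟨V, hV, hloc⟩ := hψ.locally_arch g
  set q : GA F → InfinitePlace F → Matrix.SpecialLinearGroup (Fin 2) ℝ :=
    fun h => (archPart g)⁻¹ * archPart h with hq
  have hqc : Continuous q :=
    continuous_const.mul (continuous_pi fun v => continuous_archPart v)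
  have hqg : q g = 1 := inv_mul_cancel _
  have hr : Continuous fun h => g * archIncl (q h) := continuous_const.mul (continuous_archIncl.comp hqc)
  have hrg : g * archIncl (q g) = g := by rw [hqg, archIncl_one, mul_one]
  have hrV : ∀ᶠ h in 𝓝 g, g * archIncl (q h) ∈ V :=
    hr.continuousAt.eventually_mem (by rw [hrg]; exact hV)
  have h1 : ContinuousAt (fun h => ψ (g * archIncl h)) (q g) := by
    rw [hqg]; exact hψ.continuousAt_archIncl g
  refine (h1.comp hqc.continuousAt).congr ?_
  filter_upwards [hV, hrV] with h hh hh'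
  refine hloc _ hh' _ hh (funext fun v => ?_)
  rw [archPart_mul, archPart_archIncl]
  exact mul_inv_cancel_left _ _

omit [NumberField F] [IsTotallyReal F] in
theorem contDiffAt_mul_entry {P : Type*} [NormedAddCommGroup P] [NormedSpace ℝ P]
    {H K : P → InfinitePlace F → Matrix.SpecialLinearGroup (Fin 2) ℝ} {p₀ : P}
    (hH : ∀ v i j, ContDiffAt ℝ ∞ (fun p => (H p v).1 i j) p₀)
    (hK : ∀ v i j, ContDiffAt ℝ ∞ (fun p => (K p v).1 i j) p₀) (v : InfinitePlace F) (i j : Fin 2) :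
    ContDiffAt ℝ ∞ (fun p => ((H p * K p) v).1 i j) p₀ := by
  have : (fun p => ((H p * K p) v).1 i j) =
      fun p => (H p v).1 i 0 * (K p v).1 0 j + (H p v).1 i 1 * (K p v).1 1 j := by
    funext p
    rw [Pi.mul_apply, Matrix.SpecialLinearGroup.coe_mul, Matrix.mul_apply, Fin.sum_univ_two]
  rw [this]
  exact ((hH v i 0).mul (hK v 0 j)).add ((hH v i 1).mul (hK v 1 j))

/-- Smooth functions are smooth along every smooth family of archimedean translates. -/
theorem Smooth.contDiffAt (hψ : Smooth ψ) (g : GA F) {P : Type*} [NormedAddCommGroup P]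
    [NormedSpace ℝ P] {H : P → InfinitePlace F → Matrix.SpecialLinearGroup (Fin 2) ℝ} {p₀ : P}
    (hH : ∀ v i j, ContDiffAt ℝ ∞ (fun p => (H p v).1 i j) p₀) :
    ContDiffAt ℝ ∞ (fun p => ψ (g * archIncl (H p))) p₀ := by
  set K : P → InfinitePlace F → Matrix.SpecialLinearGroup (Fin 2) ℝ := fun p => (H p₀)⁻¹ * H p with hKdef
  have hK : ∀ v i j, ContDiffAt ℝ ∞ (fun p => (K p v).1 i j) p₀ :=
    contDiffAt_mul_entry (fun v i j => contDiffAt_const) hH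
  have hK0 : K p₀ = 1 := inv_mul_cancel _
  have hKe : ∀ v, ContDiffAt ℝ ∞ (fun p => entries (K p v).1) p₀ := by
    intro v
    rw [contDiffAt_pi]
    intro i
    fin_cases i
    exacts [hK v 0 0, hK v 0 1, hK v 1 0]
  have hlog : ContDiffAt ℝ ∞ (fun p => archLog (K p)) p₀ := by
    rw [contDiffAt_pi]
    intro v
    have h := contDiffAt_logCoord
    rw [← entries_one] at h
    have h' : ContDiffAt ℝ ∞ logCoord (entries (K p₀ v).1) := by rw [hK0]; exact h
    exact h'.comp p₀ (hKe v)
  have hKc : ContinuousAt K p₀ := by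
    refine continuousAt_pi.2 fun v => ?_
    refine Topology.IsInducing.subtypeVal.continuousAt_iff.2 ?_
    refine continuousAt_pi.2 fun i => continuousAt_pi.2 fun j => (hK v i j).continuousAt
  have hu : ContDiffAt ℝ ∞ (expChart ψ (g * archIncl (H p₀))) (archLog (K p₀)) := by
    rw [hK0, archLog_one]; exact hψ.arch_smooth _
  refine (hu.comp p₀ hlog).congr_of_eventuallyEq ?_
  have hev := eventually_expChart_archLog ψ (g * archIncl (H p₀))
  rw [← hK0] at hev
  filter_upwards [hKc.eventually hev] with p hp
  rw [Function.comp, ← hp, mul_assoc, ← archIncl_mul, hKdef, mul_inv_cancel_left]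

theorem hasFDerivAt_logCoord :
    HasFDerivAt logCoord ((ContinuousLinearEquiv.refl ℝ (Fin 3 → ℝ)).symm :
      (Fin 3 → ℝ) →L[ℝ] (Fin 3 → ℝ)) ![1, 0, 0] := by
  rw [← expCoord_zero]
  exact ((contDiff_expCoord.contDiffAt (x := 0)).hasStrictFDerivAt' hasFDerivAt_expCoord
    (by simp)).to_localInverse.hasFDerivAt

/-- The derivative of a smooth function along a curve through the identity depends only on the
tangent vector of the curve. -/
theorem Smooth.hasDerivAt_fderiv (hψ : Smooth ψ) (g : GA F)
    {γ : ℝ → InfinitePlace F → Matrix.SpecialLinearGroup (Fin 2) ℝ} {x : InfinitePlace F → Fin 3 → ℝ}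
    (h0 : γ 0 = 1) (hc : ContinuousAt γ 0) (hγ : ∀ v, HasDerivAt (fun t => entries (γ t v).1) (x v) 0) :
    HasDerivAt (fun t => ψ (g * archIncl (γ t))) (fderiv ℝ (expChart ψ g) 0 x) 0 := by
  have hlog : HasDerivAt (fun t => archLog (γ t)) x 0 := by
    rw [hasDerivAt_pi]
    intro v
    have h := hasFDerivAt_logCoord
    rw [← entries_one] at h
    have h' : HasFDerivAt logCoord ((ContinuousLinearEquiv.refl ℝ (Fin 3 → ℝ)).symm :
      (Fin 3 → ℝ) →L[ℝ] (Fin 3 → ℝ)) (entries (γ 0 v).1) := by rw [h0]; exact h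
    exact h'.comp_hasDerivAt 0 (hγ v)
  have hu : HasFDerivAt (expChart ψ g) (fderiv ℝ (expChart ψ g) 0) (archLog (γ 0)) := by
    rw [h0, archLog_one]
    exact ((hψ.arch_smooth g).differentiableAt (by simp)).hasFDerivAt
  have h1 := hu.comp_hasDerivAt 0 hlog
  refine h1.congr_of_eventuallyEq ?_
  have hev := eventually_expChart_archLog ψ g
  rw [← h0] at hev
  filter_upwards [hc.eventually hev] with t ht
  exact ht

/-- Coordinates of an element of the real Lie algebra. -/
def archCoord (X : InfinitePlace F → LieAlgebra.SpecialLinear.sl (Fin 2) ℝ) :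
    InfinitePlace F → Fin 3 → ℝ := fun v => entries (X v).1

theorem contDiff_exp_smul_entry (X : LieAlgebra.SpecialLinear.sl (Fin 2) ℝ) (i j : Fin 2) :
    ContDiff ℝ ∞ (fun t : ℝ => (expSL (t • X)).1 i j) := by
  have h := (contDiff_exp_entry i j).comp (contDiff_id.smul contDiff_const :
    ContDiff ℝ ∞ fun t : ℝ => t • entries X.1)
  have e : (fun t : ℝ => (expSL (t • X)).1 i j) =
      (fun x : Fin 3 → ℝ => (expSL (slOfCoord x)).1 i j) ∘ fun t : ℝ => t • entries X.1 := by
    funext t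
    rw [Function.comp, slOfCoord_smul, slOfCoord_entries]
  rw [e]
  exact h

theorem lieDerivReal_eq_fderiv (hψ : Smooth ψ)
    (X : InfinitePlace F → LieAlgebra.SpecialLinear.sl (Fin 2) ℝ) (g : GA F) :
    HasDerivAt (fun t : ℝ => ψ (g * archIncl fun v => expSL (t • X v)))
      (fderiv ℝ (expChart ψ g) 0 (archCoord X)) 0 := by
  have hu : HasFDerivAt (expChart ψ g) (fderiv ℝ (expChart ψ g) 0) ((0 : ℝ) • archCoord X) := by
    rw [zero_smul]
    exact ((hψ.arch_smooth g).differentiableAt (by simp)).hasFDerivAt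
  have hl : HasDerivAt (fun t : ℝ => t • archCoord X) (archCoord X) 0 := by
    simpa using (hasDerivAt_id (0 : ℝ)).smul_const (archCoord X)
  convert! hu.comp_hasDerivAt 0 hl using 1
  funext t
  simp only [Function.comp, expChart, Pi.smul_apply, slOfCoord_smul, archCoord, slOfCoord_entries]

theorem lieDerivReal_apply (hψ : Smooth ψ)
    (X : InfinitePlace F → LieAlgebra.SpecialLinear.sl (Fin 2) ℝ) (g : GA F) :
    lieDerivReal X ψ g = fderiv ℝ (expChart ψ g) 0 (archCoord X) :=
  (lieDerivReal_eq_fderiv hψ X g).deriv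

theorem Smooth.hasDerivAt_curve (hψ : Smooth ψ) (g : GA F)
    {γ : ℝ → InfinitePlace F → Matrix.SpecialLinearGroup (Fin 2) ℝ}
    (X : InfinitePlace F → LieAlgebra.SpecialLinear.sl (Fin 2) ℝ)
    (h0 : γ 0 = 1) (hγ : ∀ v i j, HasDerivAt (fun t => (γ t v).1 i j) ((X v).1 i j) 0) :
    HasDerivAt (fun t => ψ (g * archIncl (γ t))) (lieDerivReal X ψ g) 0 := by
  rw [lieDerivReal_apply hψ]
  refine hψ.hasDerivAt_fderiv g h0 ?_ fun v => ?_
  · refine continuousAt_pi.2 fun v => Topology.IsInducing.subtypeVal.continuousAt_iff.2 ?_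
    exact continuousAt_pi.2 fun i => continuousAt_pi.2 fun j => (hγ v i j).continuousAt
  · rw [hasDerivAt_pi]
    intro i
    fin_cases i
    exacts [hγ v 0 0, hγ v 0 1, hγ v 1 0]

theorem lieDerivReal_add (hψ : Smooth ψ)
    (X Y : InfinitePlace F → LieAlgebra.SpecialLinear.sl (Fin 2) ℝ) (g : GA F) :
    lieDerivReal (X + Y) ψ g = lieDerivReal X ψ g + lieDerivReal Y ψ g := by
  simp only [lieDerivReal_apply hψ]
  rw [← map_add]
  congr 1
  funext v
  exact map_add entries _ _

theorem lieDerivReal_smul (hψ : Smooth ψ) (c : ℝ)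
    (X : InfinitePlace F → LieAlgebra.SpecialLinear.sl (Fin 2) ℝ) (g : GA F) :
    lieDerivReal (c • X) ψ g = c * lieDerivReal X ψ g := by
  simp only [lieDerivReal_apply hψ]
  rw [← Complex.real_smul, ← map_smul]
  congr 1
  funext v
  exact map_smul entries _ _

theorem Smooth.add {ψ' : GA F → ℂ} (hψ : Smooth ψ) (hψ' : Smooth ψ') : Smooth (ψ + ψ') where
  locally_arch g := by
    obtain ⟨V, hV, h⟩ := hψ.locally_arch g
    obtain ⟨V', hV', h'⟩ := hψ'.locally_arch g
    refine ⟨V ∩ V', Filter.inter_mem hV hV', fun a ha b hb hab => ?_⟩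
    rw [Pi.add_apply, Pi.add_apply, h a ha.1 b hb.1 hab, h' a ha.2 b hb.2 hab]
  arch_smooth g := (hψ.arch_smooth g).add (hψ'.arch_smooth g)

theorem Smooth.smul (c : ℂ) (hψ : Smooth ψ) : Smooth (c • ψ) where
  locally_arch g := by
    obtain ⟨V, hV, h⟩ := hψ.locally_arch g
    refine ⟨V, hV, fun a ha b hb hab => ?_⟩
    rw [Pi.smul_apply, Pi.smul_apply, h a ha b hb hab]
  arch_smooth g := (hψ.arch_smooth g).const_smul c

variable (F) in
/-- The space of smooth functions. -/
def smoothSpace : Submodule ℂ (GA F → ℂ) where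
  carrier := {ψ | Smooth ψ}
  add_mem' := Smooth.add
  zero_mem' := ⟨fun _ => ⟨Set.univ, Filter.univ_mem, fun _ _ _ _ _ => rfl⟩, fun _ => contDiffAt_const⟩
  smul_mem' c _ := Smooth.smul c

theorem Smooth.comp_mul_left (hψ : Smooth ψ) (a : GA F) : Smooth fun g => ψ (a * g) where
  locally_arch g := by
    obtain ⟨V, hV, h⟩ := hψ.locally_arch (a * g)
    refine ⟨(fun g => a * g) ⁻¹' V, (continuous_const.mul continuous_id).continuousAt hV,
      fun x hx y hy hxy => h _ hx _ hy (funext fun v => ?_)⟩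
    rw [archPart_mul, archPart_mul, hxy]
  arch_smooth g := by
    simp only [← mul_assoc]
    exact hψ.arch_smooth (a * g)

theorem archIncl_mul_eq (h : InfinitePlace F → Matrix.SpecialLinearGroup (Fin 2) ℝ) (g : GA F) :
    archIncl h * g = g * archIncl ((archPart g)⁻¹ * h * archPart g) := by
  conv_lhs => rw [← finPart_mul_archIncl g, ← mul_assoc, archIncl_comm (archPart_finPart g)]
  conv_rhs => rw [← finPart_mul_archIncl g]
  rw [mul_assoc, mul_assoc, ← archIncl_mul, ← archIncl_mul]
  congr 2
  have : archPart (finPart g * archIncl (archPart g)) = archPart g := by rw [finPart_mul_archIncl]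
  rw [this, ← mul_assoc, ← mul_assoc, mul_inv_cancel, one_mul]

theorem Smooth.comp_mul_right (hψ : Smooth ψ) (a : GA F) : Smooth fun g => ψ (g * a) where
  locally_arch g := by
    obtain ⟨V, hV, h⟩ := hψ.locally_arch (g * a)
    refine ⟨(fun g => g * a) ⁻¹' V, (continuous_id.mul continuous_const).continuousAt hV,
      fun x hx y hy hxy => h _ hx _ hy (funext fun v => ?_)⟩
    rw [archPart_mul, archPart_mul, hxy]
  arch_smooth g := by
    simp only [mul_assoc g, archIncl_mul_eq _ a]
    simp only [← mul_assoc g a]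
    refine hψ.contDiffAt (g * a) ?_
    refine contDiffAt_mul_entry (K := fun _ => archPart a)
      (H := fun x : InfinitePlace F → Fin 3 → ℝ => (archPart a)⁻¹ * fun v => expSL (slOfCoord (x v)))
      (contDiffAt_mul_entry (H := fun _ => (archPart a)⁻¹) (fun _ _ _ => contDiffAt_const) ?_)
      (fun _ _ _ => contDiffAt_const)
    intro v i j
    exact (contDiff_exp_entry i j).contDiffAt.comp _ (contDiff_apply _ _ v).contDiffAt

theorem lieDerivReal_comp_mul_left (X : InfinitePlace F → LieAlgebra.SpecialLinear.sl (Fin 2) ℝ)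
    (ψ : GA F → ℂ) (a g : GA F) :
    lieDerivReal X (fun h => ψ (a * h)) g = lieDerivReal X ψ (a * g) := by
  simp only [lieDerivReal, mul_assoc]

/-- Smooth functions are stable under right differentiation. -/
theorem Smooth.lieDerivReal (hψ : Smooth ψ)
    (X : InfinitePlace F → LieAlgebra.SpecialLinear.sl (Fin 2) ℝ) : Smooth (lieDerivReal X ψ) where
  locally_arch g := by
    obtain ⟨V, hV, h⟩ := hψ.locally_arch g
    refine ⟨interior V, interior_mem_nhds.2 hV, fun x hx y hy hxy => ?_⟩
    have hc : ∀ z ∈ interior V, ∀ᶠ t : ℝ in 𝓝 0, z * archIncl (fun v => expSL (t • X v)) ∈ V := by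
      intro z hz
      have h1 : ContinuousAt (fun t : ℝ => z * archIncl (fun v => expSL (t • X v))) 0 := by
        refine (continuous_const.mul (continuous_archIncl.comp ?_)).continuousAt
        refine continuous_pi fun v => continuous_induced_rng.2 ?_
        exact continuous_matrix fun i j => (contDiff_exp_smul_entry (X v) i j).continuous
      refine h1.eventually_mem ?_
      have : z * archIncl (fun v => expSL ((0 : ℝ) • X v)) = z := by
        simp only [zero_smul, expSL_zero]
        exact (congrArg (z * ·) archIncl_one).trans (mul_one z)
      rw [this]
      exact mem_interior_iff_mem_nhds.1 hz
    refine Filter.EventuallyEq.deriv_eq ?_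
    filter_upwards [hc x hx, hc y hy] with t h1 h2
    refine h _ h1 _ h2 (funext fun v => ?_)
    rw [archPart_mul, archPart_mul, hxy]
  arch_smooth g := by
    set f : (InfinitePlace F → Fin 3 → ℝ) → ℝ → ℂ := fun x t =>
      ψ (g * (archIncl fun v => expSL (slOfCoord (x v))) * archIncl fun v => expSL (t • X v)) with hf
    have hsm : ContDiffAt ℝ ∞ (Function.uncurry f) (0, 0) := by
      have e : Function.uncurry f = fun p : (InfinitePlace F → Fin 3 → ℝ) × ℝ =>
          ψ (g * archIncl ((fun v => expSL (slOfCoord (p.1 v))) * fun v => expSL (p.2 • X v))) := by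
        funext p
        simp only [Function.uncurry, hf, archIncl_mul, mul_assoc]
      rw [e]
      refine hψ.contDiffAt g (contDiffAt_mul_entry ?_ ?_)
      · intro v i j
        exact (contDiff_exp_entry i j).contDiffAt.comp _
          ((contDiff_apply _ _ v).comp contDiff_fst).contDiffAt
      · intro v i j
        exact ((contDiff_exp_smul_entry (X v) i j).comp contDiff_snd).contDiffAt
    have h1 : ContDiffAt ℝ ∞ (fun x => fderiv ℝ (f x) ((fun _ => (0 : ℝ)) x)) 0 :=
      ContDiffAt.fderiv (n := ∞) (f := f) (g := fun _ => (0 : ℝ)) hsm contDiffAt_const (by simp)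
    exact h1.clm_apply (contDiffAt_const (c := (1 : ℝ)))

end SmoothFunctions

/-! ### Spectral decomposition of functions under flows -/

section FunctionSpaces

variable {X : Type*}

/-- A finite-dimensional space of functions is coordinatized by finitely many evaluations. -/
theorem exists_dual_points (W : Submodule ℂ (X → ℂ)) [FiniteDimensional ℂ W] :
    ∃ (ι : Type) (_ : Fintype ι) (x : ι → X) (w : ι → X → ℂ), (∀ i, w i ∈ W) ∧
      ∀ ψ ∈ W, ∀ y, ψ y = ∑ i, ψ (x i) * w i y := by
  classical
  let ev : X → Module.Dual ℂ W := fun x => (LinearMap.proj x).comp W.subtype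
  have hev : ∀ x (ψ : W), ev x ψ = ψ.1 x := fun _ _ => rfl
  have hspan : Submodule.span ℂ (Set.range ev) = ⊤ := by
    by_contra hne
    obtain ⟨f, hf0, hf⟩ := Submodule.exists_le_ker_of_lt_top _ (lt_top_iff_ne_top.2 hne)
    obtain ⟨ψ, rfl⟩ := (Module.evalEquiv ℂ W).surjective f
    apply hf0
    have : ψ = 0 := by
      apply Subtype.ext
      funext x
      exact hf (Submodule.subset_span ⟨x, rfl⟩)
    rw [this, map_zero]
  obtain ⟨b, hbsub, hbspan, hbli⟩ := exists_linearIndependent ℂ (Set.range ev)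
  rw [hspan] at hbspan
  let B : Module.Basis b ℂ (Module.Dual ℂ W) := Module.Basis.mk hbli (by rw [Subtype.range_coe, hbspan])
  have : Fintype b := FiniteDimensional.fintypeBasisIndex B
  let e : b ≃ Fin (Fintype.card b) := Fintype.equivFin b
  choose x hx using fun i : b => hbsub i.2
  let w : b → W := fun i => (Module.evalEquiv ℂ W).symm (B.dualBasis i)
  refine ⟨Fin (Fintype.card b), inferInstance, x ∘ e.symm, fun i => (w (e.symm i)).1,
    fun i => (w _).2, fun ψ hψ y => ?_⟩
  have key : (⟨ψ, hψ⟩ : W) = ∑ i, ψ (x i) • w i := by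
    apply (Module.evalEquiv ℂ W).injective
    rw [map_sum]
    apply B.ext
    intro j
    rw [LinearMap.sum_apply, Finset.sum_eq_single j]
    · rw [map_smul, LinearEquiv.apply_symm_apply, LinearMap.smul_apply, Module.Basis.dualBasis_apply_self,
        if_pos rfl, smul_eq_mul, mul_one, Module.evalEquiv_apply, Module.Basis.mk_apply, ← hx j]
      rfl
    · intro i _ hij
      rw [map_smul, LinearEquiv.apply_symm_apply, LinearMap.smul_apply, Module.Basis.dualBasis_apply_self,
        if_neg hij.symm, smul_zero]
    · intro h; exact absurd (Finset.mem_univ _) h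
  have h2 := congrFun (congrArg Subtype.val key) y
  rw [AddSubmonoidClass.coe_finsetSum, Finset.sum_apply] at h2
  change ψ y = _ at h2
  rw [h2, ← e.symm.sum_comp]
  rfl

/-- Fourier decomposition of a function whose translates under a periodic flow span a
finite-dimensional space. -/
theorem exists_fourier_decomposition (T : ℝ → X → X) (h0 : ∀ x, T 0 x = x)
    (hadd : ∀ s t x, T (s + t) x = T s (T t x)) (hper : ∀ x, T (2 * Real.pi) x = x) (ψ : X → ℂ)
    (hcont : ∀ x, Continuous fun t => ψ (T t x))
    (hfin : FiniteDimensional ℂ (Submodule.span ℂ (Set.range fun t x => ψ (T t x)))) :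
    ∃ (S : Finset ℤ) (c : ℤ → X → ℂ), ψ = ∑ n ∈ S, c n ∧
      ∀ n, c n ∈ Submodule.span ℂ (Set.range fun t x => ψ (T t x)) ∧
        ∀ t x, c n (T t x) = Complex.exp (n * t * Complex.I) * c n x := by
  classical
  have hfact : Fact (0 < 2 * Real.pi) := ⟨Real.two_pi_pos⟩
  set W := Submodule.span ℂ (Set.range fun t x => ψ (T t x)) with hW
  have hperiodic : ∀ x, Function.Periodic (fun t => ψ (T t x)) (2 * Real.pi) := fun x t => by
    simp only [hadd, hper]
  let f : X → C(AddCircle (2 * Real.pi), ℂ) := fun x =>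
    ⟨(hperiodic x).lift, continuous_coinduced_dom.2 (hcont x)⟩
  have hf : ∀ x (t : ℝ), f x (t : AddCircle (2 * Real.pi)) = ψ (T t x) := fun x t => rfl
  -- The components are the Fourier coefficients along orbits. They lie in the finite-dimensional space
  -- `W` and those that do not vanish are linearly independent, so only finitely many are nonzero.
  let c : ℤ → X → ℂ := fun n x => fourierCoeff (f x) n
  obtain ⟨ι, _, y, w, hwW, hw⟩ := exists_dual_points W
  have hint : ∀ (n : ℤ) x, Integrable (fun t => fourier (-n) t • f x t)
      (AddCircle.haarAddCircle (T := 2 * Real.pi)) := fun n x =>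
    ((map_continuous (fourier (-n))).smul (f x).continuous).integrable_of_hasCompactSupport
      (HasCompactSupport.of_compactSpace _)
  have hcW : ∀ n, c n ∈ W := by
    intro n
    have : c n = ∑ i, c n (y i) • w i := by
      funext x
      rw [Finset.sum_apply]
      change fourierCoeff (f x) n = ∑ i, fourierCoeff (f (y i)) n * w i x
      simp only [fourierCoeff, ← integral_mul_const]
      rw [← integral_finsetSum _ fun i _ => (hint n (y i)).mul_const _]
      congr 1
      funext t
      obtain ⟨t, rfl⟩ := QuotientAddGroup.mk_surjective t
      simp only [smul_eq_mul, mul_assoc, ← Finset.mul_sum]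
      congr 1
      exact hw _ (Submodule.subset_span ⟨t, rfl⟩) x
    rw [this]
    exact Submodule.sum_mem _ fun i _ => Submodule.smul_mem _ _ (hwW i)
  have hfour : ∀ (n : ℤ) (t : ℝ), fourier n (t : AddCircle (2 * Real.pi)) = Complex.exp (n * t * Complex.I) := by
    intro n t
    rw [fourier_coe_apply]
    congr 1
    have : (Real.pi : ℂ) ≠ 0 := by exact_mod_cast Real.pi_ne_zero
    push_cast
    field_simp
  have hcT : ∀ n t x, c n (T t x) = Complex.exp (n * t * Complex.I) * c n x := by
    intro n s x
    change fourierCoeff (f (T s x)) n = _ * fourierCoeff (f x) n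
    simp only [fourierCoeff]
    rw [← integral_add_right_eq_self (fun t => fourier (-n) t • f x t) (s : AddCircle (2 * Real.pi)),
      ← integral_const_mul]
    congr 1
    funext t
    obtain ⟨t, rfl⟩ := QuotientAddGroup.mk_surjective t
    change fourier (-n) (t : AddCircle (2 * Real.pi)) • f (T s x) (t : AddCircle (2 * Real.pi)) =
      _ * (fourier (-n) ((t + s : ℝ) : AddCircle (2 * Real.pi)) • f x ((t + s : ℝ) : AddCircle (2 * Real.pi)))
    rw [hf, hf, hfour, hfour, hadd, smul_eq_mul, smul_eq_mul, ← mul_assoc, ← Complex.exp_add]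
    congr 2
    push_cast; ring
  have hli : LinearIndependent ℂ fun n : {n : ℤ // c n ≠ 0} => c n := by
    rw [linearIndependent_iff']
    intro s a ha n hn
    obtain ⟨x, hx⟩ := Function.ne_iff.1 n.2
    let χ : ℤ → (Multiplicative ℝ →* ℂ) := fun m =>
      { toFun := fun t => Complex.exp (m * (t.toAdd : ℝ) * Complex.I)
        map_one' := by simp
        map_mul' := fun s t => by
          rw [← Complex.exp_add, toAdd_mul]; congr 1; push_cast; ring }
    have hχ : Function.Injective χ := by
      intro m m' hmm
      have h1 : ∀ t : ℝ, Complex.exp (m * t * Complex.I) = Complex.exp (m' * t * Complex.I) :=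
        fun t => DFunLike.congr_fun hmm (Multiplicative.ofAdd t)
      have h2 : fourier (T := 2 * Real.pi) m = fourier m' := by
        ext t
        obtain ⟨t, rfl⟩ := QuotientAddGroup.mk_surjective t
        exact (hfour m t).trans ((h1 t).trans (hfour m' t).symm)
      by_contra hne
      have h3 := orthonormal_fourier (T := 2 * Real.pi)
      have h4 : inner ℂ (fourierLp (T := 2 * Real.pi) 2 m) (fourierLp 2 m') = 0 := h3.2 hne
      have h5 := h3.1 m'
      have h6 : fourierLp (T := 2 * Real.pi) 2 m = fourierLp 2 m' := by
        simp only [fourierLp, h2]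
      rw [h6, inner_self_eq_norm_sq_to_K, h5] at h4
      simp at h4
    have hlin := (linearIndependent_monoidHom (Multiplicative ℝ) ℂ).comp χ hχ
    have hlin' := (hlin.comp (fun n : {n : ℤ // c n ≠ 0} => n.1) Subtype.val_injective)
    rw [linearIndependent_iff'] at hlin'
    have h1 := hlin' s (fun m => a m * c m x) (by
      funext t
      rw [Finset.sum_apply]
      have h2 := congrFun ha (T t.toAdd x)
      rw [Finset.sum_apply] at h2
      rw [Pi.zero_apply] at h2 ⊢
      rw [← h2]
      refine Finset.sum_congr rfl fun m _ => ?_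
      simp only [Pi.smul_apply, smul_eq_mul, hcT]
      change a m * c m x * Complex.exp _ = _
      ring) n hn
    exact (mul_eq_zero.1 h1).resolve_right hx
  have hfinite : Finite {n : ℤ // c n ≠ 0} := by
    have hli' : LinearIndependent ℂ fun n : {n : ℤ // c n ≠ 0} => (⟨c n, hcW n⟩ : W) :=
      LinearIndependent.of_comp W.subtype hli
    exact hli'.finite
  have hS : {n : ℤ | c n ≠ 0}.Finite := Set.finite_coe_iff.1 hfinite
  refine ⟨hS.toFinset, c, ?_, fun n => ⟨hcW n, hcT n⟩⟩
  funext x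
  have hzero : ∀ n ∉ hS.toFinset, fourierCoeff (f x) n = 0 := by
    intro n hn
    have : c n = 0 := by simpa using hn
    exact congrFun this x
  have hsummable : Summable (fourierCoeff (f x)) := summable_of_ne_finset_zero hzero
  have h1 := has_pointwise_sum_fourier_series_of_summable hsummable ((0 : ℝ) : AddCircle (2 * Real.pi))
  have h2 : HasSum (fun n => fourierCoeff (f x) n • fourier n ((0 : ℝ) : AddCircle (2 * Real.pi)))
      (∑ n ∈ hS.toFinset, fourierCoeff (f x) n • fourier n ((0 : ℝ) : AddCircle (2 * Real.pi))) :=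
    hasSum_sum_of_ne_finset_zero fun n hn => by rw [hzero n hn, zero_smul]
  have h3 := h1.unique h2
  rw [hf, h0] at h3
  rw [h3, Finset.sum_apply]
  refine Finset.sum_congr rfl fun n _ => ?_
  rw [hfour]
  simp [c]

/-- If a function is an exponential polynomial with integral exponents along every orbit of a flow,
with exponents independent of the orbit, then it is a sum of eigenfunctions of the flow, which are
linear combinations of its translates. -/
theorem exists_exponential_decomposition (T : ℝ → X → X) (h0 : ∀ x, T 0 x = x)
    (hadd : ∀ s t x, T (s + t) x = T s (T t x)) (ψ : X → ℂ) (S : Finset ℤ)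
    (hψ : ∀ x, ∃ c : ℤ → ℂ, ∀ t : ℝ, ψ (T t x) = ∑ n ∈ S, c n * Complex.exp (n * t)) :
    ∃ c : ℤ → X → ℂ, ψ = ∑ n ∈ S, c n ∧
      ∀ n ∈ S, c n ∈ Submodule.span ℂ (Set.range fun t x => ψ (T t x)) ∧
        ∀ t x, c n (T t x) = Complex.exp (n * t) * c n x := by
  classical
  let z : ℤ → ℂ := fun n => Complex.exp n
  have hz : Function.Injective z := by
    intro m n h
    have h1 : ‖z m‖ = ‖z n‖ := by rw [h]
    simp only [z, Complex.norm_exp, Complex.intCast_re] at h1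
    exact_mod_cast Real.exp_injective h1
  -- The coefficient of `exp (n t)` is recovered from the values at `t = 0, 1, 2, …` by Lagrange
  -- interpolation at the nodes `exp n`.
  let P : ℤ → Polynomial ℂ := fun n => Lagrange.basis S z n
  let c : ℤ → X → ℂ := fun n x => (P n).sum fun k a => a * ψ (T k x)
  have hc : ∀ n ∈ S, ∀ x (d : ℤ → ℂ), (∀ t : ℝ, ψ (T t x) = ∑ n ∈ S, d n * Complex.exp (n * t)) →
      c n x = d n := by
    intro n hn x d hd
    have h1 : c n x = ∑ m ∈ S, d m * (P n).eval (z m) := by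
      simp only [c, Polynomial.sum_def, Polynomial.eval_eq_sum, hd, Finset.mul_sum]
      rw [Finset.sum_comm]
      refine Finset.sum_congr rfl fun m _ => Finset.sum_congr rfl fun k _ => ?_
      have : Complex.exp ((m : ℂ) * ((k : ℝ) : ℂ)) = z m ^ k := by
        rw [← Complex.exp_nat_mul, Complex.ofReal_natCast, mul_comm]
      rw [this]; ring
    rw [h1, Finset.sum_eq_single n]
    · rw [Lagrange.eval_basis_self hz.injOn hn, mul_one]
    · intro m hm hmn
      rw [Lagrange.eval_basis_of_ne hmn.symm hm, mul_zero]
    · exact fun h => absurd hn h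
  refine ⟨c, ?_, fun n hn => ⟨?_, ?_⟩⟩
  · funext x
    obtain ⟨d, hd⟩ := hψ x
    have h1 := hd 0
    rw [h0] at h1
    rw [h1, Finset.sum_apply]
    refine Finset.sum_congr rfl fun n hn => ?_
    rw [hc n hn x d hd]; simp
  · have : c n = ∑ k ∈ (P n).support, (P n).coeff k • fun x => ψ (T k x) := by
      funext x
      simp only [c, Polynomial.sum_def, Finset.sum_apply, Pi.smul_apply, smul_eq_mul]
    rw [this]
    exact Submodule.sum_mem _ fun k _ => Submodule.smul_mem _ _ (Submodule.subset_span ⟨_, rfl⟩)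
  · intro s x
    obtain ⟨d, hd⟩ := hψ x
    rw [hc n hn x d hd, hc n hn (T s x) fun m => Complex.exp (m * s) * d m]
    intro t
    rw [← hadd, hd]
    refine Finset.sum_congr rfl fun m _ => ?_
    rw [mul_right_comm, ← Complex.exp_add, mul_comm]
    congr 2
    push_cast; ring

/-- Simultaneous decomposition with respect to finitely many compatible families of subspaces. -/
theorem mem_iSup_iInf {V I J : Type*} [AddCommGroup V] [Module ℂ V] [Finite I] [Inhabited J]
    (U : Submodule ℂ V) (E : I → J → Submodule ℂ V)
    (hdec : ∀ i, ∀ h ∈ U, ∃ (S : Finset J) (c : J → V), h = ∑ n ∈ S, c n ∧ ∀ n ∈ S,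
      c n ∈ U ∧ c n ∈ E i n ∧ ∀ j m, h ∈ E j m → c n ∈ E j m) :
    ∀ h ∈ U, h ∈ ⨆ e : I → J, U ⊓ ⨅ i, E i (e i) := by
  classical
  have : Fintype I := Fintype.ofFinite I
  have key : ∀ s : Finset I, ∀ h ∈ U, h ∈ ⨆ e : I → J, U ⊓ ⨅ i ∈ s, E i (e i) := by
    intro s
    induction s using Finset.induction_on with
    | empty =>
      intro h hh
      exact Submodule.mem_iSup_of_mem (fun _ => default) ⟨hh, by simp⟩
    | insert i s hi ih =>
      intro h hh
      refine (iSup_le fun e => ?_ : (⨆ e : I → J, U ⊓ ⨅ i ∈ s, E i (e i)) ≤ _) (ih h hh)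
      rintro p ⟨hpU, hpE⟩
      obtain ⟨S, c, rfl, hc⟩ := hdec i p hpU
      refine Submodule.sum_mem _ fun n hn => ?_
      obtain ⟨h1, h2, h3⟩ := hc n hn
      refine Submodule.mem_iSup_of_mem (Function.update e i n) ⟨h1, ?_⟩
      rw [Finset.iInf_insert]
      refine ⟨by simpa using h2, ?_⟩
      have hpE' : ∀ j ∈ s, c n ∈ E j (e j) := fun j hj =>
        h3 j _ ((Submodule.mem_iInf _).1 ((Submodule.mem_iInf _).1 hpE j) hj)
      refine (Submodule.mem_iInf _).2 fun j => (Submodule.mem_iInf _).2 fun hj => ?_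
      rw [Function.update_of_ne (by rintro rfl; exact hi hj)]
      exact hpE' j hj
  intro h hh
  simpa using key Finset.univ h hh

end FunctionSpaces

/-! ### Functions finite under the maximal compact subgroup -/

section KFinite

variable {F : Type*} [Field F] [NumberField F] [IsTotallyReal F]

theorem mul_mem_maximalCompact {k k' : GA F} (hk : k ∈ maximalCompact (F := F))
    (hk' : k' ∈ maximalCompact (F := F)) : k * k' ∈ maximalCompact (F := F) := by
  refine ⟨fun v => ?_, fun v i j => ?_⟩
  · rw [archPart_mul, Matrix.SpecialLinearGroup.coe_mul]
    exact mul_mem (hk.1 v) (hk'.1 v)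
  · rw [GA_mul_apply]
    exact add_mem (mul_mem (hk.2 v i 0) (hk'.2 v 0 j)) (mul_mem (hk.2 v i 1) (hk'.2 v 1 j))

theorem one_mem_maximalCompact : (1 : GA F) ∈ maximalCompact (F := F) := by
  refine ⟨fun v => ?_, fun v i j => ?_⟩
  · rw [archPart_one]; exact one_mem _
  · fin_cases i <;> fin_cases j
    exacts [one_mem _, zero_mem _, zero_mem _, one_mem _]

/-- The span of the right translates of a function by the maximal compact subgroup. -/
def compactSpan (ψ : GA F → ℂ) : Submodule ℂ (GA F → ℂ) :=
  Submodule.span ℂ {ψ' : GA F → ℂ | ∃ k ∈ maximalCompact (F := F), ψ' = fun g => ψ (g * k)}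

theorem mem_compactSpan (ψ : GA F → ℂ) {k : GA F} (hk : k ∈ maximalCompact (F := F)) :
    (fun g => ψ (g * k)) ∈ compactSpan ψ := Submodule.subset_span ⟨k, hk, rfl⟩

theorem KFinite.add {ψ ψ' : GA F → ℂ} (hψ : KFinite ψ) (hψ' : KFinite ψ') : KFinite (ψ + ψ') := by
  have : FiniteDimensional ℂ (compactSpan ψ) := hψ
  have : FiniteDimensional ℂ (compactSpan ψ') := hψ'
  refine Submodule.finiteDimensional_of_le (S₂ := compactSpan ψ ⊔ compactSpan ψ') ?_
  refine Submodule.span_le.2 ?_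
  rintro _ ⟨k, hk, rfl⟩
  exact Submodule.add_mem_sup (mem_compactSpan ψ hk) (mem_compactSpan ψ' hk)

theorem KFinite.smul {ψ : GA F → ℂ} (c : ℂ) (hψ : KFinite ψ) : KFinite (c • ψ) := by
  have : FiniteDimensional ℂ (compactSpan ψ) := hψ
  refine Submodule.finiteDimensional_of_le (S₂ := compactSpan ψ) ?_
  refine Submodule.span_le.2 ?_
  rintro _ ⟨k, hk, rfl⟩
  exact Submodule.smul_mem _ c (mem_compactSpan ψ hk)

theorem KFinite.comp_mul_right {ψ : GA F → ℂ} (hψ : KFinite ψ) {κ : GA F}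
    (hκ : κ ∈ maximalCompact (F := F)) : KFinite fun g => ψ (g * κ) := by
  have : FiniteDimensional ℂ (compactSpan ψ) := hψ
  refine Submodule.finiteDimensional_of_le (S₂ := compactSpan ψ) ?_
  refine Submodule.span_le.2 ?_
  rintro _ ⟨k, hk, rfl⟩
  simp only [mul_assoc]
  exact mem_compactSpan ψ (mul_mem_maximalCompact hk hκ)

theorem KFinite.comp_mul_left {ψ : GA F → ℂ} (hψ : KFinite ψ) (a : GA F) :
    KFinite fun g => ψ (a * g) := by
  have : FiniteDimensional ℂ (compactSpan ψ) := hψ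
  let T : (GA F → ℂ) →ₗ[ℂ] (GA F → ℂ) := LinearMap.funLeft ℂ ℂ fun g => a * g
  refine Submodule.finiteDimensional_of_le (S₂ := (compactSpan ψ).map T) ?_
  refine Submodule.span_le.2 ?_
  rintro _ ⟨k, hk, rfl⟩
  refine ⟨_, mem_compactSpan ψ hk, ?_⟩
  funext g
  change ψ (a * g * k) = ψ (a * (g * k))
  rw [mul_assoc]

theorem KFinite.zero : KFinite (0 : GA F → ℂ) := by
  refine Submodule.finiteDimensional_of_le (S₂ := ⊥) (Submodule.span_le.2 ?_)
  rintro _ ⟨k, hk, rfl⟩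
  exact Submodule.zero_mem _

variable (F) in
/-- The space of right `K`-finite functions. -/
def kFiniteSpace : Submodule ℂ (GA F → ℂ) where
  carrier := {ψ | KFinite ψ}
  add_mem' := KFinite.add
  zero_mem' := KFinite.zero
  smul_mem' c _ := KFinite.smul c

omit [IsTotallyReal F] in
theorem continuous_entry (i j : Fin 2) : Continuous fun g : GA F => g i j :=
  Continuous.matrix_elem (continuous_induced_dom (f := fun g : GA F => g.1)) i j

omit [IsTotallyReal F] in
/-- Elements near the identity are integral at all finite places. -/
theorem eventually_integral : ∀ᶠ k in 𝓝 (1 : GA F),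
    ∀ (v : HeightOneSpectrum (𝓞 F)) (i j : Fin 2), (k i j).2 v ∈ v.adicCompletionIntegers F := by
  have h : ∀ i j : Fin 2, ∀ᶠ k in 𝓝 (1 : GA F), (k i j).2 ∈ integralAdeles F := by
    intro i j
    have hc : Continuous fun k : GA F => (k i j).2 :=
      continuous_snd.comp (continuous_entry i j)
    refine hc.continuousAt.eventually ((isOpen_integralAdeles (F := F)).mem_nhds ?_)
    intro v
    fin_cases i <;> fin_cases j
    exacts [one_mem _, zero_mem _, zero_mem _, one_mem _]
  filter_upwards [h 0 0, h 0 1, h 1 0, h 1 1] with k h0 h1 h2 h3 v i j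
  fin_cases i <;> fin_cases j
  exacts [h0 v, h1 v, h2 v, h3 v]

/-- Elements with trivial archimedean part near the identity lie in the maximal compact subgroup. -/
theorem eventually_mem_maximalCompact : ∀ᶠ k in 𝓝 (1 : GA F),
    (∀ v, archPart k v = 1) → k ∈ maximalCompact (F := F) := by
  filter_upwards [eventually_integral] with k hk h
  exact ⟨fun v => by rw [h]; exact one_mem _, hk⟩

/-- A smooth right `K`-finite function is right invariant under an open subgroup of the finite
adelic points: its `K`-translates are determined by finitely many values, each of which is locally
constant in the finite-adelic direction. -/
theorem KFinite.eventually_right_invariant {ψ : GA F → ℂ} (hK : KFinite ψ) (hψ : Smooth ψ) :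
    ∀ᶠ k in 𝓝 (1 : GA F), (∀ v, archPart k v = 1) → ∀ g, ψ (g * k) = ψ g := by
  have : FiniteDimensional ℂ (compactSpan ψ) := hK
  obtain ⟨ι, _, x, w, -, hw⟩ := exists_dual_points (compactSpan ψ)
  have h : ∀ i, ∀ᶠ k in 𝓝 (1 : GA F), (∀ v, archPart k v = 1) → ψ (x i * k) = ψ (x i) := by
    intro i
    obtain ⟨V, hV, hloc⟩ := hψ.locally_arch (x i)
    have hc : ContinuousAt (fun k : GA F => x i * k) 1 := (continuous_const.mul continuous_id).continuousAt
    have hc' : ∀ᶠ k in 𝓝 (1 : GA F), x i * k ∈ V := hc.eventually_mem (by rw [mul_one]; exact hV)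
    filter_upwards [hc'] with k hk h1
    refine hloc _ hk _ (mem_of_mem_nhds hV) (funext fun v => ?_)
    rw [archPart_mul, h1, mul_one]
  filter_upwards [Filter.eventually_all.2 h, eventually_mem_maximalCompact] with k hk hkK h1 g
  have e1 := hw _ (mem_compactSpan ψ (hkK h1)) g
  have e2 := hw _ (mem_compactSpan ψ one_mem_maximalCompact) g
  simp only [mul_one] at e2
  rw [e1, e2]
  exact Finset.sum_congr rfl fun i _ => by rw [hk i h1]

end KFinite

/-! ### Rotations and the archimedean Iwasawa decomposition -/

section Rotations

/-- The rotation `!![cos θ, sin θ; -sin θ, cos θ]`. -/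
def rot (θ : ℝ) : Matrix.SpecialLinearGroup (Fin 2) ℝ :=
  ⟨!![Real.cos θ, Real.sin θ; -Real.sin θ, Real.cos θ], by
    rw [Matrix.det_fin_two_of]; nlinarith [Real.cos_sq_add_sin_sq θ]⟩

theorem rot_add (θ η : ℝ) : rot (θ + η) = rot θ * rot η := by
  apply Matrix.SpecialLinearGroup.ext
  intro i j
  rw [Matrix.SpecialLinearGroup.coe_mul]
  fin_cases i <;> fin_cases j <;>
    simp [rot, Matrix.mul_apply, Fin.sum_univ_two, Real.cos_add, Real.sin_add] <;> ring

theorem rot_zero : rot 0 = 1 := by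
  apply Matrix.SpecialLinearGroup.ext
  intro i j
  fin_cases i <;> fin_cases j <;> simp [rot]

theorem rot_two_pi : rot (2 * Real.pi) = 1 := by
  apply Matrix.SpecialLinearGroup.ext
  intro i j
  fin_cases i <;> fin_cases j <;> simp [rot]

theorem rot_mem (θ : ℝ) : (rot θ).1 ∈ Matrix.orthogonalGroup (Fin 2) ℝ := by
  rw [Matrix.mem_orthogonalGroup_iff]
  ext i j
  fin_cases i <;> fin_cases j <;>
    simp [rot, Matrix.mul_apply, Fin.sum_univ_two]
    <;> nlinarith [Real.cos_sq_add_sin_sq θ]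

/-- The Iwasawa decomposition of `SL₂(ℝ)`. -/
theorem exists_iwasawa_real (g : Matrix.SpecialLinearGroup (Fin 2) ℝ) :
    ∃ (x τ θ : ℝ), g = unip x * diagSL (Units.mk0 (Real.exp τ) (Real.exp_ne_zero τ)) * rot θ := by
  have hdet := g.2
  rw [Matrix.det_fin_two] at hdet
  obtain ⟨a, ha⟩ : ∃ a, a = g.1 0 0 := ⟨_, rfl⟩
  obtain ⟨b, hb⟩ : ∃ b, b = g.1 0 1 := ⟨_, rfl⟩
  obtain ⟨c, hc⟩ : ∃ c, c = g.1 1 0 := ⟨_, rfl⟩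
  obtain ⟨d, hd⟩ : ∃ d, d = g.1 1 1 := ⟨_, rfl⟩
  rw [← ha, ← hb, ← hc, ← hd] at hdet
  set z : ℂ := ⟨d, -c⟩ with hz
  have hz0 : z ≠ 0 := by
    intro h
    have h1 : d = 0 := congrArg Complex.re h
    have h2 : -c = 0 := congrArg Complex.im h
    have h3 : c = 0 := by linarith
    rw [h1, h3] at hdet; simp at hdet
  set r := ‖z‖ with hr
  have hr0 : 0 < r := norm_pos_iff.2 hz0
  have hr2 : r ^ 2 = c ^ 2 + d ^ 2 := by
    rw [hr, ← Complex.normSq_eq_norm_sq, Complex.normSq_apply, hz]; ring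
  have hcos : Real.cos (Complex.arg z) = d / r := Complex.cos_arg hz0
  have hsin : Real.sin (Complex.arg z) = -c / r := Complex.sin_arg z
  have he : Real.exp (-Real.log r) = r⁻¹ := by rw [Real.exp_neg, Real.exp_log hr0]
  refine ⟨(a * c + b * d) / r ^ 2, -Real.log r, Complex.arg z, ?_⟩
  have hne : r ≠ 0 := hr0.ne'
  apply Matrix.SpecialLinearGroup.ext
  intro i j
  rw [Matrix.SpecialLinearGroup.coe_mul, Matrix.SpecialLinearGroup.coe_mul]
  fin_cases i <;> fin_cases j <;>
    simp [unip, diagSL, rot, Matrix.mul_apply, Fin.sum_univ_two, hcos, hsin, he]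
  · rw [← ha]; field_simp; rw [hr2]; linear_combination d * hdet
  · rw [← hb]; field_simp; rw [hr2]; linear_combination (-c) * hdet
  · rw [← hc]; field_simp
  · rw [← hd]; field_simp

variable {F : Type*} [Field F] [NumberField F] [IsTotallyReal F]

open Classical in
/-- The embedding of `SL₂(F_v)` in the adelic group at an archimedean place `v`. -/
def inclAt (v : InfinitePlace F) : Matrix.SpecialLinearGroup (Fin 2) ℝ →* GA F where
  toFun h := archIncl (Pi.mulSingle v h)
  map_one' := by rw [Pi.mulSingle_one, archIncl_one]
  map_mul' h k := by rw [Pi.mulSingle_mul, archIncl_mul]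

theorem archPart_inclAt_same (v : InfinitePlace F) (h : Matrix.SpecialLinearGroup (Fin 2) ℝ) :
    archPart (inclAt v h) v = h := by
  classical
  change archPart (archIncl (Pi.mulSingle v h)) v = h
  rw [archPart_archIncl, Pi.mulSingle_eq_same]

theorem archPart_inclAt_of_ne {v w : InfinitePlace F} (hw : w ≠ v)
    (h : Matrix.SpecialLinearGroup (Fin 2) ℝ) : archPart (inclAt v h) w = 1 := by
  classical
  change archPart (archIncl (Pi.mulSingle v h)) w = 1
  rw [archPart_archIncl, Pi.mulSingle_eq_of_ne hw]

/-- Elements with trivial component at `v` commute with the group at `v`. -/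
theorem inclAt_comm {v : InfinitePlace F} {g : GA F} (hg : archPart g v = 1)
    (h : Matrix.SpecialLinearGroup (Fin 2) ℝ) : inclAt v h * g = g * inclAt v h := by
  classical
  change archIncl (Pi.mulSingle v h) * g = g * archIncl (Pi.mulSingle v h)
  rw [archIncl_mul_eq]
  congr 2
  funext w
  by_cases hw : w = v
  · subst hw; simp [hg]
  · simp [Pi.mulSingle_eq_of_ne hw]

theorem inclAt_comm_inclAt {v w : InfinitePlace F} (hw : w ≠ v)
    (h k : Matrix.SpecialLinearGroup (Fin 2) ℝ) : inclAt v h * inclAt w k = inclAt w k * inclAt v h :=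
  inclAt_comm (archPart_inclAt_of_ne hw.symm k) h

theorem inclAt_rot_mem (v : InfinitePlace F) (θ : ℝ) :
    inclAt v (rot θ) ∈ maximalCompact (F := F) := by
  refine ⟨fun w => ?_, fun w i j => ?_⟩
  · by_cases hw : w = v
    · subst hw; rw [archPart_inclAt_same]; exact rot_mem θ
    · rw [archPart_inclAt_of_ne hw]; exact one_mem _
  · change ((1 : Matrix (Fin 2) (Fin 2) (FiniteAdeleRing (𝓞 F) F)) i j) w ∈ _
    fin_cases i <;> fin_cases j
    exacts [one_mem _, zero_mem _, zero_mem _, one_mem _]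

/-- Iwasawa decomposition at one archimedean place. -/
theorem exists_iwasawa_at (v : InfinitePlace F) (g : GA F) :
    ∃ (x τ θ : ℝ) (g' : GA F), archPart g' v = 1 ∧
      g = inclAt v (unip x) * inclAt v (diagSL (Units.mk0 (Real.exp τ) (Real.exp_ne_zero τ))) * g' *
        inclAt v (rot θ) := by
  obtain ⟨x, τ, θ, h⟩ := exists_iwasawa_real (archPart g v)
  have h1 : archPart ((inclAt v (archPart g v))⁻¹ * g) v = 1 := by
    rw [archPart_mul, archPart_inv, archPart_inclAt_same, inv_mul_cancel]
  refine ⟨x, τ, θ, (inclAt v (archPart g v))⁻¹ * g, h1, ?_⟩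
  rw [mul_assoc, ← inclAt_comm h1, ← mul_assoc, ← map_mul, ← map_mul, ← h, mul_inv_cancel_left]

/-- The space of functions of weight `k` at the archimedean place `v`. -/
def weightSpace (v : InfinitePlace F) (k : ℤ) : Submodule ℂ (GA F → ℂ) where
  carrier := {ψ | ∀ g θ, ψ (g * inclAt v (rot θ)) = Complex.exp (k * θ * Complex.I) * ψ g}
  add_mem' := fun {ψ ψ'} h h' g θ => by rw [Pi.add_apply, h, h', Pi.add_apply, mul_add]
  zero_mem' := fun g θ => by simp
  smul_mem' := fun c ψ h g θ => by
    rw [Pi.smul_apply, Pi.smul_apply, h, smul_eq_mul, smul_eq_mul]; ring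

end Rotations

/-! ### Lowering operators and weights -/

section Lowering

theorem hasDerivAt_expSL_entry (X : LieAlgebra.SpecialLinear.sl (Fin 2) ℝ) (i j : Fin 2) :
    HasDerivAt (fun t : ℝ => (expSL (t • X)).1 i j) (X.1 i j) 0 := by
  let _ : NormedRing (Matrix (Fin 2) (Fin 2) ℝ) := Matrix.linftyOpNormedRing
  let _ : NormedAlgebra ℝ (Matrix (Fin 2) (Fin 2) ℝ) := Matrix.linftyOpNormedAlgebra
  have h : HasDerivAt (fun t : ℝ => NormedSpace.exp (t • X.1)) X.1 0 := by
    have h := hasDerivAt_exp_smul_const (𝕂 := ℝ) X.1 (0 : ℝ)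
    rwa [zero_smul, NormedSpace.exp_zero, one_mul] at h
  exact (LinearMap.toContinuousLinearMap (Matrix.entryLinearMap ℝ ℝ i j)).hasFDerivAt.comp_hasDerivAt 0 h

variable {F : Type*} [Field F] [NumberField F] [IsTotallyReal F] {ψ ψ' : GA F → ℂ}

theorem Smooth.hasDerivAt (hψ : Smooth ψ)
    (X : InfinitePlace F → LieAlgebra.SpecialLinear.sl (Fin 2) ℝ) (g : GA F) :
    HasDerivAt (fun t : ℝ => ψ (g * archIncl fun v => expSL (t • X v))) (NearlyHolomorphic.lieDerivReal X ψ g) 0 := by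
  rw [lieDerivReal_apply hψ]
  exact lieDerivReal_eq_fderiv hψ X g

theorem lieDerivReal_add_fun (hψ : Smooth ψ) (hψ' : Smooth ψ')
    (X : InfinitePlace F → LieAlgebra.SpecialLinear.sl (Fin 2) ℝ) :
    lieDerivReal X (ψ + ψ') = lieDerivReal X ψ + lieDerivReal X ψ' := by
  funext g
  exact ((hψ.hasDerivAt X g).add (hψ'.hasDerivAt X g)).deriv

theorem lieDerivReal_smul_fun (hψ : Smooth ψ) (c : ℂ)
    (X : InfinitePlace F → LieAlgebra.SpecialLinear.sl (Fin 2) ℝ) :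
    lieDerivReal X (c • ψ) = c • lieDerivReal X ψ := by
  funext g
  exact ((hψ.hasDerivAt X g).const_smul c).deriv

/-- Right differentiation of a right translate, in terms of the adjoint action. -/
theorem lieDerivReal_comp_mul_right (hψ : Smooth ψ)
    {κ : InfinitePlace F → Matrix.SpecialLinearGroup (Fin 2) ℝ}
    {X Y : InfinitePlace F → LieAlgebra.SpecialLinear.sl (Fin 2) ℝ}
    (hY : ∀ v, (Y v).1 = (κ v)⁻¹.1 * (X v).1 * (κ v).1) (g : GA F) :
    lieDerivReal X (fun g => ψ (g * archIncl κ)) g = lieDerivReal Y ψ (g * archIncl κ) := by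
  have e : (fun t : ℝ => ψ (g * (archIncl fun v => expSL (t • X v)) * archIncl κ)) =
      fun t : ℝ => ψ (g * archIncl κ * archIncl (κ⁻¹ * (fun v => expSL (t • X v)) * κ)) := by
    funext t
    rw [archIncl_mul, archIncl_mul, archIncl_inv]
    congr 1
    group
  refine Eq.trans (congrArg (fun f => deriv f 0) e) (HasDerivAt.deriv ?_)
  refine hψ.hasDerivAt_curve _ Y ?_ fun v i j => ?_
  · funext v
    simp [expSL_zero]
  · have e1 : (fun t : ℝ => ((κ⁻¹ * (fun v => expSL (t • X v)) * κ) v).1 i j) = fun t : ℝ =>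
        ((κ v)⁻¹.1 i 0 * (expSL (t • X v)).1 0 0 + (κ v)⁻¹.1 i 1 * (expSL (t • X v)).1 1 0) * (κ v).1 0 j
        + ((κ v)⁻¹.1 i 0 * (expSL (t • X v)).1 0 1 + (κ v)⁻¹.1 i 1 * (expSL (t • X v)).1 1 1) *
          (κ v).1 1 j := by
      funext t
      simp only [Pi.mul_apply, Pi.inv_apply, Matrix.SpecialLinearGroup.coe_mul, Matrix.mul_apply,
        Fin.sum_univ_two]
    rw [e1, hY v]
    simp only [Matrix.mul_apply, Fin.sum_univ_two]
    have h (i j : Fin 2) := hasDerivAt_expSL_entry (X v) i j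
    exact ((((h 0 0).const_mul _).add ((h 1 0).const_mul _)).mul_const _).add
      ((((h 0 1).const_mul _).add ((h 1 1).const_mul _)).mul_const _)

theorem slRe_lowering : (slRe lowering).1 = !![1 / 2, 0; 0, -1 / 2] := by
  ext i j
  fin_cases i <;> fin_cases j <;> simp [slRe, lowering]

theorem slIm_lowering : (slIm lowering).1 = !![0, -1 / 2; -1 / 2, 0] := by
  ext i j
  fin_cases i <;> fin_cases j <;> simp [slIm, lowering]

variable (F) in
/-- Right translation on smooth functions. -/
def rightTranslate (κ : GA F) : smoothSpace F →ₗ[ℂ] smoothSpace F where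
  toFun ψ := ⟨fun g => ψ.1 (g * κ), Smooth.comp_mul_right ψ.2 κ⟩
  map_add' _ _ := rfl
  map_smul' _ _ := rfl

open Classical in
/-- An element of the real Lie algebra supported at one archimedean place. -/
def lieAt (v : InfinitePlace F) (X : LieAlgebra.SpecialLinear.sl (Fin 2) ℝ) :
    InfinitePlace F → LieAlgebra.SpecialLinear.sl (Fin 2) ℝ := Pi.single v X

open Classical in
/-- The lowering operator at an archimedean place, on smooth functions. -/
def lowerAt (v : InfinitePlace F) : smoothSpace F →ₗ[ℂ] smoothSpace F where
  toFun ψ := ⟨lieDerivReal (lieAt v (slRe lowering)) ψ.1 +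
      Complex.I • lieDerivReal (lieAt v (slIm lowering)) ψ.1,
    (Smooth.lieDerivReal ψ.2 _).add ((Smooth.lieDerivReal ψ.2 _).smul _)⟩
  map_add' ψ ψ' := Subtype.ext <| by
    change lieDerivReal _ (ψ.1 + ψ'.1) + Complex.I • lieDerivReal _ (ψ.1 + ψ'.1) =
      (lieDerivReal _ ψ.1 + Complex.I • lieDerivReal _ ψ.1) +
        (lieDerivReal _ ψ'.1 + Complex.I • lieDerivReal _ ψ'.1)
    rw [lieDerivReal_add_fun ψ.2 ψ'.2, lieDerivReal_add_fun ψ.2 ψ'.2, smul_add]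
    abel
  map_smul' c ψ := Subtype.ext <| by
    change lieDerivReal _ (c • ψ.1) + Complex.I • lieDerivReal _ (c • ψ.1) =
      c • (lieDerivReal _ ψ.1 + Complex.I • lieDerivReal _ ψ.1)
    rw [lieDerivReal_smul_fun ψ.2, lieDerivReal_smul_fun ψ.2, smul_add, smul_comm c]

open Classical in
theorem lowerAt_coe (v : InfinitePlace F) (ψ : smoothSpace F) :
    (lowerAt v ψ).1 = lieDeriv (Pi.single v lowering) ψ.1 := by
  have hre : (fun w => slRe ((Pi.single v lowering : LieG F) w)) = lieAt v (slRe lowering) := by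
    funext w
    by_cases hw : w = v
    · subst hw; simp [lieAt]
    · simp only [lieAt, Pi.single_eq_of_ne hw]
      exact Subtype.ext (by ext i j; rfl)
  have him : (fun w => slIm ((Pi.single v lowering : LieG F) w)) = lieAt v (slIm lowering) := by
    funext w
    by_cases hw : w = v
    · subst hw; simp [lieAt]
    · simp only [lieAt, Pi.single_eq_of_ne hw]
      exact Subtype.ext (by ext i j; rfl)
  funext g
  rw [lieDeriv, hre, him]
  rfl

open Classical in
theorem lowerAt_pow_coe (v : InfinitePlace F) (n : ℕ) (ψ : smoothSpace F) :
    ((lowerAt v ^ n) ψ).1 = wordAct (List.replicate n (Pi.single v lowering)) ψ.1 := by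
  induction n with
  | zero => rfl
  | succ n ih =>
    rw [pow_succ', Module.End.mul_apply, lowerAt_coe, ih]
    rfl

/-- Conjugation by a rotation multiplies the lowering element by a character of `SO(2)`. -/
theorem lowerAt_rightTranslate_same (v : InfinitePlace F) (θ : ℝ) (ψ : smoothSpace F) :
    lowerAt v (rightTranslate F (inclAt v (rot θ)) ψ) =
      Complex.exp (2 * θ * Complex.I) • rightTranslate F (inclAt v (rot θ)) (lowerAt v ψ) := by
  classical
  apply Subtype.ext
  funext g
  set κ : InfinitePlace F → Matrix.SpecialLinearGroup (Fin 2) ℝ := Pi.mulSingle v (rot θ) with hκ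
  have hcos2 : Real.cos (2 * θ) = Real.cos θ ^ 2 - Real.sin θ ^ 2 := Real.cos_two_mul' θ
  have hsin2 : Real.sin (2 * θ) = 2 * Real.sin θ * Real.cos θ := Real.sin_two_mul θ
  have hA := lieDerivReal_comp_mul_right (κ := κ) (X := lieAt v (slRe lowering))
    (Y := Real.cos (2 * θ) • lieAt v (slRe lowering) + (-Real.sin (2 * θ)) • lieAt v (slIm lowering))
    ψ.2 (by
      intro w
      by_cases hw : w = v
      · subst hw
        simp only [hκ, lieAt, Pi.add_apply, Pi.smul_apply, Pi.single_eq_same, Pi.mulSingle_eq_same]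
        rw [Submodule.coe_add, Submodule.coe_smul, Submodule.coe_smul, slRe_lowering, slIm_lowering,
          Matrix.SpecialLinearGroup.coe_inv, Matrix.adjugate_fin_two]
        ext i j
        fin_cases i <;> fin_cases j <;>
          simp [rot, Matrix.mul_apply, Fin.sum_univ_two, hcos2, hsin2] <;> ring
      · simp [hκ, lieAt, Pi.single_eq_of_ne hw, Pi.mulSingle_eq_of_ne hw]) g
  have hB := lieDerivReal_comp_mul_right (κ := κ) (X := lieAt v (slIm lowering))
    (Y := Real.sin (2 * θ) • lieAt v (slRe lowering) + Real.cos (2 * θ) • lieAt v (slIm lowering))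
    ψ.2 (by
      intro w
      by_cases hw : w = v
      · subst hw
        simp only [hκ, lieAt, Pi.add_apply, Pi.smul_apply, Pi.single_eq_same, Pi.mulSingle_eq_same]
        rw [Submodule.coe_add, Submodule.coe_smul, Submodule.coe_smul, slRe_lowering, slIm_lowering,
          Matrix.SpecialLinearGroup.coe_inv, Matrix.adjugate_fin_two]
        ext i j
        fin_cases i <;> fin_cases j <;>
          simp [rot, Matrix.mul_apply, Fin.sum_univ_two, hcos2, hsin2] <;> ring
      · simp [hκ, lieAt, Pi.single_eq_of_ne hw, Pi.mulSingle_eq_of_ne hw]) g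
  rw [lieDerivReal_add ψ.2, lieDerivReal_smul ψ.2, lieDerivReal_smul ψ.2] at hA hB
  have hexp : Complex.exp (2 * θ * Complex.I) =
      ((Real.cos (2 * θ) : ℝ) : ℂ) + ((Real.sin (2 * θ) : ℝ) : ℂ) * Complex.I := by
    rw [Complex.exp_mul_I]; push_cast; rfl
  change lieDerivReal _ (fun g => ψ.1 (g * archIncl κ)) g +
      Complex.I * lieDerivReal _ (fun g => ψ.1 (g * archIncl κ)) g =
    Complex.exp (2 * θ * Complex.I) * (lieDerivReal _ ψ.1 (g * archIncl κ) +
      Complex.I * lieDerivReal _ ψ.1 (g * archIncl κ))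
  rw [hA, hB, hexp]
  push_cast
  linear_combination (-(Complex.sin (2 * θ)) * lieDerivReal (lieAt v (slIm lowering)) ψ.1 (g * archIncl κ)) * Complex.I_sq

theorem lowerAt_rightTranslate_of_ne {v w : InfinitePlace F} (hw : w ≠ v) (θ : ℝ) (ψ : smoothSpace F) :
    lowerAt v (rightTranslate F (inclAt w (rot θ)) ψ) =
      rightTranslate F (inclAt w (rot θ)) (lowerAt v ψ) := by
  classical
  apply Subtype.ext
  funext g
  set κ : InfinitePlace F → Matrix.SpecialLinearGroup (Fin 2) ℝ := Pi.mulSingle w (rot θ) with hκ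
  have h (X) := lieDerivReal_comp_mul_right (κ := κ) (X := lieAt v X) (Y := lieAt v X)
    ψ.2 (by
      intro u
      by_cases hu : u = v
      · subst hu
        simp [hκ, lieAt, Pi.mulSingle_eq_of_ne hw.symm]
      · simp [lieAt, Pi.single_eq_of_ne hu]) g
  change lieDerivReal _ (fun g => ψ.1 (g * archIncl κ)) g +
      Complex.I * lieDerivReal _ (fun g => ψ.1 (g * archIncl κ)) g = lieDerivReal _ ψ.1 (g * archIncl κ) +
      Complex.I * lieDerivReal _ ψ.1 (g * archIncl κ)
  rw [h, h]

theorem exists_lowerAt_rightTranslate (v w : InfinitePlace F) (θ : ℝ) :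
    ∃ c : ℂ, ∀ ψ : smoothSpace F, lowerAt v (rightTranslate F (inclAt w (rot θ)) ψ) =
      c • rightTranslate F (inclAt w (rot θ)) (lowerAt v ψ) := by
  by_cases hw : w = v
  · subst hw; exact ⟨_, lowerAt_rightTranslate_same w θ⟩
  · exact ⟨1, fun ψ => by rw [one_smul]; exact lowerAt_rightTranslate_of_ne hw θ ψ⟩

theorem lowerAt_pow_rightTranslate (v w : InfinitePlace F) (θ : ℝ) (n : ℕ) (ψ : smoothSpace F)
    (h : (lowerAt v ^ n) ψ = 0) : (lowerAt v ^ n) (rightTranslate F (inclAt w (rot θ)) ψ) = 0 := by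
  obtain ⟨c, hc⟩ := exists_lowerAt_rightTranslate (F := F) v w θ
  have key : ∀ j : ℕ, (lowerAt v ^ j) (rightTranslate F (inclAt w (rot θ)) ψ) =
      c ^ j • rightTranslate F (inclAt w (rot θ)) ((lowerAt v ^ j) ψ) := by
    intro j
    induction j with
    | zero => simp
    | succ j ih =>
      rw [pow_succ', Module.End.mul_apply, ih, map_smul, hc, smul_smul, ← pow_succ, Module.End.mul_apply]
  rw [key, h, map_zero, smul_zero]

variable (F) in
/-- Functions on `SL₂(F) \ SL₂(𝔸_F)`. -/
def leftInvariantSpace : Submodule ℂ (GA F → ℂ) where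
  carrier := {ψ | ∀ γ g, ψ (rational γ * g) = ψ g}
  add_mem' := fun h h' γ g => by rw [Pi.add_apply, h, h']; rfl
  zero_mem' := fun _ _ => rfl
  smul_mem' := fun c ψ h γ g => by rw [Pi.smul_apply, h]; rfl

variable (F) in
/-- Smooth `K`-finite functions on `SL₂(F) \ SL₂(𝔸_F)` killed by the `m`-th power of every lowering
operator. -/
def formSpace (m : ℕ) : Submodule ℂ (GA F → ℂ) :=
  (⨅ v, LinearMap.ker (lowerAt v ^ m : smoothSpace F →ₗ[ℂ] smoothSpace F)).map (smoothSpace F).subtype ⊓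
    leftInvariantSpace F ⊓ kFiniteSpace F

theorem mem_formSpace {m : ℕ} : ψ ∈ formSpace F m ↔
    (∃ h : Smooth ψ, ∀ v, (lowerAt v ^ m) ⟨ψ, h⟩ = 0) ∧
      (∀ γ g, ψ (rational γ * g) = ψ g) ∧ KFinite ψ := by
  constructor
  · rintro ⟨⟨⟨⟨ψ, hs⟩, h1, rfl⟩, h2⟩, h3⟩
    exact ⟨⟨hs, fun v => (Submodule.mem_iInf _).1 h1 v⟩, h2, h3⟩
  · rintro ⟨⟨hs, h1⟩, h2, h3⟩
    exact ⟨⟨⟨⟨ψ, hs⟩, (Submodule.mem_iInf _).2 h1, rfl⟩, h2⟩, h3⟩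

theorem formSpace_rotate {m : ℕ} (hψ : ψ ∈ formSpace F m) (v : InfinitePlace F) (θ : ℝ) :
    (fun g => ψ (g * inclAt v (rot θ))) ∈ formSpace F m := by
  obtain ⟨⟨hs, h1⟩, h2, h3⟩ := mem_formSpace.1 hψ
  refine mem_formSpace.2 ⟨⟨hs.comp_mul_right _, fun w => ?_⟩, fun γ g => ?_,
    h3.comp_mul_right (inclAt_rot_mem v θ)⟩
  · exact lowerAt_pow_rightTranslate w v θ m ⟨ψ, hs⟩ (h1 w)
  · rw [mul_assoc, h2]

theorem weightSpace_rotate {v w : InfinitePlace F} {k : ℤ} (hψ : ψ ∈ weightSpace v k) (θ : ℝ) :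
    (fun g => ψ (g * inclAt w (rot θ))) ∈ weightSpace v k := by
  intro g η
  have hcomm : inclAt v (rot η) * inclAt w (rot θ) = inclAt w (rot θ) * inclAt v (rot η) := by
    by_cases hw : w = v
    · subst hw; rw [← map_mul, ← map_mul, ← rot_add, ← rot_add, add_comm]
    · exact inclAt_comm_inclAt hw _ _
  change ψ (g * inclAt v (rot η) * inclAt w (rot θ)) = _ * ψ (g * inclAt w (rot θ))
  rw [mul_assoc, hcomm, ← mul_assoc, hψ]

theorem continuous_rot : Continuous rot := by
  refine continuous_induced_rng.2 (continuous_matrix fun i j => ?_)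
  fin_cases i <;> fin_cases j
  exacts [Real.continuous_cos, Real.continuous_sin, Real.continuous_sin.neg, Real.continuous_cos]

theorem continuous_inclAt (v : InfinitePlace F) : Continuous (inclAt (F := F) v) := by
  classical
  exact continuous_archIncl.comp (continuous_mulSingle (A := fun _ => Matrix.SpecialLinearGroup (Fin 2) ℝ) v)

/-- Decomposition into weight vectors, within `formSpace`: the components are combinations of
rotation translates. -/
theorem mem_iSup_weight {m : ℕ} (hψ : ψ ∈ formSpace F m) :
    ψ ∈ ⨆ k : InfinitePlace F → ℤ, formSpace F m ⊓ ⨅ v, weightSpace v (k v) := by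
  refine mem_iSup_iInf (formSpace F m) (fun v k => weightSpace v k) (fun v h hh => ?_) ψ hψ
  obtain ⟨⟨hs, h1⟩, h2, h3⟩ := mem_formSpace.1 hh
  have hfin : FiniteDimensional ℂ (Submodule.span ℂ
      (Set.range fun (t : ℝ) g => h (g * inclAt v (rot t)))) := by
    have : FiniteDimensional ℂ (compactSpan h) := h3
    refine Submodule.finiteDimensional_of_le (S₂ := compactSpan h) (Submodule.span_mono ?_)
    rintro _ ⟨t, rfl⟩
    exact ⟨_, inclAt_rot_mem v t, rfl⟩
  obtain ⟨S, c, hc, hcS⟩ := exists_fourier_decomposition (fun t g => g * inclAt v (rot t))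
    (fun g => by rw [rot_zero, map_one, mul_one])
    (fun s t g => by rw [add_comm, rot_add, map_mul, mul_assoc])
    (fun g => by rw [rot_two_pi, map_one, mul_one]) h
    (fun g => hs.continuous.comp (continuous_const.mul ((continuous_inclAt v).comp continuous_rot))) hfin
  refine ⟨S, c, hc, fun n _ => ⟨?_, fun g θ => (hcS n).2 θ g, fun w k hw => ?_⟩⟩
  · refine Submodule.span_le.2 ?_ (hcS n).1
    rintro _ ⟨t, rfl⟩
    exact formSpace_rotate hh v t
  · refine Submodule.span_le.2 ?_ (hcS n).1
    rintro _ ⟨t, rfl⟩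
    exact weightSpace_rotate hw t

end Lowering

/-! ### The constant term as a linear map -/

section UnipotentAverage

variable {F : Type*} [Field F] [NumberField F]

omit [NumberField F] in
theorem unip_mul_diagSL {R : Type*} [CommRing R] (x : R) (a : Rˣ) :
    unip x * diagSL a = diagSL a * unip ((a⁻¹ : Rˣ) * ((a⁻¹ : Rˣ) * x)) := by
  apply Matrix.SpecialLinearGroup.ext
  intro i j
  rw [Matrix.SpecialLinearGroup.coe_mul, Matrix.SpecialLinearGroup.coe_mul]
  fin_cases i <;> fin_cases j <;>
    simp [unip, diagSL, Matrix.mul_apply, Fin.sum_univ_two]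
  rw [mul_comm]

theorem diagSL_mul_unip {R : Type*} [CommRing R] (x : R) (a : Rˣ) :
    diagSL a * unip x = unip (a * (a * x)) * diagSL a := by
  rw [unip_mul_diagSL, ← mul_assoc ((a⁻¹ : Rˣ) : R) (a : R), Units.inv_mul, one_mul,
    Units.inv_mul_cancel_left]

theorem diagSL_mul {R : Type*} [CommRing R] (a b : Rˣ) : diagSL (a * b) = diagSL a * diagSL b := by
  apply Matrix.SpecialLinearGroup.ext
  intro i j
  rw [Matrix.SpecialLinearGroup.coe_mul]
  fin_cases i <;> fin_cases j <;>
    simp [diagSL, Matrix.mul_apply, Fin.sum_univ_two]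
  rw [mul_comm]

theorem continuous_unip : Continuous (unip : Adele F → GA F) := by
  refine continuous_induced_rng.2 (continuous_matrix fun i j => ?_)
  fin_cases i <;> fin_cases j
  exacts [continuous_const, continuous_id, continuous_const, continuous_const]

variable (F) in
/-- Continuous functions that are left invariant under the rational upper unipotent matrices. -/
def unipInvariantSpace : Submodule ℂ (GA F → ℂ) where
  carrier := {ψ | Continuous ψ ∧ ∀ (ξ : F) g, ψ (unip (algebraMap F (Adele F) ξ) * g) = ψ g}
  add_mem' := fun h h' => ⟨h.1.add h'.1, fun ξ g => by rw [Pi.add_apply, h.2, h'.2]; rfl⟩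
  zero_mem' := ⟨continuous_const, fun _ _ => rfl⟩
  smul_mem' := fun c ψ h => ⟨h.1.const_smul c, fun ξ g => by rw [Pi.smul_apply, h.2]; rfl⟩

variable {ψ : GA F → ℂ}

/-- The integrand of the constant term does not depend on the chosen representatives. -/
theorem unipInvariant_out (hψ : ψ ∈ unipInvariantSpace F) (x : Adele F) (g : GA F) :
    ψ (unip (Quotient.out (x : AdeleQuot F)) * g) = ψ (unip x * g) := by
  obtain ⟨ξ, hξ⟩ := QuotientAddGroup.leftRel_apply.1
    (Quotient.exact (Quotient.out_eq (x : AdeleQuot F)))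
  have hx : x = algebraMap F (Adele F) ξ + Quotient.out (x : AdeleQuot F) := by
    rw [hξ]; ring
  conv_rhs => rw [hx, unip_add, mul_assoc, hψ.2]

theorem continuous_unipFiber (hψ : ψ ∈ unipInvariantSpace F) (g : GA F) :
    Continuous fun q : AdeleQuot F => ψ (unip (Quotient.out q) * g) := by
  rw [(QuotientAddGroup.isQuotientMap_mk (N := AdeleRing.principalSubgroup (𝓞 F) F)).continuous_iff]
  have : (fun q : AdeleQuot F => ψ (unip (Quotient.out q) * g)) ∘ QuotientAddGroup.mk =
      fun x : Adele F => ψ (unip x * g) := funext fun x => unipInvariant_out hψ x g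
  rw [this]
  exact hψ.1.comp (continuous_unip.mul continuous_const)

variable [IsTotallyReal F] [MeasurableSpace (AdeleQuot F)] [BorelSpace (AdeleQuot F)]
  (dn : Measure (AdeleQuot F)) [dn.IsAddHaarMeasure]

theorem integrable_unipFiber (hψ : ψ ∈ unipInvariantSpace F) (g : GA F) :
    Integrable (fun q : AdeleQuot F => ψ (unip (Quotient.out q) * g)) dn :=
  (continuous_unipFiber hψ g).integrable_of_hasCompactSupport (HasCompactSupport.of_compactSpace _)

/-- The constant term, as a linear map. -/
def unipAverage : unipInvariantSpace F →ₗ[ℂ] (GA F → ℂ) where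
  toFun := fun ψ g => ∫ q, ψ.1 (unip (Quotient.out q) * g) ∂dn
  map_add' ψ ψ' := funext fun g =>
    integral_add (integrable_unipFiber dn ψ.2 g) (integrable_unipFiber dn ψ'.2 g)
  map_smul' c _ := funext fun _ => integral_const_mul c _

theorem unipAverage_apply (ψ : unipInvariantSpace F) (g : GA F) :
    unipAverage dn ψ g = ∫ q, ψ.1 (unip (Quotient.out q) * g) ∂dn := rfl

theorem unipAverage_unip_mul (ψ : unipInvariantSpace F) (x : Adele F) (g : GA F) :
    unipAverage dn ψ (unip x * g) = unipAverage dn ψ g := by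
  rw [unipAverage_apply, unipAverage_apply,
    ← integral_add_right_eq_self (fun q : AdeleQuot F => ψ.1 (unip (Quotient.out q) * g)) (x : AdeleQuot F)]
  congr 1
  funext q
  obtain ⟨y, rfl⟩ := QuotientAddGroup.mk_surjective q
  rw [unipInvariant_out ψ.2, ← QuotientAddGroup.mk_add, unipInvariant_out ψ.2, unip_add, mul_assoc]

/-- The constant term is left invariant under the rational torus, which acts on `N` through
automorphisms preserving the measure of `N(F) \ N(𝔸_F)`. -/
theorem unipAverage_diagSL_mul (ψ : unipInvariantSpace F)
    (hψ : ∀ γ g, ψ.1 (rational γ * g) = ψ.1 g) (β : Fˣ) (g : GA F) :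
    unipAverage dn ψ (diagSL (principalIdele β) * g) = unipAverage dn ψ g := by
  have hβ : ((β⁻¹ : Fˣ) : F) * ((β⁻¹ : Fˣ) : F) ≠ 0 := mul_ne_zero β⁻¹.ne_zero β⁻¹.ne_zero
  have hdiag : rational (diagSL β) = diagSL (principalIdele β) := by
    apply Matrix.SpecialLinearGroup.ext
    intro i j
    rw [rational, Matrix.SpecialLinearGroup.map_apply_coe]
    fin_cases i <;> fin_cases j <;> simp [diagSL, principalIdele]
  have hmp := measurePreserving_mulQuot dn hβ
  rw [unipAverage_apply, unipAverage_apply]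
  conv_rhs => rw [← hmp.map_eq]
  rw [integral_map hmp.measurable.aemeasurable
    (continuous_unipFiber ψ.2 g).measurable.aestronglyMeasurable]
  congr 1
  funext q
  obtain ⟨y, rfl⟩ := QuotientAddGroup.mk_surjective q
  change _ = ψ.1 (unip (Quotient.out ((algebraMap F (Adele F) (((β⁻¹ : Fˣ) : F) * ((β⁻¹ : Fˣ) : F)) * y : Adele F) : AdeleQuot F)) * g)
  rw [unipInvariant_out ψ.2, unipInvariant_out ψ.2, ← mul_assoc, unip_mul_diagSL, ← hdiag, mul_assoc, hψ]
  rw [map_mul, mul_assoc, ← map_inv]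
  rfl

omit [MeasurableSpace (AdeleQuot F)] [BorelSpace (AdeleQuot F)] in
theorem lieDerivReal_mem_unipInvariantSpace (hψ : ψ ∈ unipInvariantSpace F) (hs : Smooth ψ)
    (X : InfinitePlace F → LieAlgebra.SpecialLinear.sl (Fin 2) ℝ) :
    lieDerivReal X ψ ∈ unipInvariantSpace F := by
  refine ⟨(hs.lieDerivReal X).continuous, fun ξ g => ?_⟩
  rw [← lieDerivReal_comp_mul_left]
  congr 1
  exact funext fun h => hψ.2 ξ h

omit [MeasurableSpace (AdeleQuot F)] [BorelSpace (AdeleQuot F)] in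
theorem Smooth.hasDerivAt_inclAt {ψ : GA F → ℂ} (hs : Smooth ψ) (v : InfinitePlace F)
    {γ : ℝ → Matrix.SpecialLinearGroup (Fin 2) ℝ} (hγ0 : γ 0 = 1)
    {X : LieAlgebra.SpecialLinear.sl (Fin 2) ℝ}
    (hX : ∀ i j, HasDerivAt (fun t => (γ t).1 i j) (X.1 i j) 0) (h : GA F) :
    HasDerivAt (fun t => ψ (h * inclAt v (γ t))) (NearlyHolomorphic.lieDerivReal (lieAt v X) ψ h) 0 := by
  classical
  refine hs.hasDerivAt_curve h (lieAt v X) (γ := fun t => Pi.mulSingle v (γ t)) ?_ fun w i j => ?_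
  · rw [hγ0, Pi.mulSingle_one]
  · by_cases hw : w = v
    · subst hw
      simpa only [lieAt, Pi.mulSingle_eq_same, Pi.single_eq_same] using hX i j
    · simp only [lieAt, Pi.mulSingle_eq_of_ne hw, Pi.single_eq_of_ne hw]
      exact hasDerivAt_const _ _

/-- The constant term commutes with right differentiation along one-parameter subgroups. -/
theorem hasDerivAt_unipAverage (hψ : ψ ∈ unipInvariantSpace F) (hs : Smooth ψ) (v : InfinitePlace F)
    {γ : ℝ → Matrix.SpecialLinearGroup (Fin 2) ℝ} (hadd : ∀ s t, γ (s + t) = γ s * γ t)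
    (hcont : Continuous γ) {X : LieAlgebra.SpecialLinear.sl (Fin 2) ℝ}
    (hX : ∀ i j, HasDerivAt (fun t => (γ t).1 i j) (X.1 i j) 0) (g : GA F) :
    HasDerivAt (fun t => unipAverage dn ⟨ψ, hψ⟩ (g * inclAt v (γ t)))
      (unipAverage dn ⟨_, lieDerivReal_mem_unipInvariantSpace hψ hs (lieAt v X)⟩ g) 0 := by
  classical
  have hγ0 : γ 0 = 1 := by
    have := hadd 0 0
    rw [add_zero] at this
    exact mul_eq_left.1 this.symm
  have hd := lieDerivReal_mem_unipInvariantSpace hψ hs (lieAt v X)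
  set ψ' := lieDerivReal (lieAt v X) ψ with hψ'
  have hderiv : ∀ (h : GA F) (s : ℝ), HasDerivAt (fun t => ψ (h * inclAt v (γ t)))
      (ψ' (h * inclAt v (γ s))) s := by
    intro h s
    have h1 := hs.hasDerivAt_inclAt v hγ0 hX (h * inclAt v (γ s))
    rw [← sub_self s] at h1
    have h2 := h1.comp_sub_const s s
    refine h2.congr_of_eventuallyEq (Filter.Eventually.of_forall fun t => ?_)
    change ψ (h * inclAt v (γ t)) = ψ (h * inclAt v (γ s) * inclAt v (γ (t - s)))
    rw [mul_assoc h, ← map_mul, ← hadd, add_sub_cancel]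
  have hγc : Continuous fun t => inclAt (F := F) v (γ t) := (continuous_inclAt v).comp hcont
  -- The derivative is dominated by a constant: representatives may be moved into a compact box.
  obtain ⟨M, hM⟩ := exists_adeleBox_cover F
  obtain ⟨C, hC⟩ := (isCompact_Icc (a := (-1 : ℝ)) (b := 1)).prod (isCompact_adeleBox (F := F) M)
    |>.exists_bound_of_continuousOn (f := fun p => ψ' (unip p.2 * (g * inclAt v (γ p.1))))
    (hd.1.comp ((continuous_unip.comp continuous_snd).mul
      (continuous_const.mul (hγc.comp continuous_fst)))).continuousOn
  have h := hasDerivAt_integral_of_dominated_loc_of_deriv_le (μ := dn) (𝕜 := ℝ) (x₀ := (0 : ℝ))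
    (s := Set.Icc (-1) 1) (bound := fun _ => C)
    (F := fun t q => ψ (unip (Quotient.out q) * (g * inclAt v (γ t))))
    (F' := fun t q => ψ' (unip (Quotient.out q) * (g * inclAt v (γ t))))
    (Icc_mem_nhds (by norm_num) (by norm_num))
    (Filter.Eventually.of_forall fun t =>
      (continuous_unipFiber hψ _).measurable.aestronglyMeasurable)
    (integrable_unipFiber dn hψ _)
    (continuous_unipFiber hd _).measurable.aestronglyMeasurable
    (Filter.Eventually.of_forall fun q t ht => by
      obtain ⟨a, rfl⟩ := QuotientAddGroup.mk_surjective q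
      obtain ⟨x, hx⟩ := hM a
      have e : a = algebraMap F (Adele F) x + (a - algebraMap F (Adele F) x) := by ring
      rw [unipInvariant_out hd, e, unip_add, mul_assoc, hd.2]
      exact hC (t, _) ⟨ht, hx⟩)
    (integrable_const _)
    (Filter.Eventually.of_forall fun q t _ => by
      simp only [← mul_assoc]
      exact hderiv _ t)
  have h2 := h.2
  rw [hγ0, map_one, mul_one] at h2
  exact h2

end UnipotentAverage

/-! ### A triangular system of differential equations -/

section Exponents

/-- The span of the exponentials `t ↦ exp (n t)`, for `n ∈ S`. -/
def expSpan (S : Set ℤ) : Submodule ℂ (ℝ → ℂ) :=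
  Submodule.span ℂ ((fun (n : ℤ) (t : ℝ) => Complex.exp (n * t)) '' S)

theorem sum_mem_expSpan {S : Set ℤ} {I : Finset ℕ} {n : ℕ → ℤ} (hn : ∀ i ∈ I, n i ∈ S) (c : ℕ → ℂ) :
    (fun t : ℝ => ∑ i ∈ I, c i * Complex.exp (n i * t)) ∈ expSpan S := by
  have : (fun t : ℝ => ∑ i ∈ I, c i * Complex.exp (n i * t)) =
      ∑ i ∈ I, c i • fun t : ℝ => Complex.exp (n i * t) := by
    funext t; rw [Finset.sum_apply]; rfl
  rw [this]
  exact Submodule.sum_mem _ fun i hi => Submodule.smul_mem _ _ (Submodule.subset_span ⟨n i, hn i hi, rfl⟩)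

/-- Solutions of the triangular system of differential equations `f_j' = 2 f_{j+1} + (k - 2j) f_j`
with `f_m = 0`: the exponents `k - 2j` are distinct, so that no polynomial factors appear. -/
theorem exists_exponential_sum (k : ℤ) (m : ℕ) (f : ℕ → ℝ → ℂ)
    (hf : ∀ j t, HasDerivAt (f j) (2 * f (j + 1) t + ((k - 2 * j : ℤ) : ℂ) * f j t) t)
    (hm : ∀ t, f m t = 0) :
    ∃ c : ℕ → ℂ, ∀ t, f 0 t = ∑ i ∈ Finset.range m, c i * Complex.exp (((k - 2 * i : ℤ) : ℂ) * t) := by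
  have key : ∀ d j : ℕ, j + d = m → ∃ c : ℕ → ℂ, ∀ t, f j t =
      ∑ i ∈ Finset.Ico j m, c i * Complex.exp (((k - 2 * i : ℤ) : ℂ) * t) := by
    intro d
    induction d with
    | zero =>
      intro j hj
      rw [add_zero] at hj
      subst hj
      exact ⟨0, fun t => by simp [hm]⟩
    | succ d ih =>
      intro j hj
      obtain ⟨c, hc⟩ := ih (j + 1) (by omega)
      -- A particular solution: `P' - (k - 2j) P = 2 f_{j+1}` since `(k - 2i) - (k - 2j) = 2 (j - i)`.
      set P : ℝ → ℂ := fun t => ∑ i ∈ Finset.Ico (j + 1) m,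
        (c i / ((j : ℂ) - i)) * Complex.exp (((k - 2 * i : ℤ) : ℂ) * t) with hP
      have hexp : ∀ (n : ℤ) (t : ℝ), HasDerivAt (fun t : ℝ => Complex.exp ((n : ℂ) * t))
          (Complex.exp ((n : ℂ) * t) * n) t := by
        intro n t
        have h1 : HasDerivAt (fun t : ℝ => (n : ℂ) * (t : ℂ)) ((n : ℂ) * 1) t :=
          (Complex.ofRealCLM.hasDerivAt (x := t)).const_mul (n : ℂ)
        rw [mul_one] at h1
        exact h1.cexp
      have hPd : ∀ t, HasDerivAt P (2 * f (j + 1) t + ((k - 2 * j : ℤ) : ℂ) * P t) t := by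
        intro t
        have h1 : HasDerivAt P (∑ i ∈ Finset.Ico (j + 1) m, (c i / ((j : ℂ) - i)) *
            (Complex.exp (((k - 2 * i : ℤ) : ℂ) * t) * ((k - 2 * i : ℤ) : ℂ))) t :=
          HasDerivAt.fun_sum fun i _ => (hexp _ t).const_mul _
        convert h1 using 1
        rw [hc, hP, Finset.mul_sum, Finset.mul_sum, ← Finset.sum_add_distrib]
        refine Finset.sum_congr rfl fun i hi => ?_
        have hne : (j : ℂ) - i ≠ 0 := by
          rw [sub_ne_zero]
          have := (Finset.mem_Ico.1 hi).1
          exact_mod_cast (by omega : j ≠ i)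
        push_cast
        field_simp
        ring
      have hconst : ∀ t, HasDerivAt (fun t => (f j t - P t) * Complex.exp (((-(k - 2 * j) : ℤ) : ℂ) * t)) 0 t := by
        intro t
        have h1 := ((hf j t).sub (hPd t)).mul (hexp (-(k - 2 * j)) t)
        refine h1.congr_deriv ?_
        rw [Pi.sub_apply]
        push_cast
        ring
      have h0 := is_const_of_deriv_eq_zero (fun t => (hconst t).differentiableAt)
        (fun t => (hconst t).deriv)
      refine ⟨fun i => if i = j then f j 0 - P 0 else c i / ((j : ℂ) - i), fun t => ?_⟩
      rw [Finset.sum_eq_sum_Ico_succ_bot (by omega : j < m)]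
      beta_reduce
      rw [if_pos rfl]
      have h1 := h0 t 0
      simp only [Complex.ofReal_zero, mul_zero, Complex.exp_zero, mul_one] at h1
      have h2 : ∑ i ∈ Finset.Ico (j + 1) m, (if i = j then f j 0 - P 0 else c i / ((j : ℂ) - i)) *
          Complex.exp (((k - 2 * i : ℤ) : ℂ) * t) = P t := by
        refine Finset.sum_congr rfl fun i hi => ?_
        rw [if_neg (by have := (Finset.mem_Ico.1 hi).1; omega)]
      rw [h2, ← h1, mul_assoc, ← Complex.exp_add]
      have h3 : ((-(k - 2 * j) : ℤ) : ℂ) * t + ((k - 2 * j : ℤ) : ℂ) * t = 0 := by push_cast; ring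
      rw [h3, Complex.exp_zero]
      ring
  obtain ⟨c, hc⟩ := key m 0 (zero_add m)
  exact ⟨c, fun t => by rw [hc, Finset.range_eq_Ico]⟩

end Exponents

/-! ### Exponents of the constant term -/

section ExponentsOfConstantTerm

/-- The one-parameter group `diag(exp t, exp (-t))`. -/
def torusReal (t : ℝ) : Matrix.SpecialLinearGroup (Fin 2) ℝ :=
  diagSL (Units.mk0 (Real.exp t) (Real.exp_ne_zero t))

theorem torusReal_add (s t : ℝ) : torusReal (s + t) = torusReal s * torusReal t := by
  rw [torusReal, torusReal, torusReal, ← diagSL_mul]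
  congr 1
  exact Units.ext (Real.exp_add s t)

theorem torusReal_entries (t : ℝ) : (torusReal t).1 = !![Real.exp t, 0; 0, Real.exp (-t)] := by
  rw [Real.exp_neg]
  ext i j
  fin_cases i <;> fin_cases j <;> simp [torusReal, diagSL]

theorem hasDerivAt_torusReal (i j : Fin 2) :
    HasDerivAt (fun t => (torusReal t).1 i j) ((slOfCoord ![1, 0, 0]).1 i j) 0 := by
  simp only [torusReal_entries]
  have h : HasDerivAt (fun t : ℝ => Real.exp (-t)) (-1) 0 := by
    simpa using ((hasDerivAt_id (0 : ℝ)).neg).exp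
  fin_cases i <;> fin_cases j
  · simpa [slOfCoord] using Real.hasDerivAt_exp 0
  · simpa [slOfCoord] using hasDerivAt_const (0 : ℝ) (0 : ℝ)
  · simpa [slOfCoord] using hasDerivAt_const (0 : ℝ) (0 : ℝ)
  · simpa [slOfCoord] using h

theorem continuous_torusReal : Continuous torusReal := by
  refine continuous_induced_rng.2 (continuous_matrix fun i j => ?_)
  have : (fun t => (torusReal t).1 i j) = fun t => !![Real.exp t, 0; 0, Real.exp (-t)] i j := by
    funext t; rw [torusReal_entries]
  refine Continuous.congr (f := fun t => !![Real.exp t, 0; 0, Real.exp (-t)] i j) ?_ (congrFun this.symm)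
  fin_cases i <;> fin_cases j
  exacts [Real.continuous_exp, continuous_const, continuous_const, Real.continuous_exp.comp continuous_neg]

theorem hasDerivAt_unip (i j : Fin 2) :
    HasDerivAt (fun t : ℝ => (unip t).1 i j) ((slOfCoord ![0, 1, 0]).1 i j) 0 := by
  fin_cases i <;> fin_cases j
  · simpa [slOfCoord, unip] using hasDerivAt_const (0 : ℝ) (1 : ℝ)
  · simpa [slOfCoord, unip] using hasDerivAt_id' (0 : ℝ)
  · simpa [slOfCoord, unip] using hasDerivAt_const (0 : ℝ) (0 : ℝ)
  · simpa [slOfCoord, unip] using hasDerivAt_const (0 : ℝ) (1 : ℝ)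

theorem continuous_unip_real : Continuous (unip : ℝ → Matrix.SpecialLinearGroup (Fin 2) ℝ) := by
  refine continuous_induced_rng.2 (continuous_matrix fun i j => ?_)
  fin_cases i <;> fin_cases j
  exacts [continuous_const, continuous_id, continuous_const, continuous_const]

theorem hasDerivAt_rot (i j : Fin 2) :
    HasDerivAt (fun t : ℝ => (rot t).1 i j) ((slOfCoord ![0, 1, -1]).1 i j) 0 := by
  fin_cases i <;> fin_cases j
  · simpa [slOfCoord, rot] using Real.hasDerivAt_cos 0
  · simpa [slOfCoord, rot] using Real.hasDerivAt_sin 0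
  · simpa [slOfCoord, rot] using (Real.hasDerivAt_sin 0).fun_neg
  · simpa [slOfCoord, rot] using Real.hasDerivAt_cos 0

variable {F : Type*} [Field F] [NumberField F] [IsTotallyReal F]

/-- The one-parameter group `diag(exp t, exp (-t))` at the archimedean place `v`. -/
def torusAt (v : InfinitePlace F) (t : ℝ) : GA F := inclAt v (torusReal t)

theorem torusAt_add (v : InfinitePlace F) (s t : ℝ) :
    torusAt v (s + t) = torusAt v s * torusAt v t := by
  rw [torusAt, torusReal_add, map_mul]; rfl

open Classical in
/-- The adele with component `x` at the archimedean place `v` and zero elsewhere. -/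
def archAdele (v : InfinitePlace F) (x : ℝ) : Adele F :=
  ((Pi.single v ((realIso v).symm x) : InfiniteAdeleRing F), 0)

theorem archPart_unip (x : Adele F) (v : InfinitePlace F) :
    archPart (unip x) v = unip (toReal v x) := map_unip (toReal v) x

theorem inclAt_unip (v : InfinitePlace F) (x : ℝ) : inclAt v (unip x) = unip (archAdele v x) := by
  classical
  refine GA_ext (fun w => ?_) fun i j => ?_
  · rw [archPart_unip]
    by_cases hw : w = v
    · subst hw
      rw [archPart_inclAt_same]
      congr 1
      change x = realIso w ((Pi.single w ((realIso w).symm x) : InfiniteAdeleRing F) w)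
      rw [Pi.single_eq_same, RingEquiv.apply_symm_apply]
    · rw [archPart_inclAt_of_ne hw]
      have : toReal w (archAdele v x) = 0 := by
        change realIso w ((Pi.single v ((realIso v).symm x) : InfiniteAdeleRing F) w) = 0
        rw [Pi.single_eq_of_ne hw, map_zero]
      rw [this]
      apply Matrix.SpecialLinearGroup.ext
      intro i j
      fin_cases i <;> fin_cases j <;> simp [unip]
  · fin_cases i <;> fin_cases j <;> rfl

/-- On functions of weight `k` the lowering operator `L = H/2 - iE + iW/2`, with `W = E - E^t`
generating the rotations, satisfies `H = 2L + k + 2iE`. -/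
theorem lowerAt_of_weight {v : InfinitePlace F} {k : ℤ} {ψ : smoothSpace F}
    (hk : ψ.1 ∈ weightSpace v k) (g : GA F) :
    lieDerivReal (lieAt v (slOfCoord ![1, 0, 0])) ψ.1 g = 2 * (lowerAt v ψ).1 g + (k : ℂ) * ψ.1 g +
      2 * Complex.I * lieDerivReal (lieAt v (slOfCoord ![0, 1, 0])) ψ.1 g := by
  classical
  have hA : lieAt v (slRe lowering) = (1 / 2 : ℝ) • lieAt (F := F) v (slOfCoord ![1, 0, 0]) := by
    rw [lieAt, lieAt, ← Pi.single_smul]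
    congr 1
    apply Subtype.ext
    rw [slRe_lowering, Submodule.coe_smul]
    ext i j
    fin_cases i <;> fin_cases j <;> simp [slOfCoord]
    norm_num
  have hB : lieAt v (slIm lowering) = (-1 : ℝ) • lieAt (F := F) v (slOfCoord ![0, 1, 0]) +
      (1 / 2 : ℝ) • lieAt v (slOfCoord ![0, 1, -1]) := by
    rw [lieAt, lieAt, lieAt, ← Pi.single_smul, ← Pi.single_smul, ← Pi.single_add]
    congr 1
    apply Subtype.ext
    rw [slIm_lowering, Submodule.coe_add, Submodule.coe_smul, Submodule.coe_smul]
    ext i j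
    fin_cases i <;> fin_cases j <;> simp [slOfCoord] <;> norm_num
  have hW : lieDerivReal (lieAt v (slOfCoord ![0, 1, -1])) ψ.1 g = Complex.I * k * ψ.1 g := by
    have h1 := Smooth.hasDerivAt_inclAt ψ.2 v rot_zero hasDerivAt_rot g
    have h2 : HasDerivAt (fun t : ℝ => ψ.1 (g * inclAt v (rot t))) (Complex.I * k * ψ.1 g) 0 := by
      simp only [hk g]
      have h3 : HasDerivAt (fun t : ℝ => (k : ℂ) * (t : ℂ) * Complex.I) ((k : ℂ) * 1 * Complex.I) 0 :=
        ((Complex.ofRealCLM.hasDerivAt (x := (0 : ℝ))).const_mul (k : ℂ)).mul_const _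
      have h4 := (h3.cexp).mul_const (ψ.1 g)
      refine h4.congr_deriv ?_
      rw [Complex.ofReal_zero, mul_zero, zero_mul, Complex.exp_zero]
      ring
    exact h1.unique h2
  have e : (lowerAt v ψ).1 g = lieDerivReal (lieAt v (slRe lowering)) ψ.1 g +
    Complex.I * lieDerivReal (lieAt v (slIm lowering)) ψ.1 g := rfl
  rw [e, hA, hB, lieDerivReal_add ψ.2, lieDerivReal_smul ψ.2, lieDerivReal_smul ψ.2,
    lieDerivReal_smul ψ.2, hW]
  push_cast
  linear_combination (-(k : ℂ) * ψ.1 g) * Complex.I_sq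

theorem lowerAt_mem_weightSpace {v : InfinitePlace F} {k : ℤ} {ψ : smoothSpace F}
    (hk : ψ.1 ∈ weightSpace v k) : (lowerAt v ψ).1 ∈ weightSpace v (k - 2) := by
  intro g θ
  have h1 := lowerAt_rightTranslate_same v θ ψ
  have h2 : rightTranslate F (inclAt v (rot θ)) ψ = Complex.exp (k * θ * Complex.I) • ψ :=
    Subtype.ext (funext fun g => hk g θ)
  rw [h2, map_smul] at h1
  have h3 := congrFun (congrArg Subtype.val h1) g
  change Complex.exp _ * (lowerAt v ψ).1 g = Complex.exp _ * (lowerAt v ψ).1 (g * inclAt v (rot θ)) at h3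
  have h4 : Complex.exp (((k - 2 : ℤ) : ℂ) * θ * Complex.I) =
      Complex.exp (-(2 * θ * Complex.I)) * Complex.exp (k * θ * Complex.I) := by
    rw [← Complex.exp_add]; congr 1; push_cast; ring
  rw [h4, mul_assoc, h3, ← mul_assoc, ← Complex.exp_add, neg_add_cancel, Complex.exp_zero, one_mul]

theorem lowerAt_mem_leftInvariantSpace {v : InfinitePlace F} {ψ : smoothSpace F}
    (h : ψ.1 ∈ leftInvariantSpace F) : (lowerAt v ψ).1 ∈ leftInvariantSpace F := by
  intro γ g
  change lieDerivReal _ ψ.1 _ + Complex.I * lieDerivReal _ ψ.1 _ =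
    lieDerivReal _ ψ.1 _ + Complex.I * lieDerivReal _ ψ.1 _
  rw [← lieDerivReal_comp_mul_left, ← lieDerivReal_comp_mul_left]
  have : (fun g => ψ.1 (rational γ * g)) = ψ.1 := funext (h γ)
  rw [this]

theorem mem_unipInvariantSpace {ψ : GA F → ℂ} (hs : Smooth ψ) (h : ψ ∈ leftInvariantSpace F) :
    ψ ∈ unipInvariantSpace F := by
  refine ⟨hs.continuous, fun ξ g => ?_⟩
  rw [← map_unip]
  exact h (unip ξ) g

variable [MeasurableSpace (AdeleQuot F)] [BorelSpace (AdeleQuot F)]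
  (dn : Measure (AdeleQuot F)) [dn.IsAddHaarMeasure]

/-- The first-order differential equation for the constant term along the torus at `v`: the
derivative along the unipotent direction vanishes. -/
theorem hasDerivAt_unipAverage_torusAt {v : InfinitePlace F} {k : ℤ} {ψ : smoothSpace F}
    (hk : ψ.1 ∈ weightSpace v k) (hψ : ψ.1 ∈ unipInvariantSpace F)
    (hL : (lowerAt v ψ).1 ∈ unipInvariantSpace F) {g : GA F} (hg : archPart g v = 1) (t : ℝ) :
    HasDerivAt (fun t => unipAverage dn ⟨ψ.1, hψ⟩ (torusAt v t * g))
      (2 * unipAverage dn ⟨_, hL⟩ (torusAt v t * g) + k * unipAverage dn ⟨ψ.1, hψ⟩ (torusAt v t * g)) t := by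
  have hcomm : ∀ t, torusAt v t * g = g * torusAt v t := fun t => inclAt_comm hg _
  -- On the torus, right translation by unipotents at `v` becomes left translation.
  have hE : unipAverage dn ⟨_, lieDerivReal_mem_unipInvariantSpace hψ ψ.2
      (lieAt v (slOfCoord ![0, 1, 0]))⟩ (torusAt v t * g) = 0 := by
    have h1 := hasDerivAt_unipAverage dn hψ ψ.2 v unip_add continuous_unip_real hasDerivAt_unip
      (torusAt v t * g)
    have h2 : (fun s : ℝ => unipAverage dn ⟨ψ.1, hψ⟩ (torusAt v t * g * inclAt v (unip s))) =
        fun s => unipAverage dn ⟨ψ.1, hψ⟩ (torusAt v t * g) := by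
      funext s
      rw [mul_assoc, ← inclAt_comm hg, ← mul_assoc, torusAt, ← map_mul, torusReal, diagSL_mul_unip, map_mul,
        inclAt_unip, mul_assoc, unipAverage_unip_mul]
    rw [h2] at h1
    exact h1.unique (hasDerivAt_const _ _)
  have hH := hasDerivAt_unipAverage dn hψ ψ.2 v torusReal_add continuous_torusReal
    hasDerivAt_torusReal (torusAt v t * g)
  have e : (⟨_, lieDerivReal_mem_unipInvariantSpace hψ ψ.2 (lieAt v (slOfCoord ![1, 0, 0]))⟩ :
      unipInvariantSpace F) = (2 : ℂ) • ⟨_, hL⟩ + (k : ℂ) • ⟨ψ.1, hψ⟩ + (2 * Complex.I) •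
        ⟨_, lieDerivReal_mem_unipInvariantSpace hψ ψ.2 (lieAt v (slOfCoord ![0, 1, 0]))⟩ :=
    Subtype.ext (funext fun g => lowerAt_of_weight hk g)
  rw [e, map_add, map_add, map_smul, map_smul, map_smul] at hH
  simp only [Pi.add_apply, Pi.smul_apply, smul_eq_mul] at hH
  rw [hE, mul_zero, add_zero, ← sub_self t] at hH
  refine (hH.comp_sub_const t t).congr_of_eventuallyEq (Filter.Eventually.of_forall fun s => ?_)
  change unipAverage dn _ (torusAt v s * g) = unipAverage dn _ (torusAt v t * g * torusAt v (s - t))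
  rw [hcomm, hcomm, mul_assoc, ← torusAt_add, add_sub_cancel]

/-- The constant term of a function of weight `k` killed by `L^m` is a combination of exponentials
`exp ((k - 2i)t)`, `i < m`, along the torus. -/
theorem unipAverage_mem_expSpan {v : InfinitePlace F} {k : ℤ} {m : ℕ} {ψ : smoothSpace F}
    (hk : ψ.1 ∈ weightSpace v k) (hinv : ψ.1 ∈ leftInvariantSpace F)
    (hψ : ψ.1 ∈ unipInvariantSpace F) (hm : (lowerAt v ^ m) ψ = 0)
    {S : Set ℤ} (hS : ∀ i < m, k - 2 * (i : ℤ) ∈ S) (g : GA F) :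
    (fun t => unipAverage dn ⟨ψ.1, hψ⟩ (torusAt v t * g)) ∈ expSpan S := by
  have hinvj : ∀ j : ℕ, ((lowerAt v ^ j) ψ).1 ∈ leftInvariantSpace F := by
    intro j
    induction j with
    | zero => exact hinv
    | succ j ih => rw [pow_succ', Module.End.mul_apply]; exact lowerAt_mem_leftInvariantSpace ih
  have hkj : ∀ j : ℕ, ((lowerAt v ^ j) ψ).1 ∈ weightSpace v (k - 2 * (j : ℤ)) := by
    intro j
    induction j with
    | zero => simpa using hk
    | succ j ih =>
      rw [pow_succ', Module.End.mul_apply]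
      have := lowerAt_mem_weightSpace ih
      convert this using 2
      push_cast; ring
  have hu : ∀ j : ℕ, ((lowerAt v ^ j) ψ).1 ∈ unipInvariantSpace F := fun j =>
    mem_unipInvariantSpace ((lowerAt v ^ j) ψ).2 (hinvj j)
  -- The functions `f_j` of the system are the constant terms of `L^j ψ` along the torus.
  obtain ⟨x, τ, θ, g', hg', rfl⟩ := exists_iwasawa_at v g
  obtain ⟨c, hc⟩ := exists_exponential_sum k m
    (fun j t => unipAverage dn ⟨_, hu j⟩ (torusAt v t * g')) (fun j t => by
      have hL : (lowerAt v ((lowerAt v ^ j) ψ)).1 ∈ unipInvariantSpace F := by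
        have := hu (j + 1)
        rwa [pow_succ', Module.End.mul_apply] at this
      have h1 := hasDerivAt_unipAverage_torusAt dn (hkj j) (hu j) hL hg' t
      simp only [pow_succ', Module.End.mul_apply]
      exact h1) (fun t => by
      have : (⟨_, hu m⟩ : unipInvariantSpace F) = 0 := Subtype.ext (by simp only [hm]; rfl)
      rw [this, map_zero]; rfl)
  have hrot : ∀ (h : GA F), unipAverage dn ⟨ψ.1, hψ⟩ (h * inclAt v (rot θ)) =
      Complex.exp (k * θ * Complex.I) * unipAverage dn ⟨ψ.1, hψ⟩ h := by
    intro h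
    rw [unipAverage_apply, unipAverage_apply, ← integral_const_mul]
    congr 1
    funext q
    rw [← mul_assoc, hk]
  have key : (fun t => unipAverage dn ⟨ψ.1, hψ⟩ (torusAt v t *
      (inclAt v (unip x) * inclAt v (diagSL (Units.mk0 (Real.exp τ) (Real.exp_ne_zero τ))) * g' *
        inclAt v (rot θ)))) = fun t : ℝ => ∑ i ∈ Finset.range m,
        (Complex.exp (k * θ * Complex.I) * c i * Complex.exp (((k - 2 * i : ℤ) : ℂ) * τ)) *
          Complex.exp (((k - 2 * i : ℤ) : ℂ) * t) := by
    funext t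
    have e : torusAt v t * (inclAt v (unip x) *
        inclAt v (diagSL (Units.mk0 (Real.exp τ) (Real.exp_ne_zero τ))) * g' * inclAt v (rot θ)) =
        inclAt v (unip (Real.exp t * (Real.exp t * x))) * (torusAt v (t + τ) * g') * inclAt v (rot θ) := by
      have h1 : torusReal t * unip x = unip (Real.exp t * (Real.exp t * x)) * torusReal t :=
        diagSL_mul_unip x _
      have h2 := congrArg (inclAt (F := F) v) h1
      rw [map_mul, map_mul] at h2
      rw [torusAt_add]
      simp only [mul_assoc]
      rw [← mul_assoc (inclAt v (unip (Real.exp t * _)))]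
      change _ = inclAt v _ * inclAt v (torusReal t) * _
      rw [← h2]
      simp only [mul_assoc]
      rfl
    rw [e, hrot, inclAt_unip, unipAverage_unip_mul]
    have := hc (t + τ)
    change unipAverage dn _ (torusAt v (t + τ) * g') = _ at this
    change _ * unipAverage dn ⟨ψ.1, hu 0⟩ (torusAt v (t + τ) * g') = _
    refine (congrArg _ this).trans ?_
    rw [Finset.mul_sum]
    refine Finset.sum_congr rfl fun i _ => ?_
    rw [mul_assoc, mul_assoc, mul_assoc, ← Complex.exp_add]
    push_cast
    ring_nf
  rw [key]
  exact sum_mem_expSpan (fun i hi => hS i (Finset.mem_range.1 hi)) _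

end ExponentsOfConstantTerm

/-! ### Decomposition under the archimedean torus -/

section TorusDecomposition

variable {F : Type*} [Field F] [NumberField F] [IsTotallyReal F]

/-- The totally positive archimedean idele with components `exp (t v)`. -/
def expIdele (t : InfinitePlace F → ℝ) : (Adele F)ˣ :=
  archIdele fun v => Units.mk0 (Real.exp (t v)) (Real.exp_ne_zero _)

theorem toReal_expIdele (t : InfinitePlace F → ℝ) (v : InfinitePlace F) :
    toReal v (expIdele t : Adele F) = Real.exp (t v) := (realIso v).apply_symm_apply _

theorem idele_ext {a b : (Adele F)ˣ} (h1 : ∀ v, toReal v (a : Adele F) = toReal v (b : Adele F))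
    (h2 : (a : Adele F).2 = (b : Adele F).2) : a = b :=
  Units.ext (Prod.ext (funext fun v => (realIso v).injective (h1 v)) h2)

theorem expIdele_add (s t : InfinitePlace F → ℝ) : expIdele (s + t) = expIdele s * expIdele t := by
  refine idele_ext (fun v => ?_) ?_
  · rw [Units.val_mul, map_mul]
    simp only [toReal_expIdele, Pi.add_apply, Real.exp_add]
  · exact (mul_one _).symm

theorem expIdele_zero : expIdele (0 : InfinitePlace F → ℝ) = 1 := by
  have h := expIdele_add (0 : InfinitePlace F → ℝ) 0
  rw [add_zero] at h
  exact mul_eq_left.1 h.symm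

theorem diagSL_one {R : Type*} [CommRing R] : diagSL (1 : Rˣ) = 1 := by
  have h := diagSL_mul (1 : Rˣ) 1
  rw [mul_one] at h
  exact mul_eq_left.1 h.symm

theorem archPart_diagSL (a : (Adele F)ˣ) (v : InfinitePlace F) :
    archPart (diagSL a) v = diagSL (Units.map (toReal v : Adele F →* ℝ) a) := by
  apply Matrix.SpecialLinearGroup.ext
  intro i j
  rw [archPart, Matrix.SpecialLinearGroup.map_apply_coe]
  fin_cases i <;> fin_cases j <;> simp [diagSL]

open Classical in
theorem torusAt_eq (v : InfinitePlace F) (t : ℝ) : torusAt v t = diagSL (expIdele (Pi.single v t)) := by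
  refine GA_ext (fun w => ?_) fun i j => ?_
  · rw [archPart_diagSL]
    by_cases hw : w = v
    · subst hw
      rw [torusAt, archPart_inclAt_same, torusReal]
      congr 1
      apply Units.ext
      rw [Units.coe_map]
      change _ = toReal w _
      rw [toReal_expIdele, Pi.single_eq_same]; rfl
    · rw [torusAt, archPart_inclAt_of_ne hw]
      have : Units.map (toReal w : Adele F →* ℝ) (expIdele (Pi.single v t)) = 1 := by
        apply Units.ext
        change toReal w _ = _
        rw [toReal_expIdele, Pi.single_eq_of_ne hw, Real.exp_zero]; rfl
      rw [this, diagSL_one]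
  · fin_cases i <;> fin_cases j <;> rfl

theorem torusAt_zero (v : InfinitePlace F) : torusAt v 0 = 1 := by
  have h := torusAt_add v 0 0
  rw [add_zero] at h
  exact mul_eq_left.1 h.symm

theorem torusAt_comm (v w : InfinitePlace F) (s t : ℝ) :
    torusAt v s * torusAt w t = torusAt w t * torusAt v s := by
  simp only [torusAt_eq, ← diagSL_mul, mul_comm]

/-- Functions that are eigenvectors of exponent `n` for left translation by the torus at `v`. -/
def torusEigenspace (v : InfinitePlace F) (n : ℤ) : Submodule ℂ (GA F → ℂ) where
  carrier := {h | ∀ t g, h (torusAt v t * g) = Complex.exp (n * t) * h g}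
  add_mem' := fun h h' t g => by rw [Pi.add_apply, h, h', Pi.add_apply, mul_add]
  zero_mem' := fun t g => by simp
  smul_mem' := fun c ψ h t g => by
    rw [Pi.smul_apply, Pi.smul_apply, h, smul_eq_mul, smul_eq_mul]; ring

/-- The properties of the constant term of a form of weight `k`: left invariance under the unipotent
group and the rational torus, right invariance near the identity at the finite places, right
`K`-finiteness, weight `k`, and exponents in `S` along the archimedean torus. -/
structure IsBoundaryFunction (k : InfinitePlace F → ℤ) (S : Set ℤ) (h : GA F → ℂ) : Prop where
  unip_mul : ∀ x g, h (unip x * g) = h g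
  principal_mul : ∀ β g, h (diagSL (principalIdele β) * g) = h g
  right_invariant : ∀ᶠ κ in 𝓝 (1 : GA F), (∀ v, archPart κ v = 1) → ∀ g, h (g * κ) = h g
  kFinite : KFinite h
  weight : ∀ v, h ∈ weightSpace v (k v)
  exponents : ∀ v g, (fun t => h (torusAt v t * g)) ∈ expSpan S

/-- The space of functions with the properties of `IsBoundaryFunction`. -/
def boundarySpace (k : InfinitePlace F → ℤ) (S : Set ℤ) : Submodule ℂ (GA F → ℂ) where
  carrier := {h | IsBoundaryFunction k S h}
  add_mem' := fun {h h'} H H' =>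
    { unip_mul := fun x g => by rw [Pi.add_apply, H.unip_mul, H'.unip_mul]; rfl
      principal_mul := fun x g => by rw [Pi.add_apply, H.principal_mul, H'.principal_mul]; rfl
      right_invariant := by
        filter_upwards [H.right_invariant, H'.right_invariant] with κ h1 h2 hκ g
        rw [Pi.add_apply, h1 hκ, h2 hκ]; rfl
      kFinite := H.kFinite.add H'.kFinite
      weight := fun v => add_mem (H.weight v) (H'.weight v)
      exponents := fun v g => add_mem (H.exponents v g) (H'.exponents v g) }
  zero_mem' :=
    { unip_mul := fun _ _ => rfl
      principal_mul := fun _ _ => rfl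
      right_invariant := Filter.Eventually.of_forall fun _ _ _ => rfl
      kFinite := KFinite.zero
      weight := fun _ => zero_mem _
      exponents := fun _ _ => zero_mem _ }
  smul_mem' := fun c h H =>
    { unip_mul := fun x g => by rw [Pi.smul_apply, H.unip_mul]; rfl
      principal_mul := fun x g => by rw [Pi.smul_apply, H.principal_mul]; rfl
      right_invariant := by
        filter_upwards [H.right_invariant] with κ h1 hκ g
        rw [Pi.smul_apply, h1 hκ]; rfl
      kFinite := H.kFinite.smul c
      weight := fun v => Submodule.smul_mem _ c (H.weight v)
      exponents := fun v g => Submodule.smul_mem _ c (H.exponents v g) }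

theorem weightSpace_comp_mul_left {v : InfinitePlace F} {k : ℤ} {h : GA F → ℂ}
    (hh : h ∈ weightSpace v k) (a : GA F) : (fun g => h (a * g)) ∈ weightSpace v k := fun g θ =>
  (congrArg h (mul_assoc a g _).symm).trans (hh (a * g) θ)

theorem boundarySpace_torusAt {k : InfinitePlace F → ℤ} {S : Set ℤ} {h : GA F → ℂ}
    (hh : h ∈ boundarySpace k S) (w : InfinitePlace F) (s : ℝ) :
    (fun g => h (torusAt w s * g)) ∈ boundarySpace k S where
  unip_mul x g := by
    classical
    rw [← mul_assoc, torusAt_eq, diagSL_mul_unip, mul_assoc, hh.unip_mul]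
  principal_mul β g := by
    classical
    rw [← mul_assoc, torusAt_eq, ← diagSL_mul, mul_comm, diagSL_mul, mul_assoc, hh.principal_mul]
  right_invariant := by
    filter_upwards [hh.right_invariant] with κ h1 hκ g
    rw [← mul_assoc, h1 hκ]
  kFinite := hh.kFinite.comp_mul_left _
  weight v := weightSpace_comp_mul_left (hh.weight v) _
  exponents v g := by
    simp only [← mul_assoc, torusAt_comm w v]
    simp only [mul_assoc]
    exact hh.exponents v _

/-- Decomposition of the constant term into eigenfunctions of the archimedean torus. -/
theorem mem_iSup_torusEigenspace {k : InfinitePlace F → ℤ} {S : Finset ℤ} {h : GA F → ℂ}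
    (hh : h ∈ boundarySpace k (S : Set ℤ)) :
    h ∈ ⨆ e : InfinitePlace F → ℤ, boundarySpace k (S : Set ℤ) ⊓ ⨅ v, torusEigenspace v (e v) := by
  refine mem_iSup_iInf _ (fun v n => torusEigenspace v n) (fun v h hh => ?_) h hh
  obtain ⟨c, hc, hcS⟩ := exists_exponential_decomposition (fun t g => torusAt v t * g)
    (fun g => by rw [torusAt_zero, one_mul]) (fun s t g => by rw [torusAt_add, mul_assoc]) h S
    (fun g => by
      obtain ⟨c, hc⟩ := (Submodule.mem_span_image_finset_iff_exists_fun' ℂ).1 (hh.exponents v g)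
      refine ⟨c, fun t => ?_⟩
      have := congrFun hc t
      rw [Finset.sum_apply] at this
      exact this.symm)
  refine ⟨S, c, hc, fun n hn => ⟨?_, (hcS n hn).2, fun w m hw => ?_⟩⟩
  · refine Submodule.span_le.2 ?_ (hcS n hn).1
    rintro _ ⟨t, rfl⟩
    exact boundarySpace_torusAt hh v t
  · refine Submodule.span_le.2 ?_ (hcS n hn).1
    rintro _ ⟨t, rfl⟩
    intro s g
    change h (torusAt v t * (torusAt w s * g)) = _ * h (torusAt v t * g)
    rw [← mul_assoc, torusAt_comm, mul_assoc, hw]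

variable [MeasurableSpace (AdeleQuot F)] [BorelSpace (AdeleQuot F)]
  (dn : Measure (AdeleQuot F)) [dn.IsAddHaarMeasure]

theorem kFinite_unipAverage {ψ : GA F → ℂ} (hψ : ψ ∈ unipInvariantSpace F) (hK : KFinite ψ) :
    KFinite (unipAverage dn ⟨ψ, hψ⟩) := by
  have hle : compactSpan ψ ≤ unipInvariantSpace F := by
    refine Submodule.span_le.2 ?_
    rintro _ ⟨κ, -, rfl⟩
    exact ⟨hψ.1.comp (continuous_id.mul continuous_const), fun ξ g =>
      (congrArg ψ (mul_assoc _ g κ)).trans (hψ.2 ξ _)⟩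
  have : FiniteDimensional ℂ (compactSpan ψ) := hK
  refine Submodule.finiteDimensional_of_le
    (S₂ := LinearMap.range ((unipAverage dn).comp (Submodule.inclusion hle))) ?_
  refine Submodule.span_le.2 ?_
  rintro _ ⟨κ, hκ, rfl⟩
  refine ⟨⟨_, mem_compactSpan ψ hκ⟩, ?_⟩
  funext g
  change ∫ q : AdeleQuot F, ψ (unip (Quotient.out q) * g * κ) ∂dn =
    ∫ q : AdeleQuot F, ψ (unip (Quotient.out q) * (g * κ)) ∂dn
  simp only [mul_assoc]

/-- The constant term of a weight vector in `formSpace` satisfies all of `IsBoundaryFunction`. -/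
theorem unipAverage_mem_boundarySpace {m : ℕ} {ψ : GA F → ℂ} (hψ : ψ ∈ formSpace F m)
    {k : InfinitePlace F → ℤ} (hk : ∀ v, ψ ∈ weightSpace v (k v)) {S : Set ℤ}
    (hS : ∀ v, ∀ i < m, k v - 2 * (i : ℤ) ∈ S) (hu : ψ ∈ unipInvariantSpace F) :
    unipAverage dn ⟨ψ, hu⟩ ∈ boundarySpace k S := by
  obtain ⟨⟨hs, h1⟩, h2, h3⟩ := mem_formSpace.1 hψ
  exact
  { unip_mul := unipAverage_unip_mul dn ⟨ψ, hu⟩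
    principal_mul := unipAverage_diagSL_mul dn ⟨ψ, hu⟩ h2
    right_invariant := by
      filter_upwards [h3.eventually_right_invariant hs] with κ hκ h g
      rw [unipAverage_apply, unipAverage_apply]
      simp only [← mul_assoc, hκ h]
    kFinite := kFinite_unipAverage dn hu h3
    weight := fun v g θ => by
      rw [unipAverage_apply, unipAverage_apply, ← integral_const_mul]
      simp only [← mul_assoc, hk v _ θ]
    exponents := fun v g =>
      unipAverage_mem_expSpan dn (ψ := ⟨ψ, hs⟩) (hk v) h2 hu (h1 v) (hS v) g }

end TorusDecomposition

/-! ### The adelic Iwasawa decomposition -/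

section Iwasawa

/-- An upper triangular matrix of determinant one is `diag(a, a⁻¹)` times a unipotent one. -/
theorem exists_diagSL_mul_unip {R : Type*} [CommRing R] {u : Matrix.SpecialLinearGroup (Fin 2) R}
    (h : u 1 0 = 0) : ∃ (a : Rˣ) (x : R), u = diagSL a * unip x := by
  have hdet : u 0 0 * u 1 1 = 1 := by
    have := u.2
    rw [Matrix.det_fin_two] at this
    change u 0 0 * u 1 1 - u 0 1 * u 1 0 = 1 at this
    rwa [h, mul_zero, sub_zero] at this
  refine ⟨⟨u 0 0, u 1 1, hdet, by rw [mul_comm]; exact hdet⟩, u 1 1 * u 0 1, ?_⟩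
  apply Matrix.SpecialLinearGroup.ext
  intro i j
  rw [Matrix.SpecialLinearGroup.coe_mul, Matrix.mul_apply, Fin.sum_univ_two]
  fin_cases i <;> fin_cases j
  · simp [diagSL, unip]
  · simp [diagSL, unip, ← mul_assoc, hdet]
  · simp [diagSL, unip, h]
  · simp [diagSL, unip]

variable {F : Type*} [Field F] [NumberField F]

/-- The local Iwasawa decomposition at a finite place: a bottom row `(c, d)` is, up to scaling, the
bottom row of an integral matrix of determinant one. -/
theorem exists_integral_bottom_row (v : HeightOneSpectrum (𝓞 F)) (c d : v.adicCompletion F)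
    (hcd : c ≠ 0 ∨ d ≠ 0) :
    ∃ p q r t : v.adicCompletion F, (p ∈ v.adicCompletionIntegers F ∧ q ∈ v.adicCompletionIntegers F ∧
      r ∈ v.adicCompletionIntegers F ∧ t ∈ v.adicCompletionIntegers F) ∧ p * t - q * r = 1 ∧
      c * t = d * r := by
  rcases le_or_gt ‖c‖ ‖d‖ with h | h
  · have hd : d ≠ 0 := by
      rintro rfl
      rw [norm_zero, norm_le_zero_iff] at h
      simp [h] at hcd
    refine ⟨1, 0, c / d, 1, ⟨one_mem _, zero_mem _, ?_, one_mem _⟩, by ring, ?_⟩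
    · rw [mem_integers_iff_norm, norm_div]
      exact div_le_one_of_le₀ h (norm_nonneg _)
    · field_simp
  · have hc : c ≠ 0 := by
      rintro rfl
      rw [norm_zero] at h
      exact absurd h (not_lt.2 (norm_nonneg _))
    refine ⟨0, -1, 1, d / c, ⟨zero_mem _, neg_mem (one_mem _), one_mem _, ?_⟩, by ring, ?_⟩
    · rw [mem_integers_iff_norm, norm_div]
      exact div_le_one_of_le₀ h.le (norm_nonneg _)
    · field_simp

/-- The embedding of `SL₂` of the finite adeles in the adelic group. -/
def finIncl (B : Matrix.SpecialLinearGroup (Fin 2) (FiniteAdeleRing (𝓞 F) F)) : GA F :=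
  ⟨Matrix.of fun i j => (((1 : Matrix (Fin 2) (Fin 2) (InfiniteAdeleRing F)) i j, B i j) :
      InfiniteAdeleRing F × FiniteAdeleRing (𝓞 F) F), by
    have hB := B.2
    rw [Matrix.det_fin_two] at hB ⊢
    refine Prod.ext ?_ hB
    change (1 : Matrix (Fin 2) (Fin 2) (InfiniteAdeleRing F)) 0 0 *
        (1 : Matrix (Fin 2) (Fin 2) (InfiniteAdeleRing F)) 1 1 -
        (1 : Matrix (Fin 2) (Fin 2) (InfiniteAdeleRing F)) 0 1 *
        (1 : Matrix (Fin 2) (Fin 2) (InfiniteAdeleRing F)) 1 0 = 1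
    simp⟩

/-- The finite adele with prescribed integral components. -/
def integralAdele (f : ∀ v : HeightOneSpectrum (𝓞 F), v.adicCompletion F)
    (hf : ∀ v, f v ∈ v.adicCompletionIntegers F) : FiniteAdeleRing (𝓞 F) F :=
  ⟨f, Filter.Eventually.of_forall hf⟩

variable [IsTotallyReal F]

theorem archPart_finIncl (B : Matrix.SpecialLinearGroup (Fin 2) (FiniteAdeleRing (𝓞 F) F))
    (v : InfinitePlace F) : archPart (finIncl B) v = 1 := by
  apply Matrix.SpecialLinearGroup.ext
  intro i j
  fin_cases i <;> fin_cases j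
  exacts [map_one (realIso v), map_zero (realIso v), map_zero (realIso v), map_one (realIso v)]

/-- The Iwasawa decomposition of `SL₂(𝔸_F)`. -/
theorem exists_iwasawa (g : GA F) : ∃ (a : (Adele F)ˣ) (x : Adele F) (k : GA F),
    k ∈ maximalCompact (F := F) ∧ g = diagSL a * unip x * k := by
  have hdet : g 0 0 * g 1 1 - g 0 1 * g 1 0 = 1 := by
    have := g.2
    rwa [Matrix.det_fin_two] at this
  have hcd : ∀ v, (g 1 0).2 v ≠ 0 ∨ (g 1 1).2 v ≠ 0 := by
    intro v
    by_contra! h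
    have h1 : (g 0 0).2 v * (g 1 1).2 v - (g 0 1).2 v * (g 1 0).2 v = 1 :=
      congrArg (fun a : Adele F => a.2 v) hdet
    rw [h.1, h.2] at h1
    simp at h1
  choose p q r t hint hpq hrt using fun v => exists_integral_bottom_row v _ _ (hcd v)
  choose x τ θ hg using fun v => exists_iwasawa_real (archPart g v)
  let B : Matrix.SpecialLinearGroup (Fin 2) (FiniteAdeleRing (𝓞 F) F) :=
    ⟨!![integralAdele p fun v => (hint v).1, integralAdele q fun v => (hint v).2.1;
      integralAdele r fun v => (hint v).2.2.1, integralAdele t fun v => (hint v).2.2.2], by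
      rw [Matrix.det_fin_two_of]
      exact RestrictedProduct.ext _ _ hpq⟩
  set k : GA F := archIncl (fun v => rot (θ v)) * finIncl B with hk
  have hka : ∀ v, archPart k v = rot (θ v) := fun v => by
    rw [hk, archPart_mul, archPart_archIncl, archPart_finIncl, mul_one]
  have hkf : ∀ i j, (k i j).2 = B i j := by
    intro i j
    rw [hk, GA_mul_apply]
    change (1 : Matrix (Fin 2) (Fin 2) (FiniteAdeleRing (𝓞 F) F)) i 0 * B 0 j +
      (1 : Matrix (Fin 2) (Fin 2) (FiniteAdeleRing (𝓞 F) F)) i 1 * B 1 j = B i j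
    fin_cases i
    · change 1 * B 0 j + 0 * B 1 j = B 0 j
      rw [one_mul, zero_mul, add_zero]
    · change 0 * B 0 j + 1 * B 1 j = B 1 j
      rw [one_mul, zero_mul, zero_add]
  have hkK : k ∈ maximalCompact (F := F) := by
    refine ⟨fun v => by rw [hka]; exact rot_mem _, fun v i j => ?_⟩
    rw [hkf]
    fin_cases i <;> fin_cases j
    exacts [(hint v).1, (hint v).2.1, (hint v).2.2.1, (hint v).2.2.2]
  set u : GA F := g * k⁻¹ with hu
  have hu10 : u 1 0 = 0 := by
    refine Prod.ext (funext fun v => (realIso v).injective ?_) ?_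
    · have h1 : archPart u v =
          unip (x v) * diagSL (Units.mk0 (Real.exp (τ v)) (Real.exp_ne_zero _)) := by
        rw [hu, archPart_mul, archPart_inv, hka, hg v, mul_inv_cancel_right]
      have h2 := congrArg (fun m : Matrix.SpecialLinearGroup (Fin 2) ℝ => m 1 0) h1
      change realIso v ((u 1 0).1 v) = _ at h2
      change realIso v ((u 1 0).1 v) = realIso v 0
      rw [h2, map_zero, Matrix.SpecialLinearGroup.coe_mul, Matrix.mul_apply, Fin.sum_univ_two]
      simp [unip, diagSL]
    · refine RestrictedProduct.ext _ _ fun v => ?_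
      have h1 : u 1 0 = g 1 0 * k 1 1 - g 1 1 * k 1 0 := by
        rw [hu, GA_mul_apply, Matrix.SpecialLinearGroup.coe_inv, Matrix.adjugate_fin_two]
        simp
        ring
      rw [h1]
      change (g 1 0).2 v * (k 1 1).2 v - (g 1 1).2 v * (k 1 0).2 v = 0
      rw [hkf, hkf]
      exact sub_eq_zero.2 (hrt v)
  obtain ⟨a, y, hay⟩ := exists_diagSL_mul_unip hu10
  exact ⟨a, y, k, hkK, by rw [← hay, hu, inv_mul_cancel_right]⟩

/-- The maximal compact subgroup is contained in a compact set. -/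
theorem exists_isCompact_maximalCompact_subset :
    ∃ C : Set (GA F), IsCompact C ∧ maximalCompact (F := F) ⊆ C := by
  have hT2 : T2Space (Adele F) := t2Space_adele
  have hemb : IsClosedEmbedding (Subtype.val : GA F → Matrix (Fin 2) (Fin 2) (Adele F)) := by
    refine IsClosedEmbedding.mk ⟨⟨rfl⟩, Subtype.val_injective⟩ ?_
    rw [Subtype.range_coe_subtype]
    exact isClosed_eq (continuous_id.matrix_det) continuous_const
  have hC : IsCompact {m : Matrix (Fin 2) (Fin 2) (Adele F) | ∀ i j, m i j ∈ adeleBox F 1} := by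
    have : {m : Matrix (Fin 2) (Fin 2) (Adele F) | ∀ i j, m i j ∈ adeleBox F 1} =
        Set.pi Set.univ fun _ : Fin 2 => Set.pi Set.univ fun _ : Fin 2 => adeleBox F 1 := by
      ext m
      exact ⟨fun h i _ j _ => h i j, fun h i j => h i trivial j trivial⟩
    rw [this]
    exact isCompact_univ_pi fun _ => isCompact_univ_pi fun _ => isCompact_adeleBox 1
  refine ⟨_, hemb.isCompact_preimage hC, fun k hk i j => ⟨fun v => ?_, fun v => hk.2 v i j⟩⟩
  rw [norm_eq_abs_toReal]
  have h1 := hk.1 v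
  rw [Matrix.mem_orthogonalGroup_iff] at h1
  have h2 := congrFun (congrFun h1 i) i
  rw [Matrix.mul_apply, Fin.sum_univ_two, Matrix.one_apply_eq] at h2
  change (archPart k v).1 i 0 * (archPart k v).1 i 0 + (archPart k v).1 i 1 * (archPart k v).1 i 1 = 1 at h2
  change |(archPart k v).1 i j| ≤ 1
  rw [← sq_le_one_iff_abs_le_one]
  fin_cases j <;> simp only [Fin.zero_eta, Fin.mk_one] <;>
    nlinarith [mul_self_nonneg ((archPart k v).1 i 0), mul_self_nonneg ((archPart k v).1 i 1)]

end Iwasawa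

/-! ### Exponents are parallel -/

section Eigenfunctions

variable {F : Type*} [Field F] [NumberField F] [IsTotallyReal F]

theorem toReal_idele_ne_zero (c : (Adele F)ˣ) (v : InfinitePlace F) : toReal v (c : Adele F) ≠ 0 := by
  rw [← abs_ne_zero, ← norm_eq_abs_toReal]
  exact norm_ne_zero_iff.2 (idele_fst_ne_zero c v)

/-- The character `c ↦ ∏_{v ∣ ∞} |c_v|^{e_v}` of the ideles. -/
def archWeight (e : InfinitePlace F → ℤ) : (Adele F)ˣ →* ℝ where
  toFun c := ∏ v, |toReal v (c : Adele F)| ^ e v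
  map_one' := Finset.prod_eq_one fun v _ => by rw [Units.val_one, map_one, abs_one, _root_.one_zpow]
  map_mul' a b := by
    rw [← Finset.prod_mul_distrib]
    exact Finset.prod_congr rfl fun v _ => by rw [Units.val_mul, map_mul, abs_mul, mul_zpow]

theorem archWeight_pos (e : InfinitePlace F → ℤ) (c : (Adele F)ˣ) : 0 < archWeight e c :=
  Finset.prod_pos fun v _ => zpow_pos (abs_pos.2 (toReal_idele_ne_zero c v)) _

theorem archWeight_expIdele (e : InfinitePlace F → ℤ) (t : InfinitePlace F → ℝ) :
    archWeight e (expIdele t) = Real.exp (∑ v, e v * t v) := by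
  change ∏ v, |toReal v (expIdele t : Adele F)| ^ e v = _
  rw [Real.exp_sum]
  exact Finset.prod_congr rfl fun v _ => by
    rw [toReal_expIdele, Real.abs_exp, ← Real.rpow_intCast, ← Real.exp_mul, mul_comm]

variable {k e : InfinitePlace F → ℤ} {S : Set ℤ} {h : GA F → ℂ}

/-- The left action of the archimedean torus on a simultaneous eigenfunction. -/
theorem apply_expIdele_mul (he : ∀ v, h ∈ torusEigenspace v (e v)) (t : InfinitePlace F → ℝ) (g : GA F) :
    h (diagSL (expIdele t) * g) = (archWeight e (expIdele t) : ℂ) * h g := by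
  classical
  have key : ∀ s : Finset (InfinitePlace F), ∀ g,
      h (diagSL (expIdele (∑ v ∈ s, Pi.single v (t v))) * g) =
        Complex.exp (∑ v ∈ s, (e v : ℂ) * t v) * h g := by
    intro s
    induction s using Finset.induction_on with
    | empty => intro g; simp [expIdele_zero, diagSL_one]
    | insert v s hv ih =>
      intro g
      rw [Finset.sum_insert hv, Finset.sum_insert hv, expIdele_add, diagSL_mul, mul_assoc,
        ← torusAt_eq, he v, ih, Complex.exp_add, mul_assoc]
  have h1 := key Finset.univ g
  rw [Finset.univ_sum_single] at h1
  rw [h1, archWeight_expIdele]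
  push_cast
  rfl

/-- The right action of the archimedean rotations on a weight vector. -/
theorem apply_mul_rot (hk : ∀ v, h ∈ weightSpace v (k v)) (θ : InfinitePlace F → ℝ) (g : GA F) :
    h (g * archIncl fun v => rot (θ v)) = Complex.exp (∑ v, (k v : ℂ) * θ v * Complex.I) * h g := by
  classical
  have key : ∀ s : Finset (InfinitePlace F), ∀ g,
      h (g * archIncl fun v => if v ∈ s then rot (θ v) else 1) =
        Complex.exp (∑ v ∈ s, (k v : ℂ) * θ v * Complex.I) * h g := by
    intro s
    induction s using Finset.induction_on with
    | empty =>
      intro g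
      have : (fun v : InfinitePlace F => if v ∈ (∅ : Finset (InfinitePlace F)) then rot (θ v) else 1) = 1 :=
        funext fun v => by simp
      rw [this, archIncl_one]
      simp
    | insert v s hv ih =>
      intro g
      have : (fun w : InfinitePlace F => if w ∈ insert v s then rot (θ w) else 1) =
          (fun w => if w ∈ s then rot (θ w) else 1) * Pi.mulSingle v (rot (θ v)) := by
        funext w
        by_cases hw : w = v
        · subst hw; simp [hv]
        · simp [hw]
      rw [this, archIncl_mul, ← mul_assoc]
      change h (g * _ * inclAt v (rot (θ v))) = _
      rw [hk v, ih, Finset.sum_insert hv, Complex.exp_add, mul_assoc (Complex.exp _) (Complex.exp _)]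
  have h1 := key Finset.univ g
  simpa using h1

omit [IsTotallyReal F] in
theorem continuous_diagSL : Continuous (diagSL : (Adele F)ˣ → GA F) := by
  refine continuous_induced_rng.2 (continuous_matrix fun i j => ?_)
  fin_cases i <;> fin_cases j
  exacts [Units.continuous_val, continuous_const, continuous_const,
    Units.continuous_val.comp continuous_inv]

theorem archIncl_archPart_diagSL {c : (Adele F)ˣ} (hc : ∀ v, 0 < toReal v (c : Adele F)) :
    archIncl (archPart (diagSL c)) = diagSL (expIdele fun v => Real.log (toReal v (c : Adele F))) := by
  refine GA_ext (fun v => ?_) fun i j => ?_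
  · rw [archPart_archIncl, archPart_diagSL, archPart_diagSL]
    congr 1
    apply Units.ext
    change toReal v _ = toReal v _
    rw [toReal_expIdele, Real.exp_log (hc v)]
  · fin_cases i <;> fin_cases j <;> rfl

/-- Left translation by ideles close to the identity acts on an eigenfunction through the archimedean
components: by the Iwasawa decomposition it amounts to right translation by elements near the
identity, uniformly over the maximal compact subgroup. -/
theorem eventually_apply_diagSL_mul (hh : h ∈ boundarySpace k S)
    (he : ∀ v, h ∈ torusEigenspace v (e v)) :
    ∀ᶠ c in 𝓝 (1 : (Adele F)ˣ), ∀ g, h (diagSL c * g) = (archWeight e c : ℂ) * h g := by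
  obtain ⟨C, hC, hKC⟩ := exists_isCompact_maximalCompact_subset (F := F)
  have hfin : ∀ᶠ κ in 𝓝 (1 : GA F), ∀ g, h (g * finPart κ) = h g := by
    have h1 : finPart (1 : GA F) = 1 := by
      have : archPart (1 : GA F) = 1 := funext fun v => archPart_one v
      rw [finPart, this, _root_.inv_one, archIncl_one, one_mul]
    have h2 := (continuous_finPart (F := F)).continuousAt (x := 1)
    rw [ContinuousAt, h1] at h2
    filter_upwards [h2.eventually hh.right_invariant] with κ hκ g
    exact hκ (archPart_finPart κ) g
  -- Conjugating by `κ` in a compact set keeps `diag(c, c⁻¹)` near the identity, uniformly in `κ`.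
  have hconj : ∀ᶠ c in 𝓝 (1 : (Adele F)ˣ), ∀ κ ∈ C, ∀ g, h (g * finPart (κ⁻¹ * diagSL c * κ)) = h g := by
    refine hC.eventually_forall_of_forall_eventually fun κ _ => ?_
    have hc : Continuous fun p : (Adele F)ˣ × GA F => p.2⁻¹ * diagSL p.1 * p.2 :=
      (continuous_snd.inv.mul (continuous_diagSL.comp continuous_fst)).mul continuous_snd
    have hc' := hc.continuousAt (x := (1, κ))
    rw [ContinuousAt, diagSL_one, mul_one, inv_mul_cancel] at hc'
    exact hc'.eventually hfin
  have hpos : ∀ᶠ c : (Adele F)ˣ in 𝓝 1, ∀ v, 0 < toReal v (c : Adele F) := by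
    refine Filter.eventually_all.2 fun v => ?_
    have hc := ((continuous_toReal v).comp (Units.continuous_val (M := Adele F))).continuousAt (x := 1)
    refine hc.eventually (lt_mem_nhds ?_)
    simp
  filter_upwards [hconj, hpos] with c hc hc0 g
  obtain ⟨a, x, κ, hκ, rfl⟩ := exists_iwasawa g
  have e1 : diagSL c * κ = archIncl (archPart (diagSL c)) * κ * finPart (κ⁻¹ * diagSL c * κ) := by
    have h1 := archIncl_mul_finPart (κ⁻¹ * diagSL c * κ)
    have h2 : archPart (κ⁻¹ * diagSL c * κ) = (archPart κ)⁻¹ * archPart (diagSL c) * archPart κ :=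
      funext fun v => by rw [archPart_mul, archPart_mul, archPart_inv]; rfl
    rw [archIncl_mul_eq, ← h2, mul_assoc, h1]
    group
  have e2 : diagSL c * (diagSL a * unip x * κ) = unip ((c * a : (Adele F)ˣ) * ((c * a : (Adele F)ˣ) * x)) *
      (diagSL a * (diagSL c * κ)) := by
    rw [← mul_assoc, ← mul_assoc, ← diagSL_mul, diagSL_mul_unip, mul_comm c a, diagSL_mul a c]
    simp only [mul_assoc]
  have e3 : diagSL a * unip x * κ = unip (a * (a * x)) * (diagSL a * κ) := by
    rw [diagSL_mul_unip, mul_assoc]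
  have e4 : archWeight e (expIdele fun v => Real.log (toReal v (c : Adele F))) = archWeight e c :=
    Finset.prod_congr rfl fun v _ => by rw [toReal_expIdele, Real.exp_log (hc0 v)]
  rw [e2, e3, hh.unip_mul, hh.unip_mul, e1, ← mul_assoc, hc κ (hKC hκ), ← mul_assoc,
    archIncl_archPart_diagSL hc0, ← diagSL_mul, mul_comm, diagSL_mul, mul_assoc, apply_expIdele_mul he, e4]

/-- The stabilizer of an eigenfunction, up to the archimedean character of its exponents. -/
def weightStabilizer (e : InfinitePlace F → ℤ) (h : GA F → ℂ) : Subgroup (Adele F)ˣ where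
  carrier := {c | ∀ g, h (diagSL c * g) = (archWeight e c : ℂ) * h g}
  one_mem' := fun g => by rw [diagSL_one, one_mul, map_one, Complex.ofReal_one, one_mul]
  mul_mem' := fun {a b} ha hb g => by
    rw [diagSL_mul, mul_assoc, ha, hb, map_mul]; push_cast; ring
  inv_mem' := fun {a} ha g => by
    have h1 := ha (diagSL a⁻¹ * g)
    rw [← mul_assoc, ← diagSL_mul, mul_inv_cancel, diagSL_one, one_mul] at h1
    have h2 : (archWeight e a⁻¹ : ℂ) * archWeight e a = 1 := by
      rw [← Complex.ofReal_mul, ← map_mul, inv_mul_cancel, map_one, Complex.ofReal_one]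
    rw [h1, ← mul_assoc, h2, one_mul]

theorem isOpen_weightStabilizer (hh : h ∈ boundarySpace k S)
    (he : ∀ v, h ∈ torusEigenspace v (e v)) : IsOpen (weightStabilizer e h : Set (Adele F)ˣ) :=
  Subgroup.isOpen_of_mem_nhds _ (eventually_apply_diagSL_mul hh he)

/-- The exponents are trivial on units: some power of a unit, corrected at the archimedean places,
lies in the open stabilizer, by compactness of the group of ideles of norm one at every place. -/
theorem archWeight_unit (hh : h ∈ boundarySpace k S) (he : ∀ v, h ∈ torusEigenspace v (e v))
    (h0 : h ≠ 0) (u : (𝓞 F)ˣ) :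
    archWeight e (principalIdele (Units.map (algebraMap (𝓞 F) F : 𝓞 F →* F) u)) = 1 := by
  set p : (Adele F)ˣ := principalIdele (Units.map (algebraMap (𝓞 F) F : 𝓞 F →* F) u) with hp
  -- Dividing the unit by its archimedean absolute values gives an idele `p * q` of norm one everywhere.
  set q : (Adele F)ˣ := expIdele fun v => -Real.log |toReal v (p : Adele F)| with hq
  have hqΓ : q ∈ weightStabilizer e h := fun g => apply_expIdele_mul he _ g
  have harch : ∀ v, |toReal v ((p * q : (Adele F)ˣ) : Adele F)| = 1 := fun v => by
    rw [Units.val_mul, map_mul, abs_mul, hq, toReal_expIdele, Real.abs_exp, Real.exp_neg,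
      Real.exp_log (abs_pos.2 (toReal_idele_ne_zero p v))]
    exact mul_inv_cancel₀ (abs_ne_zero.2 (toReal_idele_ne_zero p v))
  have hint : ∀ (w : (𝓞 F)ˣ) v, (algebraMap F (Adele F) ((w : 𝓞 F) : F)).2 v ∈ v.adicCompletionIntegers F :=
    fun w v => (mem_integers_iff_norm _ _).2 (FinitePlace.norm_le_one F v _)
  have hmem : ∀ n : ℕ, ((p * q) ^ n : (Adele F)ˣ) ∈ {c : (Adele F)ˣ | (c : Adele F) ∈ adeleBox F 1 ∧
      ((c⁻¹ : (Adele F)ˣ) : Adele F) ∈ adeleBox F 1} := by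
    have key : ∀ c : (Adele F)ˣ, (∀ v, |toReal v (c : Adele F)| = 1) →
        (∀ v, (c : Adele F).2 v ∈ v.adicCompletionIntegers F) → ∀ n : ℕ,
        ((c ^ n : (Adele F)ˣ) : Adele F) ∈ adeleBox F 1 := by
      intro c h1 h2 n
      refine ⟨fun v => ?_, fun v => ?_⟩
      · rw [norm_eq_abs_toReal, Units.val_pow_eq_pow_val, map_pow, abs_pow, h1, one_pow]
      · rw [Units.val_pow_eq_pow_val]
        exact pow_mem (h2 v) n
    intro n
    refine ⟨key _ harch (fun v => ?_) n, ?_⟩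
    · have : ((p * q : (Adele F)ˣ) : Adele F).2 v = (p : Adele F).2 v := mul_one _
      rw [this]
      exact hint u v
    · rw [← inv_pow]
      refine key _ (fun v => ?_) (fun v => ?_) n
      · have h1 : toReal v (((p * q)⁻¹ : (Adele F)ˣ) : Adele F) * toReal v ((p * q : (Adele F)ˣ) : Adele F) = 1 := by
          rw [← map_mul, Units.inv_mul, map_one]
        have h2 := congrArg abs h1
        rwa [abs_mul, harch, mul_one, abs_one] at h2
      · have h1 : ((p * q)⁻¹ : (Adele F)ˣ) = q⁻¹ * principalIdele (Units.map (algebraMap (𝓞 F) F : 𝓞 F →* F) u⁻¹) := by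
          rw [_root_.mul_inv_rev, hp, map_inv, map_inv]
        have h2 : (((p * q)⁻¹ : (Adele F)ˣ) : Adele F).2 v = (algebraMap F (Adele F) ((u⁻¹ : (𝓞 F)ˣ) : F)).2 v := by
          rw [h1]; exact one_mul _
        rw [h2]
        exact hint u⁻¹ v
  have hdisc : DiscreteTopology ((Adele F)ˣ ⧸ weightStabilizer e h) :=
    QuotientGroup.discreteTopology (isOpen_weightStabilizer hh he)
  have hfinite := ((isCompact_unitBox (F := F) 1).image
    (continuous_quotient_mk' (s := QuotientGroup.leftRel (weightStabilizer e h)))).finite_of_discrete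
  -- Two powers of `p * q` agree modulo the stabilizer, by finiteness of the image of a compact set.
  obtain ⟨m, -, n, -, hmn, heq⟩ := Set.infinite_univ.exists_ne_map_eq_of_mapsTo
    (f := fun n : ℕ => (((p * q) ^ n : (Adele F)ˣ) : (Adele F)ˣ ⧸ weightStabilizer e h))
    (fun n _ => Set.mem_image_of_mem _ (hmem n)) hfinite
  have key : ∀ m n : ℕ, m < n →
      (((p * q) ^ m : (Adele F)ˣ) : (Adele F)ˣ ⧸ weightStabilizer e h) = ((p * q) ^ n : (Adele F)ˣ) →
      archWeight e p = 1 := by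
    intro m n hmn heq
    rw [QuotientGroup.eq] at heq
    have h1 : ((p * q) ^ m)⁻¹ * (p * q) ^ n = p ^ (n - m) * q ^ (n - m) := by
      rw [← mul_pow, ← Nat.add_sub_of_le hmn.le, pow_add, inv_mul_cancel_left, Nat.add_sub_cancel_left]
    rw [h1] at heq
    have h2 : p ^ (n - m) ∈ weightStabilizer e h :=
      ((weightStabilizer e h).mul_mem_cancel_right (pow_mem hqΓ _)).1 heq
    obtain ⟨g, hg⟩ := Function.ne_iff.1 h0
    have h3 := h2 g
    rw [hp, ← map_pow, hh.principal_mul, map_pow, ← hp, map_pow] at h3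
    have h4 : ((archWeight e p ^ (n - m) : ℝ) : ℂ) = 1 := by
      refine mul_right_cancel₀ hg ?_
      rw [one_mul]; exact h3.symm
    have h5 : archWeight e p ^ (n - m) = 1 := by exact_mod_cast h4
    exact (pow_eq_one_iff_of_nonneg (archWeight_pos e p).le (by omega)).1 h5
  rcases lt_or_gt_of_ne hmn with hlt | hlt
  · exact key m n hlt heq
  · exact key n m hlt heq.symm

/-- The exponents of a nonzero eigenfunction are parallel: they are orthogonal to the logarithms of
all units, and by the unit theorem only multiples of the vector `(1, …, 1)` are. -/
theorem exists_parallel_exponent (hh : h ∈ boundarySpace k S)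
    (he : ∀ v, h ∈ torusEigenspace v (e v)) (h0 : h ≠ 0) : ∃ s : ℤ, ∀ v, e v = s := by
  classical
  obtain ⟨w₁, -, hmax⟩ := Finset.exists_max_image (Finset.univ : Finset (InfinitePlace F)) e
    Finset.univ_nonempty
  -- A unit `u` with `|u|_v < 1` for all `v ≠ w₁`, where `e w₁` is the largest exponent: in the vanishing
  -- sum `∑ (e v - e w₁) log |u|_v` all terms are nonnegative.
  obtain ⟨u, hu⟩ := NumberField.Units.dirichletUnitTheorem.exists_unit F w₁
  refine ⟨e w₁, fun w => ?_⟩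
  have h1 := archWeight_unit hh he h0 u
  have hval : ∀ v : InfinitePlace F, |toReal v (principalIdele (Units.map (algebraMap (𝓞 F) F : 𝓞 F →* F) u) : Adele F)| =
      v ((u : 𝓞 F) : F) := fun v => by
    rw [← norm_eq_abs_toReal]; exact norm_algebraMap_infinite v _
  change ∏ v, |toReal v (principalIdele (Units.map (algebraMap (𝓞 F) F : 𝓞 F →* F) u) : Adele F)| ^ e v = 1 at h1
  simp only [hval] at h1
  have hpos : ∀ v : InfinitePlace F, 0 < v ((u : 𝓞 F) : F) := fun v => by
    rw [← hval]; exact abs_pos.2 (toReal_idele_ne_zero _ v)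
  have h2 : ∑ v : InfinitePlace F, (e v : ℝ) * Real.log (v ((u : 𝓞 F) : F)) = 0 := by
    have := congrArg Real.log h1
    rw [Real.log_one, Real.log_prod (fun v _ => (zpow_pos (hpos v) _).ne')] at this
    rw [← this]
    exact Finset.sum_congr rfl fun v _ => (Real.log_zpow _ _).symm
  have h3 : ∑ v : InfinitePlace F, Real.log (v ((u : 𝓞 F) : F)) = 0 := by
    have := NumberField.Units.sum_mult_mul_log u
    rw [← this]
    exact Finset.sum_congr rfl fun v _ => by
      rw [mult_isReal ⟨v, IsTotallyReal.isReal v⟩]; simp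
  have h4 : ∑ v : InfinitePlace F, ((e v : ℝ) - e w₁) * Real.log (v ((u : 𝓞 F) : F)) = 0 := by
    simp only [sub_mul, Finset.sum_sub_distrib, ← Finset.mul_sum, h2, h3]; simp
  have h5 : ∀ v ∈ (Finset.univ : Finset (InfinitePlace F)),
      0 ≤ ((e v : ℝ) - e w₁) * Real.log (v ((u : 𝓞 F) : F)) := by
    intro v _
    by_cases hv : v = w₁
    · subst hv; simp
    · refine mul_nonneg_of_nonpos_of_nonpos ?_ (hu v hv).le
      have := hmax v (Finset.mem_univ v)
      rw [sub_nonpos]; exact_mod_cast this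
  by_cases hw : w = w₁
  · rw [hw]
  · have h6 := (Finset.sum_eq_zero_iff_of_nonneg h5).1 h4 w (Finset.mem_univ w)
    have h7 := (mul_eq_zero.1 h6).resolve_right (hu w hw).ne
    exact_mod_cast sub_eq_zero.1 h7

end Eigenfunctions

/-! ### Smoothness of eigenfunctions -/

section SmoothEigenfunctions

variable {F : Type*} [Field F] [NumberField F] [IsTotallyReal F]

/-- The number `d - ic` attached to the bottom row `(c, d)` of a matrix. -/
def bottomRow (m : Matrix.SpecialLinearGroup (Fin 2) ℝ) : ℂ := (m 1 1 : ℂ) - (m 1 0 : ℂ) * Complex.I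

theorem bottomRow_ne_zero (m : Matrix.SpecialLinearGroup (Fin 2) ℝ) : bottomRow m ≠ 0 := by
  intro h
  have h1 : m 1 1 = 0 := by simpa [bottomRow] using congrArg Complex.re h
  have h2 : m 1 0 = 0 := by simpa [bottomRow] using congrArg Complex.im h
  have hd := m.2
  rw [Matrix.det_fin_two] at hd
  change m 0 0 * m 1 1 - m 0 1 * m 1 0 = 1 at hd
  rw [h1, h2] at hd
  simp at hd

/-- The function on `SL₂(ℝ)` of weight `k` and exponent `e`, equal to `1` at the identity. -/
def realEigenfunction (k e : ℤ) (m : Matrix.SpecialLinearGroup (Fin 2) ℝ) : ℂ :=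
  (‖bottomRow m‖ : ℂ) ^ (-e - k) * bottomRow m ^ k

theorem realEigenfunction_iwasawa (k e : ℤ) (x τ θ : ℝ) :
    realEigenfunction k e (unip x * torusReal τ * rot θ) =
      Complex.exp (e * τ) * Complex.exp (k * θ * Complex.I) := by
  have h1 : bottomRow (unip x * torusReal τ * rot θ) = Complex.exp (-τ) * Complex.exp (θ * Complex.I) := by
    rw [bottomRow, Matrix.SpecialLinearGroup.coe_mul, Matrix.SpecialLinearGroup.coe_mul, torusReal_entries,
      Complex.exp_mul_I]
    simp [unip, rot, Matrix.mul_apply, Fin.sum_univ_two]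
    ring
  have h2 : ‖bottomRow (unip x * torusReal τ * rot θ)‖ = Real.exp (-τ) := by
    rw [h1, norm_mul, Complex.norm_exp_ofReal_mul_I, mul_one, ← Complex.ofReal_neg,
      Complex.norm_exp_ofReal]
  rw [realEigenfunction, h2, h1, Complex.ofReal_exp, ← Complex.exp_int_mul, mul_zpow,
    ← Complex.exp_int_mul, ← Complex.exp_int_mul, ← mul_assoc, ← Complex.exp_add]
  congr 2
  · push_cast; ring
  · ring

theorem contDiffAt_zpow_comp {P 𝕜 : Type*} [NormedAddCommGroup P] [NormedSpace ℝ P] [NormedField 𝕜]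
    [NormedAlgebra ℝ 𝕜] {f : P → 𝕜} {p : P} (hf : ContDiffAt ℝ ∞ f p) (h0 : f p ≠ 0) (n : ℤ) :
    ContDiffAt ℝ ∞ (fun p => f p ^ n) p := by
  cases n with
  | ofNat n => simpa using hf.pow n
  | negSucc n =>
    simp only [zpow_negSucc]
    exact (hf.pow (n + 1)).inv (pow_ne_zero _ h0)

theorem contDiffAt_realEigenfunction (k e : ℤ) {P : Type*} [NormedAddCommGroup P] [NormedSpace ℝ P]
    {H : P → Matrix.SpecialLinearGroup (Fin 2) ℝ} {p : P}
    (hH : ∀ i j, ContDiffAt ℝ ∞ (fun p => (H p).1 i j) p) :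
    ContDiffAt ℝ ∞ (fun p => realEigenfunction k e (H p)) p := by
  have hb : ContDiffAt ℝ ∞ (fun p => bottomRow (H p)) p :=
    (Complex.ofRealCLM.contDiff.contDiffAt.comp p (hH 1 1)).sub
      ((Complex.ofRealCLM.contDiff.contDiffAt.comp p (hH 1 0)).mul contDiffAt_const)
  have hn : ContDiffAt ℝ ∞ (fun p => (‖bottomRow (H p)‖ : ℂ)) p :=
    Complex.ofRealCLM.contDiff.contDiffAt.comp p (hb.norm ℝ (bottomRow_ne_zero _))
  refine (contDiffAt_zpow_comp hn ?_ _).mul (contDiffAt_zpow_comp hb (bottomRow_ne_zero _) _)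
  exact_mod_cast norm_ne_zero_iff.2 (bottomRow_ne_zero _)

/-- The adele with prescribed real archimedean coordinates and vanishing finite part. -/
def realAdele (x : InfinitePlace F → ℝ) : Adele F :=
  ((fun v => (realIso v).symm (x v) : InfiniteAdeleRing F), (0 : FiniteAdeleRing (𝓞 F) F))

theorem archIncl_unip (x : InfinitePlace F → ℝ) :
    (archIncl fun v => unip (x v)) = unip (realAdele x) := by
  refine GA_ext (fun v => ?_) fun i j => ?_
  · rw [archPart_unip, archPart_archIncl]
    congr 1
    exact ((realIso v).apply_symm_apply _).symm
  · fin_cases i <;> fin_cases j <;> rfl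

theorem archIncl_torusReal (t : InfinitePlace F → ℝ) :
    (archIncl fun v => torusReal (t v)) = diagSL (expIdele t) := by
  refine GA_ext (fun v => ?_) fun i j => ?_
  · rw [archPart_diagSL, archPart_archIncl]
    rw [torusReal]
    congr 1
    apply Units.ext
    change _ = toReal v _
    rw [toReal_expIdele]; rfl
  · fin_cases i <;> fin_cases j <;> rfl

variable {k e : InfinitePlace F → ℤ} {S : Set ℤ} {h : GA F → ℂ}

/-- The values of an eigenfunction on an archimedean orbit, from the Iwasawa decomposition. -/
theorem apply_archIncl_mul (hh : h ∈ boundarySpace k S) (he : ∀ v, h ∈ torusEigenspace v (e v))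
    (A : InfinitePlace F → Matrix.SpecialLinearGroup (Fin 2) ℝ) {g : GA F} (hg : ∀ v, archPart g v = 1) :
    h (archIncl A * g) = (∏ v, realEigenfunction (k v) (e v) (A v)) * h g := by
  choose x τ θ hA using fun v => exists_iwasawa_real (A v)
  have hA' : A = (fun v => unip (x v)) * (fun v => torusReal (τ v)) * fun v => rot (θ v) := funext hA
  have hv : ∀ v, realEigenfunction (k v) (e v) (A v) =
      Complex.exp (e v * τ v) * Complex.exp (k v * θ v * Complex.I) := fun v => by
    rw [hA v]; exact realEigenfunction_iwasawa _ _ _ _ _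
  have h1 : archIncl A * g = unip (realAdele x) *
      (diagSL (expIdele τ) * (g * archIncl fun v => rot (θ v))) := by
    rw [← archIncl_comm hg, ← archIncl_torusReal, ← archIncl_unip, hA', archIncl_mul, archIncl_mul]
    simp only [mul_assoc]
  rw [h1, hh.unip_mul, apply_expIdele_mul he, apply_mul_rot hh.weight, archWeight_expIdele]
  simp only [hv]
  rw [Finset.prod_mul_distrib, ← Complex.exp_sum, ← Complex.exp_sum]
  push_cast
  ring

theorem contDiffAt_eigenfunction (hh : h ∈ boundarySpace k S)
    (he : ∀ v, h ∈ torusEigenspace v (e v)) (g : GA F) :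
    ContDiffAt ℝ ∞ (fun x : InfinitePlace F → Fin 3 → ℝ =>
      h (g * archIncl fun v => expSL (slOfCoord (x v)))) 0 := by
  have e1 : (fun x : InfinitePlace F → Fin 3 → ℝ => h (g * archIncl fun v => expSL (slOfCoord (x v)))) =
      fun x => (∏ v, realEigenfunction (k v) (e v)
        ((archPart g * fun v => expSL (slOfCoord (x v))) v)) * h (finPart g) := by
    funext x
    rw [← apply_archIncl_mul hh he _ (archPart_finPart g), archIncl_mul, mul_assoc,
      archIncl_comm (archPart_finPart g), ← mul_assoc, archIncl_mul_finPart]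
  rw [e1]
  have h1 : ∀ v i j, ContDiffAt ℝ ∞ (fun x : InfinitePlace F → Fin 3 → ℝ =>
      ((archPart g * fun v => expSL (slOfCoord (x v))) v).1 i j) 0 :=
    contDiffAt_mul_entry (H := fun _ => archPart g) (fun v i j => contDiffAt_const) fun v i j =>
      (contDiff_exp_entry i j).contDiffAt.comp _ (contDiff_apply _ _ v).contDiffAt
  have h2 : ∀ v, ContDiffAt ℝ ∞ (fun x : InfinitePlace F → Fin 3 → ℝ => realEigenfunction (k v) (e v)
      ((archPart g * fun v => expSL (slOfCoord (x v))) v)) 0 :=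
    fun v => contDiffAt_realEigenfunction _ _ (h1 v)
  exact (contDiffAt_prod fun v _ => h2 v).mul contDiffAt_const

/-- Eigenfunctions are smooth: they are explicit in the archimedean variables. -/
theorem smooth_of_eigenfunction (hh : h ∈ boundarySpace k S)
    (he : ∀ v, h ∈ torusEigenspace v (e v)) : Smooth h where
  locally_arch g := by
    have hc : ContinuousAt (fun p : GA F × GA F => p.1⁻¹ * p.2) (g, g) :=
      (continuous_fst.inv.mul continuous_snd).continuousAt
    rw [ContinuousAt, inv_mul_cancel, nhds_prod_eq] at hc
    have h2 := hc.eventually hh.right_invariant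
    obtain ⟨V, hV, hVV⟩ := (Filter.eventually_prod_self_iff (r := fun x y : GA F =>
      (∀ v, archPart (x⁻¹ * y) v = 1) → ∀ g, h (g * (x⁻¹ * y)) = h g)).1 h2
    refine ⟨V, hV, fun x hx y hy hxy => ?_⟩
    have h1 := hVV x hx y hy (fun v => by
      rw [archPart_mul, archPart_inv, hxy, inv_mul_cancel]) x
    rw [mul_inv_cancel_left] at h1
    exact h1.symm
  arch_smooth g := contDiffAt_eigenfunction hh he g

end SmoothEigenfunctions

/-! ### Hecke characters and induced representations -/

section Characters

variable {F : Type*} [Field F] [NumberField F] [IsTotallyReal F]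

/-- On ideles that are units at all finite places, `|·|^s` is an archimedean weight. -/
theorem ideleAbs_zpow_eq {c : (Adele F)ˣ} (hc : ∀ v, ‖(c : Adele F).2 v‖ = 1) (s : ℤ) :
    ideleAbs c ^ s = archWeight (fun _ => s) c := by
  change _ = ∏ v, |toReal v (c : Adele F)| ^ s
  rw [ideleAbs, finprod_eq_one_of_forall_eq_one hc, mul_one, Finset.prod_zpow]
  congr 1
  exact Finset.prod_congr rfl fun v _ => by
    rw [mult_isReal ⟨v, IsTotallyReal.isReal v⟩, pow_one, norm_eq_abs_toReal]

omit [IsTotallyReal F] in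
theorem eventually_norm_eq_one : ∀ᶠ c : (Adele F)ˣ in 𝓝 1, ∀ v, ‖(c : Adele F).2 v‖ = 1 := by
  have h : ∀ᶠ c : (Adele F)ˣ in 𝓝 1, (c : Adele F).2 ∈ integralAdeles F := by
    have hc : Continuous fun c : (Adele F)ˣ => (c : Adele F).2 :=
      continuous_snd.comp Units.continuous_val
    refine hc.continuousAt.eventually_mem (isOpen_integralAdeles.mem_nhds fun v => one_mem _)
  have h' : ∀ᶠ c : (Adele F)ˣ in 𝓝 1, ((c⁻¹ : (Adele F)ˣ) : Adele F).2 ∈ integralAdeles F := by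
    have hc := continuous_inv (G := (Adele F)ˣ) |>.continuousAt (x := 1)
    rw [ContinuousAt, _root_.inv_one] at hc
    exact hc.eventually h
  filter_upwards [h, h'] with c hc hc' v
  have h1 := (mem_integers_iff_norm v _).1 (hc v)
  have h2 := (mem_integers_iff_norm v _).1 (hc' v)
  have h3 := congrArg norm (idele_snd_mul_inv c v)
  rw [norm_mul, norm_one] at h3
  refine le_antisymm h1 ?_
  rw [← h3]
  exact mul_le_of_le_one_right (norm_nonneg _) h2

/-- The group of ideles acting on `h` from the left through `|·|^s`. -/
def absStabilizer (s : ℤ) (h : GA F → ℂ) : Subgroup (Adele F)ˣ where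
  carrier := {c | ∀ g, h (diagSL c * g) = (ideleAbs c : ℂ) ^ s * h g}
  one_mem' := fun g => by
    have h1 := ideleAbs_principal (1 : Fˣ)
    rw [map_one] at h1
    rw [diagSL_one, one_mul, h1, Complex.ofReal_one, _root_.one_zpow, one_mul]
  mul_mem' := fun {a b} ha hb g => by
    rw [diagSL_mul, mul_assoc, ha, hb, ideleAbs_mul, Complex.ofReal_mul, mul_zpow, mul_assoc]
  inv_mem' := fun {a} ha g => by
    have h1 := ha (diagSL a⁻¹ * g)
    rw [← mul_assoc, ← diagSL_mul, mul_inv_cancel, diagSL_one, one_mul] at h1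
    have h2 : (ideleAbs a⁻¹ : ℂ) * ideleAbs a = 1 := by
      have h3 := ideleAbs_principal (1 : Fˣ)
      rw [map_one, ← inv_mul_cancel a, ideleAbs_mul] at h3
      exact_mod_cast h3
    rw [h1, ← mul_assoc, ← mul_zpow, h2, _root_.one_zpow, one_mul]

variable {k : InfinitePlace F → ℤ} {s : ℤ} {S : Set ℤ} {h : GA F → ℂ}

theorem isOpen_absStabilizer (hh : h ∈ boundarySpace k S) (he : ∀ v, h ∈ torusEigenspace v s) :
    IsOpen (absStabilizer s h : Set (Adele F)ˣ) := by
  refine Subgroup.isOpen_of_mem_nhds _ (g := 1) ?_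
  filter_upwards [eventually_apply_diagSL_mul hh he, eventually_norm_eq_one] with c hc hc1 g
  rw [hc, ← ideleAbs_zpow_eq hc1, Complex.ofReal_zpow]

theorem principalIdele_mem_absStabilizer (hh : h ∈ boundarySpace k S) (x : Fˣ) :
    principalIdele x ∈ absStabilizer s h := fun g => by
  rw [hh.principal_mul, ideleAbs_principal, Complex.ofReal_one, _root_.one_zpow, one_mul]

theorem arch_mem_absStabilizer (he : ∀ v, h ∈ torusEigenspace v s) (c : (Adele F)ˣ)
    (hc : ∀ v, 0 < toReal v (c : Adele F)) (hc1 : (c : Adele F).2 = 1) : c ∈ absStabilizer s h := fun g => by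
  have h1 : c = expIdele fun v => Real.log (toReal v (c : Adele F)) :=
    idele_ext (fun v => by rw [toReal_expIdele, Real.exp_log (hc v)]) hc1
  have h2 : ∀ v, ‖(c : Adele F).2 v‖ = 1 := fun v => by
    rw [hc1]; exact norm_one
  rw [← Complex.ofReal_zpow, ideleAbs_zpow_eq h2, h1, apply_expIdele_mul he]

/-- The Hecke character defined by a character of the quotient of the ideles by an open subgroup
containing the principal and the totally positive archimedean ideles. -/
def heckeCharacterOfQuotient (Γ : Subgroup (Adele F)ˣ) (hopen : IsOpen (Γ : Set (Adele F)ˣ))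
    (hprin : ∀ x : Fˣ, principalIdele x ∈ Γ)
    (harch : ∀ a : (Adele F)ˣ, (∀ v, 0 < toReal v (a : Adele F)) → (a : Adele F).2 = 1 → a ∈ Γ)
    (χ : ((Adele F)ˣ ⧸ Γ) →* ℂˣ) : HeckeCharacter F where
  toHom := χ.comp (QuotientGroup.mk' Γ)
  continuous_toHom := by
    have := QuotientGroup.discreteTopology hopen
    exact (continuous_of_discreteTopology (f := χ)).comp continuous_quotient_mk'
  map_principal x := (congrArg χ ((QuotientGroup.eq_one_iff _).2 (hprin x))).trans (map_one χ)
  map_arch_pos a h1 h2 := (congrArg χ ((QuotientGroup.eq_one_iff _).2 (harch a h1 h2))).trans (map_one χ)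

variable (F) in
/-- The span of all the spaces `Ind(μ |·|^s)`, with `s` an integer. -/
def indSpan : Submodule ℂ (GA F → ℂ) :=
  Submodule.span ℂ {f | ∃ (μ : HeckeCharacter F) (s : ℤ), f ∈ Ind μ (s : ℂ)}

theorem Ind_smul {μ : HeckeCharacter F} {s : ℂ} {f : GA F → ℂ} (hf : f ∈ Ind μ s) (c : ℂ) :
    c • f ∈ Ind μ s := by
  refine ⟨hf.1.smul c, hf.2.1.smul c, fun a x g => ?_⟩
  rw [Pi.smul_apply, Pi.smul_apply, hf.2.2, smul_eq_mul, smul_eq_mul]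
  ring

/-- Fourier inversion at the identity of a finite abelian group: evaluation at `1` is a sum of
functionals `∑ q, c q * T q` that are equivariant under translation through characters `χ`. -/
theorem exists_character_decomposition.{u} (G : Type u) [CommGroup G] [Fintype G] :
    ∃ (ι : Type u) (_ : Fintype ι) (χ : ι → G →* ℂˣ) (c : ι → G → ℂ),
      (∀ T : G → ℂ, T 1 = ∑ i, ∑ q, c i q * T q) ∧
        ∀ i q a, (χ i a : ℂ) * c i (q * a) = c i q := by
  classical
  refine ⟨AddChar (Additive G) ℂ, inferInstance, fun χ => χ.toMonoidHom.toHomUnits,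
    fun χ q => (Fintype.card (Additive G) : ℂ)⁻¹ * χ (-Additive.ofMul q), fun T => ?_, fun χ q a => ?_⟩
  · have h1 : ∀ q : G, ∑ χ : AddChar (Additive G) ℂ, χ (-Additive.ofMul q) =
        if q = 1 then (Fintype.card (Additive G) : ℂ) else 0 := fun q => by
      rw [AddChar.sum_apply_eq_ite]
      exact if_congr neg_eq_zero rfl rfl
    rw [Finset.sum_comm, Finset.sum_eq_single (1 : G)]
    · rw [← Finset.sum_mul, ← Finset.mul_sum, h1, if_pos rfl,
        inv_mul_cancel₀ (Nat.cast_ne_zero.2 Fintype.card_ne_zero), one_mul]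
    · intro q _ hq
      rw [← Finset.sum_mul, ← Finset.mul_sum, h1, if_neg hq, mul_zero, zero_mul]
    · exact fun h => absurd (Finset.mem_univ _) h
  · change χ (Additive.ofMul a) * _ = _
    rw [mul_left_comm, ← AddChar.map_add_eq_mul]
    congr 2
    rw [ofMul_mul]
    abel

/-- An eigenfunction of parallel exponent is a sum of elements of induced representations: the ideles
act on it, up to a power of the absolute value, through a finite abelian group. -/
theorem mem_indSpan (hh : h ∈ boundarySpace k S) (he : ∀ v, h ∈ torusEigenspace v s) : h ∈ indSpan F := by
  classical
  set Γ := absStabilizer s h with hΓ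
  have hopen := isOpen_absStabilizer hh he
  have hprin : ∀ x : Fˣ, principalIdele x ∈ Γ := principalIdele_mem_absStabilizer hh
  have harch : ∀ a : (Adele F)ˣ, (∀ v, 0 < toReal v (a : Adele F)) → (a : Adele F).2 = 1 → a ∈ Γ :=
    arch_mem_absStabilizer he
  have hfinite : Finite ((Adele F)ˣ ⧸ Γ) := finiteIndex_of_isOpen Γ hopen hprin harch
  have : Fintype ((Adele F)ˣ ⧸ Γ) := Fintype.ofFinite ((Adele F)ˣ ⧸ Γ)
  have habs : ∀ a : (Adele F)ˣ, (ideleAbs a : ℂ) ≠ 0 := fun a => by exact_mod_cast (ideleAbs_pos a).ne'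
  -- The translate of `h` by `c`, normalized by `|c|^{-s}`, depends only on the class of `c` modulo `Γ`.
  let t : (Adele F)ˣ → GA F → ℂ := fun c g => (ideleAbs c : ℂ) ^ (-s) * h (diagSL c * g)
  have ht : ∀ c c' : (Adele F)ˣ, (c : ((Adele F)ˣ ⧸ Γ)) = c' → t c = t c' := by
    intro c c' hcc
    have h1 : c⁻¹ * c' ∈ Γ := QuotientGroup.eq.1 hcc
    have h2 : c' = c⁻¹ * c' * c := by rw [mul_comm, mul_inv_cancel_left]
    funext g
    simp only [t]
    conv_rhs => rw [h2, diagSL_mul, mul_assoc (diagSL (c⁻¹ * c')), h1 _, ideleAbs_mul, Complex.ofReal_mul, mul_zpow]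
    have h3 := habs (c⁻¹ * c')
    rw [zpow_neg (ideleAbs (c⁻¹ * c') : ℂ)]
    field_simp
  have htmul : ∀ c a g, t c (diagSL a * g) = (ideleAbs a : ℂ) ^ s * t (c * a) g := by
    intro c a g
    have h3 := habs a
    simp only [t]
    rw [ideleAbs_mul, Complex.ofReal_mul, mul_zpow, diagSL_mul, mul_assoc (diagSL c), zpow_neg (ideleAbs a : ℂ)]
    field_simp
  let T : ((Adele F)ˣ ⧸ Γ) → GA F → ℂ := fun q => t q.out
  have hT : ∀ c : (Adele F)ˣ, T (c : ((Adele F)ˣ ⧸ Γ)) = t c := fun c => ht _ _ (Quotient.out_eq _)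
  obtain ⟨ι, _, χ, co, hco, hχ⟩ := exists_character_decomposition ((Adele F)ˣ ⧸ Γ)
  let p : ι → GA F → ℂ := fun i => ∑ q, co i q • T q
  have hsum : h = ∑ i, p i := by
    funext g
    have h2 : T (1 : ((Adele F)ˣ ⧸ Γ)) g = h g := by
      have h3 := hT 1
      have h4 := ideleAbs_principal (1 : Fˣ)
      rw [map_one] at h4
      rw [QuotientGroup.mk_one] at h3
      rw [h3]
      simp only [t]
      rw [h4, diagSL_one, one_mul, Complex.ofReal_one, _root_.one_zpow, one_mul]
    rw [Finset.sum_apply, ← h2, hco (fun q => T q g)]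
    simp only [p, Finset.sum_apply, Pi.smul_apply, smul_eq_mul]
  rw [hsum]
  -- The normalization of `Ind` contributes `|a|^{s + 1}`, so the exponent `s` occurs in `Ind (μ |·|^{s - 1})`.
  refine Submodule.sum_mem _ fun i _ => Submodule.subset_span
    ⟨heckeCharacterOfQuotient Γ hopen hprin harch (χ i), s - 1, ?_, ?_, ?_⟩
  · refine Submodule.sum_mem (smoothSpace F) fun q _ => Submodule.smul_mem _ _ (Submodule.smul_mem _
      ((ideleAbs q.out : ℂ) ^ (-s)) (x := fun g => h (diagSL q.out * g)) ?_)
    exact (smooth_of_eigenfunction hh he).comp_mul_left _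
  · refine Submodule.sum_mem (kFiniteSpace F) fun q _ => Submodule.smul_mem _ _ (Submodule.smul_mem _
      ((ideleAbs q.out : ℂ) ^ (-s)) (x := fun g => h (diagSL q.out * g)) ?_)
    exact hh.kFinite.comp_mul_left _
  · intro a x g
    have h1 : ((s - 1 : ℤ) : ℂ) + 1 = ((s : ℤ) : ℂ) := by push_cast; ring
    have htu : ∀ (q : ((Adele F)ˣ ⧸ Γ)) g, T q (unip x * g) = T q g := by
      intro q g
      simp only [T, t]
      rw [← mul_assoc, diagSL_mul_unip, mul_assoc, hh.unip_mul]
    have hTa : ∀ (q : ((Adele F)ˣ ⧸ Γ)) g, T q (diagSL a * g) = (ideleAbs a : ℂ) ^ s * T (q * (a : ((Adele F)ˣ ⧸ Γ))) g := by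
      intro q g
      obtain ⟨c, rfl⟩ := QuotientGroup.mk_surjective q
      rw [← QuotientGroup.mk_mul, hT, hT, htmul]
    rw [h1, Complex.cpow_intCast]
    change p i (diagSL a * unip x * g) = (χ i (a : (Adele F)ˣ ⧸ Γ) : ℂ) * _ * p i g
    simp only [p, Finset.sum_apply, Pi.smul_apply, smul_eq_mul]
    simp only [mul_assoc (diagSL a), hTa, htu]
    rw [← Equiv.sum_comp (Equiv.mulRight (a : (Adele F)ˣ ⧸ Γ)) (fun q => co i q * T q g), Finset.mul_sum]
    refine Finset.sum_congr rfl fun q _ => ?_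
    rw [Equiv.coe_mulRight, ← hχ i q a]
    ring

theorem boundarySpace_le_indSpan {S : Finset ℤ} : boundarySpace k (S : Set ℤ) ≤ indSpan F := by
  intro h hh
  refine (iSup_le fun e => ?_ : _ ≤ indSpan F) (mem_iSup_torusEigenspace hh)
  rintro p ⟨hp, hpe⟩
  have hpe' : ∀ v, p ∈ torusEigenspace v (e v) := (Submodule.mem_iInf _).1 hpe
  by_cases h0 : p = 0
  · rw [h0]; exact zero_mem _
  · obtain ⟨s, hs⟩ := exists_parallel_exponent hp hpe' h0
    exact mem_indSpan hp fun v => hs v ▸ hpe' v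

end Characters

/-! ### The constant term of a nearly holomorphic form -/

section ConstantTerm

variable {F : Type*} [Field F] [NumberField F] [IsTotallyReal F]
  [MeasurableSpace (AdeleQuot F)] [BorelSpace (AdeleQuot F)]
  (dn : Measure (AdeleQuot F)) [dn.IsAddHaarMeasure]

omit [MeasurableSpace (AdeleQuot F)] [BorelSpace (AdeleQuot F)] in
theorem mem_formSpace_of_isNearlyHolomorphic {φ : GA F → ℂ} (hφ : IsAutomorphicForm φ)
    (hnh : IsNearlyHolomorphic φ) : ∃ m, φ ∈ formSpace F m := by
  classical
  obtain ⟨m, -, hm⟩ := hnh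
  refine ⟨m, mem_formSpace.2 ⟨⟨hφ.smooth, fun v => ?_⟩, hφ.left_invariant, hφ.kFinite⟩⟩
  apply Subtype.ext
  rw [lowerAt_pow_coe]
  refine hm _ List.length_replicate fun X hX => ?_
  rw [List.eq_of_mem_replicate hX]
  intro w _
  by_cases hw : w = v
  · subst hw
    rw [Pi.single_eq_same]
    exact Submodule.mem_span_singleton_self _
  · rw [Pi.single_eq_of_ne hw]
    exact zero_mem _

theorem unipAverage_mem_indSpan {m : ℕ} {φ : GA F → ℂ} (hφ : φ ∈ formSpace F m) :
    ∃ hu : φ ∈ unipInvariantSpace F, unipAverage dn ⟨φ, hu⟩ ∈ indSpan F := by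
  classical
  have key : φ ∈ ((indSpan F).comap (unipAverage dn)).map (unipInvariantSpace F).subtype := by
    refine (iSup_le fun k => ?_ : _ ≤ ((indSpan F).comap (unipAverage dn)).map
      (unipInvariantSpace F).subtype) (mem_iSup_weight hφ)
    rintro ψ ⟨hψ, hk⟩
    obtain ⟨⟨hs, -⟩, h2, -⟩ := mem_formSpace.1 hψ
    have hu := mem_unipInvariantSpace hs h2
    let S : Finset ℤ := Finset.univ.biUnion fun v : InfinitePlace F =>
      (Finset.range m).image fun i : ℕ => k v - 2 * (i : ℤ)
    refine ⟨⟨ψ, hu⟩, boundarySpace_le_indSpan (k := k) (S := S) ?_, rfl⟩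
    refine unipAverage_mem_boundarySpace dn hψ ((Submodule.mem_iInf _).1 hk) (fun v i hi => ?_) hu
    exact Finset.mem_biUnion.2 ⟨v, Finset.mem_univ v, Finset.mem_image.2 ⟨i, Finset.mem_range.2 hi, rfl⟩⟩
  obtain ⟨⟨ψ, hu⟩, h1, rfl⟩ := key
  exact ⟨hu, h1⟩

theorem constantTerm_eq_unipAverage {φ : GA F → ℂ} (hφ : IsAutomorphicForm φ)
    (hu : φ ∈ unipInvariantSpace F) : constantTerm dn φ hφ = unipAverage dn ⟨φ, hu⟩ := by
  funext g
  rw [constantTerm, unipAverage_apply]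
  congr 1
  funext q
  conv_lhs => rw [← Quotient.out_eq q]
  rfl

end ConstantTerm

end NearlyHolomorphic

end

open NearlyHolomorphic in
theorem proposition3p9 {F : Type*} [Field F] [NumberField F] [NumberField.IsTotallyReal F]
    [MeasurableSpace (AdeleQuot F)] [BorelSpace (AdeleQuot F)]
    (dn : MeasureTheory.Measure (AdeleQuot F)) [dn.IsAddHaarMeasure]
    (φ : GA F → ℂ) (hφ : IsAutomorphicForm φ) (hnh : IsNearlyHolomorphic φ) :
    ∃ (l : ℕ) (μ : Fin l → HeckeCharacter F) (s : Fin l → ℤ) (f : Fin l → GA F → ℂ),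
      (∀ i, f i ∈ Ind (μ i) (s i : ℂ)) ∧
        ∀ g : GA F, constantTerm dn φ hφ g = ∑ i, f i g := by
  obtain ⟨m, hm⟩ := mem_formSpace_of_isNearlyHolomorphic hφ hnh
  obtain ⟨hu, hD⟩ := unipAverage_mem_indSpan dn hm
  rw [← constantTerm_eq_unipAverage dn hφ hu, indSpan, Submodule.mem_span_set'] at hD
  obtain ⟨l, c, f, hf⟩ := hD
  choose μ s hμ using fun i => (f i).2
  refine ⟨l, μ, s, fun i => c i • (f i).1, fun i => Ind_smul (hμ i) (c i), fun g => ?_⟩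
  rw [← hf, Finset.sum_apply]
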